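/- Conventions. A probabilistic Turing machine (PTM) is a multi-tape Turing machine over the tape alphabet {blank, 0, 1}, with an arbitrary finite number of read-write tapes (one of them holds the input and one holds the advice, if any), a write-only output tape, and a tape of random bits from which one fresh bit is read in each step. $|M|$ is the length of a fixed standard binary encoding of the machine $M$ (its transition table), and $\log$ is to base $2$. $M_{\le t}(a)$ is the random variable giving the content of the output tape of $M$ after $t$ steps on input $a$ (or its final content if $M$ halts earlier). For $x\in\{0,1\}^*$, $$\mathsf{rKt}(x)=\min\{\,|M|+|a|+\lceil\log t\rceil \;:\; M \text{ a PTM},\ a\in\{0,1\}^*,\ t\ge 1,\ \Pr[M_{\le t}(a)=x]\ge 2/3\,\}.$$ A function $t:\mathbb N\to\mathbb N$ is constructive if some deterministic machine, on input $1^n$, halts within $O(t(n))$ steps and outputs $t(n)$ in binary. $\mathsf{BPTIME}[t(n)]/a(n)$ is the class of languages $L\subseteq\{0,1\}^*$ for which there are a PTM $M$ and advice strings $\alpha_n$ with $|\alpha_n|=a(n)$ such that, for every $n$ and every $x\in\{0,1\}^n$, $M$ on input $x$ with advice $\alpha_n$ halts within $O(t(n))$ steps on every random string and outputs $L(x)$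 with probability at least $2/3$ (nothing is required for other advice strings); $\mathsf{BPTIME}[t(n)]$ is the same class without advice. Here a time bound $O(s(n))$ means a bound $c\cdot s(n)+c$ with a constant $c$. A language is in $\mathsf{i.o.}\mathcal C$ if it agrees on all inputs of length $n$, for infinitely many $n$, with some language in $\mathcal C$. Theorem. The following statements are equivalent. (1) There are a constant $\varepsilon>0$ and a randomized algorithm (a PTM) $A$ that, given $m$ (as $1^m$), runs in time $2^{O(m)}$ (that is, at most $2^{c(m+1)}$ steps for a constant $c$) on every random string and, for every $m$, outputs with probability at least $2/3$ a fixed string $w_m\in\{0,1\}^m$ such that $\mathsf{rKt}(w_m)\ge\varepsilon m$. (2) There are constants $k\ge1$ (an integer) and $\lambda>0$ such that, for every constructive function $t:\mathbb N\to\mathbb N$ with $n\le t(n)\le 2^{\lambda 2^n}$ for all sufficiently large $n$, there is a language $L\in\mathsf{BPTIME}[t(n)^k]$ such that $L\notin\mathsf{i.o.BPTIME}[t(n)]/\lfloor\log t(n)\rfloor$. -/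

import Mathlib

/-- What a probabilistic Turing machine with `k` tapes and states `0, …, q - 1` does in one step:
the next state (`none` means halting), the symbol written on each tape, the head move on each tape
(`none` means that the head stays), and the bit (if any) appended to the write-only output tape. -/
structure PTMAction (k q : ℕ) where
  next : Option (Fin q)
  write : Fin k → Option Bool
  move : Fin k → Option Turing.Dir
  emit : Option Bool

/-- A probabilistic multi-tape Turing machine. The tape alphabet is `{blank, 0, 1} = Option Bool`.
There are `extraTapes + 2` two-way infinite read-write tapes (tape `0` holds the input, tape `1`
holds the advice, the others are blank at the start), a one-way write-only output tape, and a tape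
of random bits, from which one fresh bit is read in each step. State `0` is the initial state.
Larger alphabets need no extra steps, since the number of tapes is arbitrary. -/
structure PTM where
  extraTapes : ℕ
  extraStates : ℕ
  δ : Fin (extraStates + 1) → (Fin (extraTapes + 2) → Option Bool) → Bool →
    PTMAction (extraTapes + 2) (extraStates + 1)

namespace PTM

/-- A configuration; `state = none` means that the machine has halted. -/
structure Cfg (M : PTM) where
  state : Option (Fin (M.extraStates + 1))
  tape : Fin (M.extraTapes + 2) → Turing.Tape (Option Bool)
  out : List Bool

/-- The initial configuration on input `x` with advice `α`: all heads are on the first symbol. -/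
def init (M : PTM) (x α : List Bool) : M.Cfg where
  state := some 0
  tape := fun i =>
    if i = 0 then Turing.Tape.mk₁ (x.map some)
    else if i = 1 then Turing.Tape.mk₁ (α.map some)
    else Turing.Tape.mk₁ []
  out := []

/-- Move the head of a tape, or leave it in place. -/
def moveHead (T : Turing.Tape (Option Bool)) : Option Turing.Dir → Turing.Tape (Option Bool)
  | none => T
  | some d => T.move d

/-- One step, reading the random bit `b`. A halted machine does not change any more. -/
def step (M : PTM) (c : M.Cfg) (b : Bool) : M.Cfg :=
  match c.state with
  | none => c
  | some q =>
    let a := M.δ q (fun i => (c.tape i).head) b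
    { state := a.next
      tape := fun i => moveHead ((c.tape i).write (a.write i)) (a.move i)
      out := c.out ++ a.emit.toList }

/-- The configuration after `T` steps on input `x` with advice `α`, when `r` holds the first `T`
bits of the random tape. -/
def run (M : PTM) (x α : List Bool) {T : ℕ} (r : Fin T → Bool) : M.Cfg :=
  (List.ofFn r).foldl M.step (M.init x α)

/-- On input `x` with advice `α`, the machine halts within `T` steps, whatever the random bits. -/
def HaltsWithin (M : PTM) (x α : List Bool) (T : ℕ) : Prop :=
  ∀ r : Fin T → Bool, (M.run x α r).state = none

/-- The probability, over the random bits, that the content of the output tape is `y` after `T`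
steps on input `x` with advice `α` (or when the machine halted, if it did so earlier). -/
noncomputable def outputProb (M : PTM) (x α : List Bool) (T : ℕ) (y : List Bool) : ℝ :=
  (Nat.card {r : Fin T → Bool // (M.run x α r).out = y} : ℝ) / 2 ^ T

/-- The machine does not use its random bits. -/
def Deterministic (M : PTM) : Prop :=
  ∀ q s b b', M.δ q s b = M.δ q s b'

/-! ### Binary encoding of machines

`1^extraTapes 0 1^extraStates 0`, followed by the table of the transition function in
lexicographic order, each entry in a self-delimiting code. -/

/-- Two bits for a tape symbol. -/
def encodeSymbol : Option Bool → List Bool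
  | none => [false, false]
  | some b => [true, b]

/-- Two bits for a head move. -/
def encodeMove : Option Turing.Dir → List Bool
  | none => [false, false]
  | some .left => [true, false]
  | some .right => [true, true]

/-- Halting is `0`, and state `i` is `1^(i+1) 0`. -/
def encodeState {q : ℕ} : Option (Fin q) → List Bool
  | none => [false]
  | some i => List.replicate (i.val + 1) true ++ [false]

def encodeAction {k q : ℕ} (a : PTMAction k q) : List Bool :=
  encodeState a.next
    ++ (List.ofFn fun i => encodeSymbol (a.write i) ++ encodeMove (a.move i)).flatten
    ++ encodeSymbol a.emit

/-- All `k`-tuples of tape symbols in lexicographic order. -/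
def tuples : (k : ℕ) → List (Fin k → Option Bool)
  | 0 => [Fin.elim0]
  | k + 1 => [none, some false, some true].flatMap fun s => (tuples k).map (Fin.cons s)

/-- The binary encoding of a machine. -/
def encode (M : PTM) : List Bool :=
  List.replicate M.extraTapes true ++ [false]
    ++ List.replicate M.extraStates true ++ [false]
    ++ (List.finRange (M.extraStates + 1)).flatMap fun q =>
        (tuples (M.extraTapes + 2)).flatMap fun s =>
          [false, true].flatMap fun b => encodeAction (M.δ q s b)

end PTM

/-- Randomized time-bounded Kolmogorov complexity with success probability `2/3`: the least
`|M| + |a| + ⌈log₂ t⌉` such that `M`, run for `t` steps on input `a`, has `x` on its output tape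
with probability at least `2/3`. -/
noncomputable def rKt (x : List Bool) : ℕ :=
  sInf {s : ℕ | ∃ (M : PTM) (a : List Bool) (t : ℕ), 1 ≤ t ∧ 2 / 3 ≤ M.outputProb a [] t x ∧
    s = M.encode.length + a.length + Nat.clog 2 t}

/-- Time-constructibility: some deterministic machine, on input `1^n`, halts within `O(t(n))` steps
and outputs `t(n)` in binary. -/
def TimeConstructible (t : ℕ → ℕ) : Prop :=
  ∃ M : PTM, M.Deterministic ∧ ∃ c : ℕ, ∀ n,
    M.HaltsWithin (List.replicate n true) [] (c * t n + c) ∧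
    ∀ r : Fin (c * t n + c) → Bool, (M.run (List.replicate n true) [] r).out = (t n).bits

open Classical in
/-- On input `x` with advice `α`, the machine `M` always halts within `T` steps, and it outputs the
bit telling whether `x ∈ L` with probability at least `2/3`. -/
def PTM.DecidesAt (M : PTM) (L : Language Bool) (x α : List Bool) (T : ℕ) : Prop :=
  M.HaltsWithin x α T ∧ 2 / 3 ≤ M.outputProb x α T [decide (x ∈ L)]

/-- `BPTIME[t]/a`: bounded-error probabilistic time `O(t(n))` with `a(n)` bits of advice, which
depend on the input length only. Nothing is asked of the machine on other advice. -/
def BPTIMEAdvice (t a : ℕ → ℕ) : Set (Language Bool) :=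
  {L | ∃ (M : PTM) (c : ℕ) (α : ℕ → List Bool), (∀ n, (α n).length = a n) ∧
    ∀ x : List Bool, M.DecidesAt L x (α x.length) (c * t x.length + c)}

/-- `BPTIME[t]`: bounded-error probabilistic time `O(t(n))`. -/
def BPTIME (t : ℕ → ℕ) : Set (Language Bool) :=
  {L | ∃ (M : PTM) (c : ℕ), ∀ x : List Bool, M.DecidesAt L x [] (c * t x.length + c)}

/-- `i.o.C`: the languages that agree with some language in `C` on infinitely many input
lengths. -/
def infinitelyOften (C : Set (Language Bool)) : Set (Language Bool) :=
  {L | ∃ L' ∈ C, ∃ᶠ n in Filter.atTop, ∀ x : List Bool, x.length = n → (x ∈ L ↔ x ∈ L')}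

/-!
Both implications identify strings `w` with (parts of) truth tables of languages: the entries of `w`
tell which strings of length `n` belong to the language.

*From a construction to a hierarchy.* Let `A` construct strings of large `rKt` complexity. For a
constructive `t`, the hard language has, on inputs of length `n`, the truth table that begins with
the string `w` which `A` constructs for length `m = C * log (t n)`. As `A` runs for `2 ^ O(m)` steps,
this takes time polynomial in `t n`, with an exponent that depends on `A` and `C` only
(`exists_hierarchy_machine`). Suppose that some machine `M` with `log (t n)` bits of advice decides
the language in time `O(t n)` on inputs of length `n`. A machine that gets `n` and the advice and
evaluates `M`, with majority votes, on the first `m` inputs (`exists_compressing_machine`) shows that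
`rKt w ≤ c₀ * log (t n) + O(1)`. The constant `c₀` is independent of `M`, since all machines are run by
one universal machine with polynomial overhead. For large `C` this contradicts `rKt w ≥ ε * m`.

*From a hierarchy to a construction.* Apply the hierarchy to `t n = 2 ^ 2 ^ (n - j)`, with `j` so large
that `t n ≤ 2 ^ (lam * 2 ^ n)`. For `n = log m`, a machine can compute the truth table `w` of length
`m` of the hard language with majority votes in time `2 ^ O(m)` (`exists_truthTable_machine`).
A program for `w` of complexity much smaller than `log (t n) = 2 ^ (n - j)` would be an advice string
with which the language can be decided in time `t n` by simulation and lookup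
(`exists_advice_machine`, `exists_lt_mul_rKt`). As this happens for finitely many `n` only,
`rKt w ≥ ε * m`.

Machines are obtained from a small language of programs over stacks (`Prog`), compiled to Turing
machines in `Prog.exists_machine`. On top of it, `PolyTime` and `Transforms` treat polynomial-time
functions on binary trees (`SExp`), closed under composition, case distinction, and bounded loops;
in this calculus the universal machine `SExp.simRun` is a fold of the step function `SExp.simStep`.
`Transforms.exists_machine` turns a pair of transformations, one before and one after a number of
random bits is drawn, into a machine.
-/

/-! ### Stack programs -/

/-- An elementary operation on seven stacks of bits and an output tape. -/
inductive StackOp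
  | skip
  | push (i : Fin 7) (b : Bool)
  | pop (i : Fin 7)
  | emit (b : Bool)

/-- The contents of the seven stacks, and of the output tape. -/
abbrev Mem := (Fin 7 → List Bool) × List Bool

/-- The effect of an operation on the memory. -/
def StackOp.apply : StackOp → Mem → Mem
  | .skip, m => m
  | .push i b, m => (Function.update m.1 i (b :: m.1 i), m.2)
  | .pop i, m => (Function.update m.1 i (m.1 i).tail, m.2)
  | .emit b, m => (m.1, m.2 ++ [b])

/-- A deterministic program on stacks: a finite control that sees the tops of the stacks and in each
step performs one operation. The next state `none` means that the program is left. -/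
structure Prog where
  σ : Type
  fin : Fintype σ
  start : σ
  δ : σ → (Fin 7 → Option Bool) → StackOp × Option σ

namespace Prog

/-- One step of a program, on pairs of a state and the memory. -/
def step (p : Prog) : Option p.σ × Mem → Option p.σ × Mem
  | (none, m) => (none, m)
  | (some q, m) =>
    ((p.δ q fun i => (m.1 i).head?).2, (p.δ q fun i => (m.1 i).head?).1.apply m)

/-- Started on `m`, the program is left with memory `m'` after at most `n` steps. -/
def Ex (p : Prog) (m : Mem) (n : ℕ) (m' : Mem) : Prop :=
  p.step^[n] (some p.start, m) = (none, m')

lemma step_none (p : Prog) (n : ℕ) (m : Mem) : p.step^[n] (none, m) = (none, m) := by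
  induction n with
  | zero => rfl
  | succ n ih => rw [Function.iterate_succ_apply]; exact ih

lemma Ex.mono {p : Prog} {m m' : Mem} {n n' : ℕ} (h : p.Ex m n m') (hn : n ≤ n') :
    p.Ex m n' m' := by
  obtain ⟨k, rfl⟩ := Nat.exists_eq_add_of_le hn
  unfold Ex at *
  rw [Nat.add_comm, Function.iterate_add_apply, h, step_none]

lemma Ex.congr {p : Prog} {m m' m'' : Mem} {n : ℕ} (h : p.Ex m n m') (e : m' = m'') :
    p.Ex m n m'' := e ▸ h

/-- A program `p` that is embedded in the control of `P`, its exit being redirected to `ex`, runs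
inside `P` as it does alone. -/
lemma embed {p P : Prog} (f : p.σ → P.σ) (ex : Option P.σ)
    (h : ∀ q s, P.δ (f q) s = ((p.δ q s).1, (p.δ q s).2.elim ex (fun q' => some (f q'))))
    {n : ℕ} {q : p.σ} {m m' : Mem} (hr : p.step^[n] (some q, m) = (none, m')) :
    ∃ k ≤ n, P.step^[k] (some (f q), m) = (ex, m') := by
  induction n generalizing q m with
  | zero => simp at hr
  | succ n ih =>
    rw [Function.iterate_succ_apply] at hr
    have h1 := h q fun i => (m.1 i).head?
    rcases h2 : (p.δ q fun i => (m.1 i).head?).2 with _ | q'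
    · refine ⟨1, by omega, ?_⟩
      rw [step, h2, step_none] at hr
      rw [Function.iterate_one, step, h1, h2]
      simpa using hr
    · rw [step, h2] at hr
      obtain ⟨k, hk, hk'⟩ := ih hr
      refine ⟨k + 1, by omega, ?_⟩
      rw [Function.iterate_succ_apply, step, h1, h2]
      exact hk'

/-- The program performing one operation. -/
def op (o : StackOp) : Prog := ⟨Unit, inferInstance, (), fun _ _ => (o, none)⟩

lemma Ex.of_op {o : StackOp} {m m' : Mem} (h : o.apply m = m') : (op o).Ex m 1 m' :=
  congrArg _ h

/-- `p` followed by `q`. -/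
def seq (p q : Prog) : Prog where
  σ := p.σ ⊕ q.σ
  fin := have := p.fin; have := q.fin; inferInstance
  start := .inl p.start
  δ := fun x s => match x with
    | .inl a => ((p.δ a s).1, (p.δ a s).2.elim (some (.inr q.start)) fun a' => some (.inl a'))
    | .inr a => ((q.δ a s).1, (q.δ a s).2.elim none fun a' => some (.inr a'))

lemma Ex.seq {p q : Prog} {m m' m'' : Mem} {n n' : ℕ} (h : p.Ex m n m') (h' : q.Ex m' n' m'') :
    (p.seq q).Ex m (n + n') m'' := by
  obtain ⟨k, hk, e⟩ := embed (P := p.seq q) Sum.inl (some (.inr q.start)) (fun _ _ => rfl) h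
  obtain ⟨k', hk', e'⟩ := embed (P := p.seq q) Sum.inr none (fun _ _ => rfl) h'
  refine Ex.mono (n := k' + k) ?_ (by omega)
  unfold Ex
  rw [Function.iterate_add_apply]
  exact (congrArg _ e).trans e'

/-- Run `p` if the top of stack `i` satisfies `t`, and `q` otherwise. -/
def ifHd (i : Fin 7) (t : Option Bool → Bool) (p q : Prog) : Prog where
  σ := Option (p.σ ⊕ q.σ)
  fin := have := p.fin; have := q.fin; inferInstance
  start := none
  δ := fun x s => match x with
    | none => (.skip, if t (s i) then some (some (.inl p.start)) else some (some (.inr q.start)))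
    | some (.inl a) => ((p.δ a s).1, (p.δ a s).2.elim none fun a' => some (some (.inl a')))
    | some (.inr a) => ((q.δ a s).1, (q.δ a s).2.elim none fun a' => some (some (.inr a')))

lemma Ex.ifHd_pos {i : Fin 7} {t : Option Bool → Bool} {p q : Prog} {m m' : Mem} {n : ℕ}
    (ht : t (m.1 i).head? = true) (h : p.Ex m n m') : (ifHd i t p q).Ex m (n + 1) m' := by
  obtain ⟨k, hk, e⟩ := embed (P := ifHd i t p q) (fun a => some (.inl a)) none (fun _ _ => rfl) h
  refine Ex.mono (n := k + 1) ?_ (by omega)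
  unfold Ex
  rw [Function.iterate_succ_apply, ← e]
  simp [step, ifHd, ht, StackOp.apply]

lemma Ex.ifHd_neg {i : Fin 7} {t : Option Bool → Bool} {p q : Prog} {m m' : Mem} {n : ℕ}
    (ht : t (m.1 i).head? = false) (h : q.Ex m n m') : (ifHd i t p q).Ex m (n + 1) m' := by
  obtain ⟨k, hk, e⟩ := embed (P := ifHd i t p q) (fun a => some (.inr a)) none (fun _ _ => rfl) h
  refine Ex.mono (n := k + 1) ?_ (by omega)
  unfold Ex
  rw [Function.iterate_succ_apply, ← e]
  simp [step, ifHd, ht, StackOp.apply]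

/-- Repeat `p` as long as the top of stack `i` satisfies `t`. -/
def loop (i : Fin 7) (t : Option Bool → Bool) (p : Prog) : Prog where
  σ := Option p.σ
  fin := have := p.fin; inferInstance
  start := none
  δ := fun x s => match x with
    | none => (.skip, if t (s i) then some (some p.start) else none)
    | some a => ((p.δ a s).1, (p.δ a s).2.elim (some none) fun a' => some (some a'))

lemma Ex.loop_stop {i : Fin 7} {t : Option Bool → Bool} {p : Prog} {m : Mem}
    (ht : t (m.1 i).head? = false) : (loop i t p).Ex m 1 m := by
  simp [Ex, step, loop, ht, StackOp.apply]

lemma Ex.loop_step {i : Fin 7} {t : Option Bool → Bool} {p : Prog} {m m' m'' : Mem} {n n' : ℕ}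
    (ht : t (m.1 i).head? = true) (h : p.Ex m n m') (h' : (loop i t p).Ex m' n' m'') :
    (loop i t p).Ex m (n + 1 + n') m'' := by
  obtain ⟨k, hk, e⟩ := embed (P := loop i t p) (fun a => some a) (some none) (fun _ _ => rfl) h
  refine Ex.mono (n := n' + (k + 1)) ?_ (by omega)
  unfold Ex
  rw [Function.iterate_add_apply, Function.iterate_succ_apply]
  have : (loop i t p).step (some (loop i t p).start, m) = (some (some p.start), m) := by
    simp [step, loop, ht, StackOp.apply]
  rw [this]
  exact (congrArg _ e).trans h'

/-- The memory with given stacks and output: input `i`, advice `a`, workspace `w`, scratch stacks `x`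
and `y`, counter `c`, randomness `r`, output `o`. -/
abbrev mem (i a w x y c r o : List Bool) : Mem := (![i, a, w, x, y, c, r], o)

section
variable {i a w x y c r o : List Bool}

lemma Ex.push2 (b : Bool) :
    (op (.push 2 b)).Ex (mem i a w x y c r o) 1 (mem i a (b :: w) x y c r o) :=
  .of_op (Prod.ext (funext fun k => by fin_cases k <;> rfl) rfl)

lemma Ex.push3 (b : Bool) :
    (op (.push 3 b)).Ex (mem i a w x y c r o) 1 (mem i a w (b :: x) y c r o) :=
  .of_op (Prod.ext (funext fun k => by fin_cases k <;> rfl) rfl)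

lemma Ex.push4 (b : Bool) :
    (op (.push 4 b)).Ex (mem i a w x y c r o) 1 (mem i a w x (b :: y) c r o) :=
  .of_op (Prod.ext (funext fun k => by fin_cases k <;> rfl) rfl)

lemma Ex.push5 (b : Bool) :
    (op (.push 5 b)).Ex (mem i a w x y c r o) 1 (mem i a w x y (b :: c) r o) :=
  .of_op (Prod.ext (funext fun k => by fin_cases k <;> rfl) rfl)

lemma Ex.push6 (b : Bool) :
    (op (.push 6 b)).Ex (mem i a w x y c r o) 1 (mem i a w x y c (b :: r) o) :=
  .of_op (Prod.ext (funext fun k => by fin_cases k <;> rfl) rfl)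

lemma Ex.pop2 : (op (.pop 2)).Ex (mem i a w x y c r o) 1 (mem i a w.tail x y c r o) :=
  .of_op (Prod.ext (funext fun k => by fin_cases k <;> rfl) rfl)

lemma Ex.pop3 : (op (.pop 3)).Ex (mem i a w x y c r o) 1 (mem i a w x.tail y c r o) :=
  .of_op (Prod.ext (funext fun k => by fin_cases k <;> rfl) rfl)

lemma Ex.pop5 : (op (.pop 5)).Ex (mem i a w x y c r o) 1 (mem i a w x y c.tail r o) :=
  .of_op (Prod.ext (funext fun k => by fin_cases k <;> rfl) rfl)

lemma Ex.emit (b : Bool) :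
    (op (.emit b)).Ex (mem i a w x y c r o) 1 (mem i a w x y c r (o ++ [b])) := rfl

end

end Prog

/-! ### Binary trees and their manipulation by stack programs -/

/-- Binary trees, the data on which programs compute. -/
inductive SExp
  | nil
  | cons (a b : SExp)

namespace SExp

/-- The prefix code of a tree. -/
def code : SExp → List Bool
  | nil => [false]
  | cons a b => true :: (a.code ++ b.code)

/-- The length of the code, which is the number of nodes and leaves. -/
def size (x : SExp) : ℕ := x.code.length

@[simp] lemma size_nil : nil.size = 1 := rfl
@[simp] lemma size_cons (a b : SExp) : (cons a b).size = a.size + b.size + 1 := by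
  simp [size, code]

lemma one_le_size (x : SExp) : 1 ≤ x.size := by cases x <;> simp

/-- The left part, with the junk value `nil` at `nil`. -/
def hd : SExp → SExp
  | nil => nil
  | cons a _ => a

/-- The right part, with the junk value `nil` at `nil`. -/
def tl : SExp → SExp
  | nil => nil
  | cons _ b => b

@[simp] lemma hd_nil : nil.hd = nil := rfl
@[simp] lemma tl_nil : nil.tl = nil := rfl
@[simp] lemma hd_cons (a b : SExp) : (cons a b).hd = a := rfl
@[simp] lemma tl_cons (a b : SExp) : (cons a b).tl = b := rfl

lemma size_hd_le (x : SExp) : x.hd.size ≤ x.size := by cases x <;> simp; omega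
lemma size_tl_le (x : SExp) : x.tl.size ≤ x.size := by cases x <;> simp; omega

/-- Booleans are coded by `nil` and `cons nil nil`. -/
def ofBool : Bool → SExp
  | false => nil
  | true => cons nil nil

/-- Lists are coded by right combs. -/
def ofList : List SExp → SExp
  | [] => nil
  | a :: l => cons a (ofList l)

/-- Lists of bits as trees. -/
def ofBits (l : List Bool) : SExp := ofList (l.map ofBool)

/-- Natural numbers in unary notation. -/
def ofNat (n : ℕ) : SExp := ofList (List.replicate n nil)

@[simp] lemma ofBool_false : ofBool false = nil := rfl
@[simp] lemma ofBool_true : ofBool true = cons nil nil := rfl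
@[simp] lemma ofList_nil : ofList [] = nil := rfl
@[simp] lemma ofList_cons (a : SExp) (l : List SExp) : ofList (a :: l) = cons a (ofList l) := rfl
@[simp] lemma ofBits_nil : ofBits [] = nil := rfl
@[simp] lemma ofBits_cons (a : Bool) (l : List Bool) :
    ofBits (a :: l) = cons (ofBool a) (ofBits l) := rfl
@[simp] lemma ofNat_zero : ofNat 0 = nil := rfl
@[simp] lemma ofNat_succ (n : ℕ) : ofNat (n + 1) = cons nil (ofNat n) := rfl

@[simp] lemma size_ofNat (n : ℕ) : (ofNat n).size = 2 * n + 1 := by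
  induction n with
  | zero => rfl
  | succ n ih => simp [ih]; omega

lemma size_ofBool (b : Bool) : (ofBool b).size ≤ 3 := by cases b <;> simp

lemma size_ofBits (l : List Bool) : (ofBits l).size ≤ 4 * l.length + 1 := by
  induction l with
  | nil => simp
  | cons b l ih => have := size_ofBool b; simp; omega

lemma length_le_size_ofBits (l : List Bool) : l.length ≤ (ofBits l).size := by
  induction l with
  | nil => simp
  | cons b l ih => simp; omega

end SExp

namespace Prog
open SExp

section
variable {i a w x y c r o : List Bool}

/-- Pour stack `j` into stack `k`, reversing it. -/
def pour (j k : Fin 7) : Prog :=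
  loop j (fun t => t.isSome)
    (ifHd j (fun t => t == some true) ((op (.pop j)).seq (op (.push k true)))
      ((op (.pop j)).seq (op (.push k false))))

lemma ex_pour {j k : Fin 7} (hjk : j ≠ k) (l : List Bool) (s : Fin 7 → List Bool)
    (h : s j = l) : (pour j k).Ex (s, o) (4 * l.length + 1)
      (Function.update (Function.update s k (l.reverse ++ s k)) j [], o) := by
  induction l generalizing s with
  | nil =>
    refine (Ex.loop_stop (m := (s, o)) (by simp [h])).congr (Prod.ext ?_ rfl)
    · funext t
      by_cases h1 : t = j
      · subst h1; simp [h]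
      · by_cases h2 : t = k
        · subst h2; simp [h1]
        · simp [h1]
  | cons b l ih =>
    have key : ∀ b, s j = b :: l → ((op (.pop j)).seq (op (.push k b))).Ex (s, o) 2
        (Function.update (Function.update s j l) k (b :: s k), o) := by
      intro b h
      refine Ex.seq (.of_op rfl) (.of_op ?_)
      simp [StackOp.apply, h, hjk.symm]
    have h3 := ih (Function.update (Function.update s j l) k (b :: s k)) (by simp [hjk])
    refine (Ex.loop_step (n := 3) (by simp [h]) ?_ h3).mono (by simp; omega) |>.congr ?_
    · cases b
      · exact Ex.ifHd_neg (by simp [h]) (key _ h)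
      · exact Ex.ifHd_pos (by simp [h]) (key _ h)
    · refine Prod.ext (funext fun t => ?_) rfl
      by_cases h1 : t = j
      · subst h1; simp
      · by_cases h2 : t = k
        · subst h2; simp [h1]
        · simp [h1, h2]

lemma ex_pour03 : (pour 0 3).Ex (mem i a w x y c r o) (4 * i.length + 1)
    (mem [] a w (i.reverse ++ x) y c r o) :=
  (ex_pour (by decide) i _ rfl).congr
    (Prod.ext (funext fun t => by fin_cases t <;> rfl) rfl)

lemma ex_pour13 : (pour 1 3).Ex (mem i a w x y c r o) (4 * a.length + 1)
    (mem i [] w (a.reverse ++ x) y c r o) :=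
  (ex_pour (by decide) a _ rfl).congr
    (Prod.ext (funext fun t => by fin_cases t <;> rfl) rfl)

lemma ex_pour34 : (pour 3 4).Ex (mem i a w x y c r o) (4 * x.length + 1)
    (mem i a w [] (x.reverse ++ y) c r o) :=
  (ex_pour (by decide) x _ rfl).congr
    (Prod.ext (funext fun t => by fin_cases t <;> rfl) rfl)

lemma ex_pour45 : (pour 4 5).Ex (mem i a w x y c r o) (4 * y.length + 1)
    (mem i a w x [] (y.reverse ++ c) r o) :=
  (ex_pour (by decide) y _ rfl).congr
    (Prod.ext (funext fun t => by fin_cases t <;> rfl) rfl)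

lemma ex_pour52 : (pour 5 2).Ex (mem i a w x y c r o) (4 * c.length + 1)
    (mem i a (c.reverse ++ w) x y [] r o) :=
  (ex_pour (by decide) c _ rfl).congr
    (Prod.ext (funext fun t => by fin_cases t <;> rfl) rfl)

lemma ex_pour32 : (pour 3 2).Ex (mem i a w x y c r o) (4 * x.length + 1)
    (mem i a (x.reverse ++ w) [] y c r o) :=
  (ex_pour (by decide) x _ rfl).congr
    (Prod.ext (funext fun t => by fin_cases t <;> rfl) rfl)

lemma ex_pour43 : (pour 4 3).Ex (mem i a w x y c r o) (4 * y.length + 1)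
    (mem i a w (y.reverse ++ x) [] c r o) :=
  (ex_pour (by decide) y _ rfl).congr
    (Prod.ext (funext fun t => by fin_cases t <;> rfl) rfl)

/-- The loop that moves trees from the workspace to `x`, reversing their codes. The counter holds
the number of trees that are still to be read. -/
def takeLoop : Prog :=
  loop 5 (fun t => t.isSome)
    (ifHd 2 (fun t => t == some true)
      ((op (.pop 2)).seq ((op (.push 3 true)).seq (op (.push 5 true))))
      ((op (.pop 2)).seq ((op (.push 3 false)).seq (op (.pop 5)))))

lemma ex_takeLoop (t : SExp) {n : ℕ} {m : Mem}
    (h : takeLoop.Ex (mem i a w (t.code.reverse ++ x) y c r o) n m) :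
    takeLoop.Ex (mem i a (t.code ++ w) x y (true :: c) r o) (5 * t.size + n) m := by
  induction t generalizing w x c n with
  | nil =>
    have := Ex.seq (Ex.pop2 (i := i) (a := a) (w := false :: w) (x := x) (y := y)
      (c := true :: c) (r := r) (o := o)) ((Ex.push3 false).seq Ex.pop5)
    exact Ex.mono (Ex.loop_step rfl (Ex.ifHd_neg rfl this) h) (by simp)
  | cons t u iht ihu =>
    simp only [code, List.reverse_cons, List.reverse_append, List.append_assoc,
      List.cons_append] at h ⊢
    have h1 := iht (x := true :: x) (c := true :: c) (ihu (by simpa using h))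
    have := Ex.seq (Ex.pop2 (i := i) (a := a) (w := true :: (t.code ++ (u.code ++ w))) (x := x)
      (y := y) (c := true :: c) (r := r) (o := o)) ((Ex.push3 true).seq (Ex.push5 true))
    exact Ex.mono (Ex.loop_step rfl (Ex.ifHd_pos rfl this) h1) (by simp; omega)

/-- Move the first tree of the workspace to `x`. -/
def takeTree : Prog := (op (.push 5 true)).seq takeLoop

lemma ex_takeTree (t : SExp) :
    takeTree.Ex (mem i a (t.code ++ w) x y [] r o) (5 * t.size + 2)
      (mem i a w (t.code.reverse ++ x) y [] r o) :=
  ((Ex.push5 true).seq (ex_takeLoop t (Ex.loop_stop rfl))).mono (by omega)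

/-- Empty the stack `x`. -/
def clearX : Prog := loop 3 (fun t => t.isSome) (op (.pop 3))

lemma ex_clearX : clearX.Ex (mem i a w x y c r o) (2 * x.length + 1) (mem i a w [] y c r o) := by
  induction x with
  | nil => exact Ex.loop_stop rfl
  | cons b x ih => exact Ex.mono (Ex.loop_step rfl Ex.pop3 ih) (by simp; omega)

/-- Delete the first tree of the workspace. -/
def dropTree : Prog := takeTree.seq clearX

lemma ex_dropTree (t : SExp) :
    dropTree.Ex (mem i a (t.code ++ w) [] y [] r o) (7 * t.size + 3) (mem i a w [] y [] r o) :=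
  ((ex_takeTree t).seq ex_clearX).mono (by simp [size]; omega)

/-- Exchange the first two trees of the workspace. -/
def swapTrees : Prog :=
  takeTree.seq ((pour 3 4).seq (takeTree.seq ((pour 4 5).seq ((pour 5 2).seq (pour 3 2)))))

lemma ex_swapTrees (t u : SExp) :
    swapTrees.Ex (mem i a (t.code ++ (u.code ++ w)) [] [] [] r o) (17 * (t.size + u.size) + 8)
      (mem i a (u.code ++ (t.code ++ w)) [] [] [] r o) := by
  have := (ex_takeTree (i := i) (a := a) (w := u.code ++ w) (x := []) (y := []) (r := r)
    (o := o) t).seq (ex_pour34.seq ((ex_takeTree u).seq (ex_pour45.seq (ex_pour52.seq ex_pour32))))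
  simp only [List.append_nil, List.reverse_reverse, List.length_reverse] at this
  exact this.mono (by simp only [size]; omega)

/-- The loop that pours `x` both to the workspace and to `y`. -/
def pourBoth : Prog :=
  loop 3 (fun t => t.isSome)
    (ifHd 3 (fun t => t == some true)
      ((op (.pop 3)).seq ((op (.push 2 true)).seq (op (.push 4 true))))
      ((op (.pop 3)).seq ((op (.push 2 false)).seq (op (.push 4 false)))))

lemma ex_pourBoth : pourBoth.Ex (mem i a w x y c r o) (5 * x.length + 1)
    (mem i a (x.reverse ++ w) [] (x.reverse ++ y) c r o) := by
  induction x generalizing w y with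
  | nil => exact Ex.loop_stop rfl
  | cons b x ih =>
    have h1 : ∀ b, ((op (.pop 3)).seq ((op (.push 2 b)).seq (op (.push 4 b)))).Ex
        (mem i a w (b :: x) y c r o) (1 + (1 + 1)) (mem i a (b :: w) x (b :: y) c r o) :=
      fun b => Ex.pop3.seq ((Ex.push2 b).seq (Ex.push4 b))
    have h2 := ih (w := b :: w) (y := b :: y)
    simp only [List.reverse_cons, List.append_assoc, List.singleton_append]
    refine (Ex.loop_step (n := 4) rfl ?_ h2).mono (by simp; omega)
    cases b
    · exact Ex.ifHd_neg rfl (h1 _)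
    · exact Ex.ifHd_pos rfl (h1 _)

/-- Duplicate the first tree of the workspace. -/
def dupTree : Prog := takeTree.seq (pourBoth.seq ((pour 4 3).seq (pour 3 2)))

lemma ex_dupTree (t : SExp) :
    dupTree.Ex (mem i a (t.code ++ w) [] [] [] r o) (18 * t.size + 5)
      (mem i a (t.code ++ (t.code ++ w)) [] [] [] r o) := by
  have := (ex_takeTree (i := i) (a := a) (w := w) (x := []) (y := []) (r := r)
    (o := o) t).seq (ex_pourBoth.seq (ex_pour43.seq ex_pour32))
  simp only [List.append_nil, List.reverse_reverse, List.length_reverse] at this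
  exact this.mono (by simp only [size]; omega)

/-- Push a constant string on the workspace. -/
def pushAll : List Bool → Prog
  | [] => op .skip
  | b :: l => (pushAll l).seq (op (.push 2 b))

lemma ex_pushAll (l : List Bool) :
    (pushAll l).Ex (mem i a w x y c r o) (l.length + 1) (mem i a (l ++ w) x y c r o) := by
  induction l with
  | nil => rfl
  | cons b l ih => exact ih.seq (Ex.push2 b)

/-- Turn the stack `x` into a list of bits, in reverse order, in front of the list that begins the
workspace. -/
def consBits : Prog :=
  loop 3 (fun t => t.isSome)
    (ifHd 3 (fun t => t == some true)
      ((op (.pop 3)).seq (pushAll [true, true, false, false]))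
      ((op (.pop 3)).seq (pushAll [true, false])))

lemma ex_consBits (l : List Bool) :
    consBits.Ex (mem i a ((ofBits l).code ++ w) x y c r o) (8 * x.length + 1)
      (mem i a ((ofBits (x.reverse ++ l)).code ++ w) [] y c r o) := by
  induction x generalizing l with
  | nil => exact Ex.loop_stop rfl
  | cons b x ih =>
    have h2 := ih (b :: l)
    simp only [List.reverse_cons, List.append_assoc, List.singleton_append]
    refine (Ex.loop_step (n := 7) rfl ?_ h2).mono (by simp; omega)
    cases b
    · exact Ex.mono (Ex.ifHd_neg rfl (Ex.pop3.seq (ex_pushAll _))) (by simp)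
    · exact Ex.mono (Ex.ifHd_pos rfl (Ex.pop3.seq (ex_pushAll _))) (by simp)

/-- Put the pair of a constant, the input and the advice on the workspace. -/
def readAll (e : SExp) : Prog :=
  (op (.push 2 false)).seq ((pour 1 3).seq (consBits.seq ((op (.push 2 false)).seq
    ((pour 0 3).seq (consBits.seq (pushAll (true :: (e.code ++ [true]))))))))

lemma ex_readAll (e : SExp) :
    (readAll e).Ex (mem i a [] [] y c r o) (12 * i.length + 12 * a.length + e.size + 9)
      (mem [] [] (cons e (cons (ofBits i) (ofBits a))).code [] y c r o) := by
  have := (Ex.push2 (i := i) (a := a) (w := []) (x := []) (y := y) (c := c) (r := r) (o := o)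
    false).seq (ex_pour13.seq ((ex_consBits []).seq ((Ex.push2 false).seq (ex_pour03.seq
      ((ex_consBits []).seq (ex_pushAll (true :: (e.code ++ [true]))))))))
  simp only [List.append_nil, List.reverse_reverse, List.length_reverse] at this
  have e1 : (cons e (cons (ofBits i) (ofBits a))).code
      = true :: (e.code ++ [true]) ++ ((ofBits i).code ++ (ofBits a).code) := by
    simp [code]
  rw [e1]
  refine (this.mono ?_).congr (by simp [List.append_eq])
  simp only [size, List.length_append, List.length_cons, List.length_nil]
  omega

/-- Take a unary number off the workspace, to stack `r`. -/
def unaryLoop : Prog :=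
  loop 2 (fun t => t == some true) ((op (.pop 2)).seq ((op (.pop 2)).seq (op (.push 6 true))))

lemma ex_unaryLoop (n : ℕ) :
    unaryLoop.Ex (mem i a ((ofNat n).code ++ w) x y c r o) (4 * n + 1)
      (mem i a (false :: w) x y c (List.replicate n true ++ r) o) := by
  induction n generalizing r with
  | zero => exact Ex.loop_stop rfl
  | succ n ih =>
    have := ih (r := true :: r)
    have e : List.replicate (n + 1) true ++ r = List.replicate n true ++ true :: r := by
      rw [List.replicate_succ', List.append_assoc]; rfl
    rw [e]
    exact Ex.mono (Ex.loop_step rfl (Ex.pop2.seq (Ex.pop2.seq (Ex.push6 true))) this) (by omega)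

/-- Move the head of the tree, a number in unary notation, from the workspace to stack `r`. -/
def takeUnary : Prog := (op (.pop 2)).seq (unaryLoop.seq (op (.pop 2)))

lemma ex_takeUnary (n : ℕ) (d : SExp) :
    takeUnary.Ex (mem i a (cons (ofNat n) d).code x y c [] o) (4 * n + 3)
      (mem i a d.code x y c (List.replicate n true) o) := by
  have := (Ex.pop2 (i := i) (a := a) (w := (cons (ofNat n) d).code) (x := x) (y := y) (c := c)
    (r := []) (o := o)).seq ((ex_unaryLoop (w := d.code) n).seq Ex.pop2)
  simp only [List.append_nil] at this
  exact this.mono (by omega)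

/-- Write the list of bits on the workspace to the output. -/
def emitLoop : Prog :=
  loop 2 (fun t => t == some true) ((op (.pop 2)).seq
    (ifHd 2 (fun t => t == some true)
      ((op (.pop 2)).seq ((op (.pop 2)).seq ((op (.pop 2)).seq (op (.emit true)))))
      ((op (.pop 2)).seq (op (.emit false)))))

lemma ex_emitLoop (l : List Bool) :
    ∃ w', emitLoop.Ex (mem i a ((ofBits l).code ++ w) x y c r o) (7 * l.length + 1)
      (mem i a w' x y c r (o ++ l)) := by
  induction l generalizing o with
  | nil => exact ⟨_, (Ex.loop_stop rfl).congr (by rw [List.append_nil])⟩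
  | cons b l ih =>
    obtain ⟨w', hw⟩ := ih (o := o ++ [b])
    rw [List.append_assoc] at hw
    refine ⟨w', (Ex.loop_step (n := 6) rfl ?_ hw).mono (by simp; omega)⟩
    cases b
    · exact Ex.mono (Ex.pop2.seq (Ex.ifHd_neg rfl (Ex.pop2.seq (Ex.emit false)))) (by norm_num)
    · exact Ex.mono (Ex.pop2.seq (Ex.ifHd_pos rfl
        (Ex.pop2.seq (Ex.pop2.seq (Ex.pop2.seq (Ex.emit true)))))) (by norm_num)

end

end Prog

/-! ### Polynomial-time functions on trees -/

/-- `n` is bounded by a polynomial in `B`. -/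
def PolyBdd {ι : Type*} (B n : ι → ℕ) : Prop := ∃ c, ∀ i, n i ≤ (B i + 2) ^ c

namespace PolyBdd
variable {ι : Type*} {B n m : ι → ℕ}

lemma pow_mono (b : ℕ) {c d : ℕ} (h : c ≤ d) : (b + 2) ^ c ≤ (b + 2) ^ d :=
  Nat.pow_le_pow_right (by omega) h

lemma mono (h : PolyBdd B n) (hm : ∀ i, m i ≤ n i) : PolyBdd B m :=
  h.imp fun _ hc i => (hm i).trans (hc i)

lemma self : PolyBdd B B := ⟨1, fun i => by simp⟩

lemma of_le (h : ∀ i, n i ≤ B i) : PolyBdd B n := self.mono h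

lemma const (k : ℕ) : PolyBdd B fun _ => k :=
  ⟨k, fun i => (Nat.lt_two_pow_self).le.trans (Nat.pow_le_pow_left (by omega) k)⟩

lemma add (hn : PolyBdd B n) (hm : PolyBdd B m) : PolyBdd B fun i => n i + m i := by
  obtain ⟨c, hc⟩ := hn
  obtain ⟨d, hd⟩ := hm
  refine ⟨max c d + 1, fun i => ?_⟩
  have h1 := (hc i).trans (pow_mono (B i) (le_max_left c d))
  have h2 := (hd i).trans (pow_mono (B i) (le_max_right c d))
  rw [pow_succ]
  nlinarith [Nat.zero_le (B i)]

lemma mul (hn : PolyBdd B n) (hm : PolyBdd B m) : PolyBdd B fun i => n i * m i := by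
  obtain ⟨c, hc⟩ := hn
  obtain ⟨d, hd⟩ := hm
  exact ⟨c + d, fun i => by rw [pow_add]; exact Nat.mul_le_mul (hc i) (hd i)⟩

lemma pow (hn : PolyBdd B n) (k : ℕ) : PolyBdd B fun i => n i ^ k := by
  induction k with
  | zero => simpa using const 1
  | succ k ih => simpa only [pow_succ] using ih.mul hn

lemma trans {B' : ι → ℕ} (h : PolyBdd B B') (hn : PolyBdd B' n) : PolyBdd B n := by
  obtain ⟨c, hc⟩ := hn
  exact ((h.add (const 2)).pow c).mono hc

lemma comp {κ : Type*} (hn : PolyBdd B n) (f : κ → ι) :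
    PolyBdd (fun j => B (f j)) fun j => n (f j) := hn.imp fun _ h j => h (f j)

end PolyBdd

/-- The program replaces the tree `x` on top of the workspace by `y` within `n` steps, starting and
ending with empty scratch stacks. -/
def Prog.Computes (p : Prog) (x : SExp) (n : ℕ) (y : SExp) : Prop :=
  ∀ i a w r o, p.Ex (Prog.mem i a (x.code ++ w) [] [] [] r o) n (Prog.mem i a (y.code ++ w) [] [] [] r o)

/-- Some program transforms `F i` into `G i`, in time polynomial in `B i`. Neither the program nor
the polynomial depends on `i`. The sizes of `F i` and `G i` are polynomial in `B i`, too. -/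
def Transforms {ι : Type*} (B : ι → ℕ) (F G : ι → SExp) : Prop :=
  PolyBdd B (fun i => (F i).size) ∧ PolyBdd B (fun i => (G i).size) ∧
    ∃ (p : Prog) (T : ι → ℕ), PolyBdd B T ∧ ∀ i, p.Computes (F i) (T i) (G i)

/-- Polynomial-time functions on trees. -/
@[fun_prop]
def PolyTime (f : SExp → SExp) : Prop := Transforms SExp.size id f

open SExp Prog

/-- Case distinction: `x.sel y z` is `y` if `x = nil`, and `z` otherwise. -/
def SExp.sel (x y z : SExp) : SExp :=
  match x with
  | nil => y
  | cons _ _ => z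

@[simp] lemma SExp.sel_nil (y z : SExp) : nil.sel y z = y := rfl
@[simp] lemma SExp.sel_cons (a b y z : SExp) : (cons a b).sel y z = z := rfl

lemma SExp.size_sel_le (x y z : SExp) : (x.sel y z).size ≤ y.size + z.size := by
  cases x <;> simp

namespace Prog

lemma Computes.mono {p : Prog} {x y : SExp} {n n' : ℕ} (h : p.Computes x n y) (hn : n ≤ n') :
    p.Computes x n' y := fun i a w r o => (h i a w r o).mono hn

/-- Replace the tree on top of the workspace by its head. -/
def hdTree : Prog :=
  ifHd 2 (fun t => t == some true) ((op (.pop 2)).seq (swapTrees.seq dropTree)) (op .skip)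

lemma computes_hdTree (x : SExp) : hdTree.Computes x (24 * x.size + 13) x.hd := by
  intro i a w r o
  cases x with
  | nil => exact Ex.mono (Ex.ifHd_neg (n := 1) rfl (.of_op rfl)) (by omega)
  | cons u v =>
    have := (Ex.pop2 (i := i) (a := a) (w := (cons u v).code ++ w) (x := []) (y := []) (c := [])
      (r := r) (o := o))
    simp only [code, List.cons_append, List.tail_cons, List.append_assoc] at this ⊢
    refine (Ex.ifHd_pos rfl (this.seq ((ex_swapTrees u v).seq (ex_dropTree v)))).mono ?_
    simp
    omega

/-- Replace the tree on top of the workspace by its tail. -/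
def tlTree : Prog :=
  ifHd 2 (fun t => t == some true) ((op (.pop 2)).seq dropTree) (op .skip)

lemma computes_tlTree (x : SExp) : tlTree.Computes x (7 * x.size + 5) x.tl := by
  intro i a w r o
  cases x with
  | nil => exact Ex.mono (Ex.ifHd_neg (n := 1) rfl (.of_op rfl)) (by omega)
  | cons u v =>
    have := (Ex.pop2 (i := i) (a := a) (w := (cons u v).code ++ w) (x := []) (y := []) (c := [])
      (r := r) (o := o))
    simp only [code, List.cons_append, List.tail_cons, List.append_assoc] at this ⊢
    refine (Ex.ifHd_pos rfl (this.seq (ex_dropTree u))).mono ?_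
    simp
    omega

lemma Computes.seq {p q : Prog} {x y z : SExp} {n m : ℕ} (hp : p.Computes x n y)
    (hq : q.Computes y m z) : (p.seq q).Computes x (n + m) z :=
  fun i a w r o => (hp i a w r o).seq (hq i a w r o)

lemma computes_const (x v : SExp) :
    (dropTree.seq (pushAll v.code)).Computes x (7 * x.size + v.size + 4) v :=
  fun i a w r o => ((ex_dropTree x).seq (ex_pushAll _)).mono (by simp only [size]; omega)

/-- Pair the results of `p` and `q`. -/
def pairing (p q : Prog) : Prog :=
  dupTree.seq (q.seq (swapTrees.seq (p.seq (op (.push 2 true)))))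

lemma Computes.pairing {p q : Prog} {x y z : SExp} {n m : ℕ} (hp : p.Computes x n y)
    (hq : q.Computes x m z) :
    (pairing p q).Computes x (n + m + 35 * x.size + 17 * z.size + 14) (cons y z) := by
  intro i a w r o
  have := (ex_dupTree (i := i) (a := a) (w := w) (r := r) (o := o) x).seq
    ((hq _ _ _ _ _).seq ((ex_swapTrees z x).seq ((hp _ _ _ _ _).seq (Ex.push2 true))))
  simp only [code, List.cons_append, List.append_assoc] at this ⊢
  exact this.mono (by omega)

/-- Run `q` if `p` yields `nil`, and `s` otherwise. -/
def branch (p q s : Prog) : Prog :=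
  dupTree.seq (p.seq (ifHd 2 (fun t => t == some true) (dropTree.seq s) (dropTree.seq q)))

lemma Computes.branch {p q s : Prog} {x y u v : SExp} {n m l : ℕ} (hp : p.Computes x n y)
    (hq : q.Computes x m u) (hs : s.Computes x l v) :
    (branch p q s).Computes x (n + m + l + 18 * x.size + 7 * y.size + 9) (y.sel u v) := by
  intro i a w r o
  have h1 := (ex_dupTree (i := i) (a := a) (w := w) (r := r) (o := o) x)
  have h2 := hp i a (x.code ++ w) r o
  cases y with
  | nil =>
    exact (h1.seq (h2.seq (Ex.ifHd_neg rfl ((ex_dropTree _).seq (hq i a w r o))))).mono (by omega)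
  | cons y z =>
    exact (h1.seq (h2.seq (Ex.ifHd_pos rfl ((ex_dropTree _).seq (hs i a w r o))))).mono (by omega)

/-- Push the head of the tree on top of the workspace. -/
def testHd : Prog := dupTree.seq hdTree

/-- Iterate `p` as long as the head of the tree is not `nil`. -/
def whileHd (p : Prog) : Prog :=
  testHd.seq ((loop 2 (fun t => t == some true) (dropTree.seq (p.seq testHd))).seq (op (.pop 2)))

lemma ex_testHd {i a w r o : List Bool} (x : SExp) :
    testHd.Ex (Prog.mem i a (x.code ++ w) [] [] [] r o) (42 * x.size + 18)
      (Prog.mem i a (x.hd.code ++ (x.code ++ w)) [] [] [] r o) :=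
  ((ex_dupTree x).seq (computes_hdTree x _ _ _ _ _)).mono (by omega)

lemma computes_whileHd {p : Prog} {f : SExp → SExp} {k s t : ℕ} {x : SExp}
    (hp : ∀ j < k, p.Computes (f^[j] x) t (f^[j + 1] x)) (hs : ∀ j ≤ k, (f^[j] x).size ≤ s)
    (h1 : ∀ j < k, (f^[j] x).hd ≠ nil) (h2 : (f^[k] x).hd = nil) :
    (whileHd p).Computes x ((k + 1) * (t + 49 * s + 22)) (f^[k] x) := by
  intro i a w r o
  have key : ∀ k x, (∀ j < k, p.Computes (f^[j] x) t (f^[j + 1] x)) →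
      (∀ j ≤ k, (f^[j] x).size ≤ s) →
      (∀ j < k, (f^[j] x).hd ≠ nil) → (f^[k] x).hd = nil →
      (loop 2 (fun t => t == some true) (dropTree.seq (p.seq testHd))).Ex
        (Prog.mem i a (x.hd.code ++ (x.code ++ w)) [] [] [] r o) (k * (t + 49 * s + 22) + 1)
        (Prog.mem i a (nil.code ++ ((f^[k] x).code ++ w)) [] [] [] r o) := by
    intro k
    induction k with
    | zero =>
      intro x _ _ _ h2
      simp only [Function.iterate_zero, id_eq] at h2 ⊢
      rw [h2]
      exact (Ex.loop_stop rfl).mono (by omega)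
    | succ k ih =>
      intro x hp hs h1 h2
      have h3 := h1 0 (by omega)
      simp only [Function.iterate_zero, id_eq] at h3
      have h4 : ((x.hd.code ++ (x.code ++ w)).head? == some true) = true := by
        cases e : x.hd with
        | nil => exact absurd e h3
        | cons u v => rfl
      have h5 := ih (f x) (fun j hj => hp (j + 1) (by omega)) (fun j hj => hs (j + 1) (by omega))
        (fun j hj => h1 (j + 1) (by omega)) h2
      have h6 := hp 0 (by omega) i a w r o
      have h7 := hs 0 (by omega)
      have h8 := hs 1 (by omega)
      have h9 := size_hd_le x
      simp only [Function.iterate_zero, id_eq, Function.iterate_one, zero_add] at h6 h7 h8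
      refine Ex.mono (Ex.loop_step h4 ((ex_dropTree _).seq (h6.seq (ex_testHd _))) h5) ?_
      rw [Nat.add_mul k 1]
      omega
  have h := (ex_testHd (i := i) (a := a) (w := w) (r := r) (o := o) x).seq
    ((key k x hp hs h1 h2).seq Ex.pop2)
  have h0 := hs 0 (by omega)
  simp only [Function.iterate_zero, id_eq] at h0
  refine Ex.mono h ?_
  rw [Nat.add_mul k 1]
  omega

end Prog

namespace Transforms
variable {ι : Type*} {B : ι → ℕ} {F G H K : ι → SExp}

lemma bdd_left (h : Transforms B F G) : PolyBdd B fun i => (F i).size := h.1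
lemma bdd (h : Transforms B F G) : PolyBdd B fun i => (G i).size := h.2.1

lemma refl (h : PolyBdd B fun i => (F i).size) : Transforms B F F :=
  ⟨h, h, op .skip, fun _ => 1, .const 1, fun _ _ _ _ _ _ => rfl⟩

lemma trans (h : Transforms B F G) (h' : Transforms B G H) : Transforms B F H := by
  obtain ⟨hF, -, p, T, hT, hp⟩ := h
  obtain ⟨-, hH, q, T', hT', hq⟩ := h'
  exact ⟨hF, hH, _, _, hT.add hT', fun i => (hp i).seq (hq i)⟩

lemma comp {κ : Type*} (h : Transforms B F G) (f : κ → ι) {B' : κ → ℕ}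
    (hB : PolyBdd B' fun j => B (f j)) :
    Transforms B' (fun j => F (f j)) fun j => G (f j) := by
  obtain ⟨hF, hG, p, T, hT, hp⟩ := h
  exact ⟨hB.trans (hF.comp f), hB.trans (hG.comp f), p, _, hB.trans (hT.comp f),
    fun j => hp (f j)⟩

lemma cons (h : Transforms B F G) (h' : Transforms B F H) :
    Transforms B F fun i => .cons (G i) (H i) := by
  obtain ⟨hF, hG, p, T, hT, hp⟩ := h
  obtain ⟨-, hH, q, T', hT', hq⟩ := h'
  exact ⟨hF, ((hG.add hH).add (.const 1)).mono fun i => by simp, _, _,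
    (((hT.add hT').add ((PolyBdd.const 35).mul hF)).add ((PolyBdd.const 17).mul hH)).add
      (.const 14), fun i => (hp i).pairing (hq i)⟩

lemma sel (h : Transforms B F G) (h' : Transforms B F H) (h'' : Transforms B F K) :
    Transforms B F fun i => (G i).sel (H i) (K i) := by
  obtain ⟨hF, hG, p, T, hT, hp⟩ := h
  obtain ⟨-, hH, q, T', hT', hq⟩ := h'
  obtain ⟨-, hK, s, T'', hT'', hs⟩ := h''
  exact ⟨hF, (hH.add hK).mono fun i => size_sel_le _ _ _, _, _,
    ((((hT.add hT').add hT'').add ((PolyBdd.const 18).mul hF)).add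
      ((PolyBdd.const 7).mul hG)).add (.const 9), fun i => (hp i).branch (hq i) (hs i)⟩

lemma hd (h : Transforms B F G) : Transforms B F fun i => (G i).hd :=
  h.trans ⟨h.bdd, h.bdd.mono fun _ => size_hd_le _, _, _,
    ((PolyBdd.const 24).mul h.bdd).add (.const 13), fun _ => computes_hdTree _⟩

lemma tl (h : Transforms B F G) : Transforms B F fun i => (G i).tl :=
  h.trans ⟨h.bdd, h.bdd.mono fun _ => size_tl_le _, _, _,
    ((PolyBdd.const 7).mul h.bdd).add (.const 5), fun _ => computes_tlTree _⟩

lemma const (h : PolyBdd B fun i => (F i).size) (v : SExp) : Transforms B F fun _ => v :=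
  ⟨h, .const _, _, _, (((PolyBdd.const 7).mul h).add (.const v.size)).add (.const 4),
    fun _ => computes_const _ _⟩

lemma app {f : SExp → SExp} (hf : PolyTime f) (h : Transforms B F G) :
    Transforms B F fun i => f (G i) :=
  h.trans (Transforms.comp (F := id) (G := f) hf G h.bdd)

/-- A loop whose number of iterations and whose intermediate results are polynomially bounded. -/
lemma iterateWhile {f : SExp → SExp} (hf : PolyTime f) (k : ι → ℕ) (hk : PolyBdd B k)
    (s : ι → ℕ) (hs : PolyBdd B s) (hsize : ∀ i, ∀ j ≤ k i, (f^[j] (F i)).size ≤ s i)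
    (h1 : ∀ i, ∀ j < k i, (f^[j] (F i)).hd ≠ nil) (h2 : ∀ i, (f^[k i] (F i)).hd = nil) :
    Transforms B F fun i => f^[k i] (F i) := by
  obtain ⟨-, -, p, T, ⟨c, hc⟩, hp⟩ := hf
  have hF : PolyBdd B fun i => (F i).size := hs.mono fun i => hsize i 0 (Nat.zero_le _)
  have hG : PolyBdd B fun i => (f^[k i] (F i)).size := hs.mono fun i => hsize i _ le_rfl
  refine ⟨hF, hG, whileHd p, fun i => (k i + 1) * ((s i + 2) ^ c + 49 * s i + 22),
    (hk.add (.const 1)).mul ((((hs.add (.const 2)).pow c).add ((PolyBdd.const 49).mul hs)).add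
      (.const 22)), fun i => ?_⟩
  refine computes_whileHd (fun j hj => ?_) (hsize i) (h1 i) (h2 i)
  rw [Function.iterate_succ_apply']
  refine (hp (f^[j] (F i))).mono ((hc _).trans ?_)
  exact Nat.pow_le_pow_left (Nat.add_le_add_right (hsize i j hj.le) 2) c

end Transforms

namespace PolyTime
variable {f g h : SExp → SExp}

@[fun_prop] lemma id' : PolyTime fun x => x := Transforms.refl .self
@[fun_prop] lemma const (v : SExp) : PolyTime fun _ => v := Transforms.const .self v
@[fun_prop] lemma comp (hf : PolyTime f) (hg : PolyTime g) : PolyTime fun x => f (g x) :=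
  Transforms.app hf hg
@[fun_prop] lemma cons (hf : PolyTime f) (hg : PolyTime g) :
    PolyTime fun x => .cons (f x) (g x) := Transforms.cons hf hg
@[fun_prop] lemma hd (hf : PolyTime f) : PolyTime fun x => (f x).hd := Transforms.hd hf
@[fun_prop] lemma tl (hf : PolyTime f) : PolyTime fun x => (f x).tl := Transforms.tl hf
@[fun_prop] lemma sel (hf : PolyTime f) (hg : PolyTime g) (hh : PolyTime h) :
    PolyTime fun x => (f x).sel (g x) (h x) := Transforms.sel hf hg hh

end PolyTime


namespace SExp

/-- The length of the right spine, that is, the length of the list that the tree codes. -/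
def len : SExp → ℕ
  | nil => 0
  | cons _ b => b.len + 1

lemma len_le_size (x : SExp) : x.len ≤ x.size := by
  induction x with
  | nil => simp [len]
  | cons a b _ ih => simp [len]; omega

/-- Left fold along the right spine, that is, over a list. -/
def fold (f : SExp → SExp → SExp) : SExp → SExp → SExp
  | nil, s => s
  | cons h t, s => fold f t (f h s)

/-- The first `j` steps of `fold`. -/
def foldN (f : SExp → SExp → SExp) : ℕ → SExp → SExp → SExp
  | 0, _, s => s
  | _ + 1, nil, s => s
  | j + 1, cons h t, s => foldN f j t (f h s)

@[simp] lemma fold_nil (f : SExp → SExp → SExp) (s : SExp) : fold f nil s = s := rfl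
@[simp] lemma fold_cons (f : SExp → SExp → SExp) (h t s : SExp) :
    fold f (cons h t) s = fold f t (f h s) := rfl

lemma foldN_len (f : SExp → SExp → SExp) (l s : SExp) : foldN f l.len l s = fold f l s := by
  induction l generalizing s with
  | nil => rfl
  | cons h t _ ih => exact ih _

lemma fold_ofList {α : Type*} (e : α → SExp) (f : SExp → SExp → SExp) (l : List α) (s : SExp) :
    fold f (ofList (l.map e)) s = l.foldl (fun s h => f (e h) s) s := by
  induction l generalizing s with
  | nil => rfl
  | cons h t ih => exact ih _

lemma fold_ofBits (f : SExp → SExp → SExp) (l : List Bool) (s : SExp) :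
    fold f (ofBits l) s = l.foldl (fun s h => f (ofBool h) s) s := fold_ofList _ _ _ _

lemma fold_ofNat (f : SExp → SExp → SExp) (n : ℕ) (s : SExp) :
    fold f (ofNat n) s = (f nil)^[n] s := by
  induction n generalizing s with
  | zero => rfl
  | succ n ih => exact ih _

lemma iterate_tl_len (x : SExp) : tl^[x.len] x = nil := by
  induction x with
  | nil => rfl
  | cons a b _ ih => exact ih

lemma iterate_tl_ne (x : SExp) {j : ℕ} (h : j < x.len) : tl^[j] x ≠ nil := by
  induction x generalizing j with
  | nil => simp [len] at h
  | cons a b _ ih =>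
    cases j with
    | zero => simp
    | succ j => exact ih (by simpa [len] using h)

lemma size_iterate_tl (x : SExp) (j : ℕ) : (tl^[j] x).size ≤ x.size := by
  induction j generalizing x with
  | zero => simp
  | succ j ih => exact (ih _).trans (size_tl_le x)

/-- One step of a fold, on triples of a list, a parameter and a state. -/
def foldStep (f : SExp → SExp → SExp → SExp) (y : SExp) : SExp :=
  cons y.hd.tl (cons y.tl.hd (f y.tl.hd y.hd.hd y.tl.tl))

lemma iterate_foldStep (f : SExp → SExp → SExp → SExp) (l x s : SExp) {j : ℕ} (hj : j ≤ l.len) :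
    (foldStep f)^[j] (cons l (cons x s)) = cons (tl^[j] l) (cons x (foldN (f x) j l s)) := by
  induction j generalizing l s with
  | zero => rfl
  | succ j ih =>
    cases l with
    | nil => simp [len] at hj
    | cons h t => exact ih t _ (by simpa [len] using hj)

end SExp

lemma Transforms.fold {ι : Type*} {B : ι → ℕ} {F E L S : ι → SExp}
    {f : SExp → SExp → SExp → SExp}
    (hf : PolyTime fun y => f y.hd y.tl.hd y.tl.tl) (hE : Transforms B F E)
    (hL : Transforms B F L) (hS : Transforms B F S) (s : ι → ℕ) (hs : PolyBdd B s)
    (hsize : ∀ i, ∀ j ≤ (L i).len, (foldN (f (E i)) j (L i) (S i)).size ≤ s i) :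
    Transforms B F fun i => fold (f (E i)) (L i) (S i) := by
  have h1 : PolyTime (foldStep f) := by
    have : PolyTime fun y => SExp.cons y.tl.hd (.cons y.hd.hd y.tl.tl) := by fun_prop
    have := PolyTime.comp hf this
    unfold foldStep
    simp only [hd_cons, tl_cons] at this
    exact .cons (by fun_prop) (.cons (by fun_prop) this)
  have h2 := (hL.cons (hE.cons hS)).trans (Transforms.iterateWhile h1 (fun i => (L i).len)
    (hL.bdd.mono fun i => len_le_size _) (fun i => (L i).size + (E i).size + s i + 2)
    (((hL.bdd.add hE.bdd).add hs).add (.const 2)) ?_ ?_ ?_)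
  · have h3 := h2.tl.tl
    simpa only [iterate_foldStep _ _ _ _ le_rfl, tl_cons, foldN_len] using h3
  · intro i j hj
    have := size_iterate_tl (L i) j
    have := hsize i j hj
    simp only [iterate_foldStep _ _ _ _ hj, size_cons]
    omega
  · intro i j hj
    simp only [iterate_foldStep _ _ _ _ hj.le, hd_cons]
    exact iterate_tl_ne _ hj
  · intro i
    simp only [iterate_foldStep _ _ _ _ le_rfl, hd_cons]
    exact iterate_tl_len _

lemma SExp.size_foldN_le {f : SExp → SExp → SExp} {K : ℕ} {l : SExp}
    (h : ∀ h s, h.size ≤ l.size → (f h s).size ≤ s.size + K) (j : ℕ) (s : SExp) :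
    (foldN f j l s).size ≤ s.size + j * K := by
  induction j generalizing l s with
  | zero => simp [foldN]
  | succ j ih =>
    cases l with
    | nil => simp [foldN]
    | cons a t =>
      have h1 := h a s (by simp; omega)
      have h2 := ih (l := t) (fun x s hx => h x s (by simp; omega)) (f a s)
      rw [foldN, Nat.add_mul]
      omega

lemma SExp.size_fold_le {f : SExp → SExp → SExp} {K : ℕ} {l : SExp}
    (h : ∀ h s, h.size ≤ l.size → (f h s).size ≤ s.size + K) (s : SExp) :
    (fold f l s).size ≤ s.size + l.size * K := by
  rw [← foldN_len]
  have := Nat.mul_le_mul_right K (len_le_size l)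
  have := size_foldN_le h l.len s
  omega

/-- A fold is polynomial-time if each step adds to the size of the state at most a polynomial in the
sizes of the parameter and the list element. -/
lemma PolyTime.fold {f : SExp → SExp → SExp → SExp} {e l s : SExp → SExp}
    (hf : PolyTime fun y => f y.hd y.tl.hd y.tl.tl)
    (hsize : ∃ c, ∀ x h s, (f x h s).size ≤ s.size + (x.size + h.size + 2) ^ c)
    (he : PolyTime e) (hl : PolyTime l) (hs : PolyTime s) :
    PolyTime fun x => SExp.fold (f (e x)) (l x) (s x) := by
  obtain ⟨c, hc⟩ := hsize
  refine Transforms.fold hf he hl hs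
    (fun x => (s x).size + (l x).size * ((e x).size + (l x).size + 2) ^ c)
    (hs.bdd.add (hl.bdd.mul (((he.bdd.add hl.bdd).add (.const 2)).pow c))) fun x j hj => ?_
  have h1 := size_foldN_le (f := f (e x)) (K := ((e x).size + (l x).size + 2) ^ c) (l := l x)
    (fun h s hh => (hc _ _ _).trans ?_) j (s x)
  · have := Nat.mul_le_mul_right (((e x).size + (l x).size + 2) ^ c) (hj.trans (len_le_size _))

    omega
  · have : ((e x).size + h.size + 2) ^ c ≤ ((e x).size + (l x).size + 2) ^ c :=
      Nat.pow_le_pow_left (by omega) c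
    omega

/-! ### Stack programs on Turing machines -/

section StackTape
open Turing

/-- The tape that holds a stack, with the head on the top of the stack. -/
def stackTape (l : List Bool) : Tape (Option Bool) := Tape.mk₁ (l.map some)

lemma stackTape_head (l : List Bool) : (stackTape l).head = l.head? := by cases l <;> rfl

lemma ListBlank.cons_default_nil :
    ListBlank.cons none (ListBlank.mk ([] : List (Option Bool))) = ListBlank.mk [] :=
  ListBlank.cons_head_tail (ListBlank.mk [])

lemma stackTape_pop (l : List Bool) :
    ((stackTape l).write none).move .right = stackTape l.tail := by
  simp only [stackTape, Tape.mk₁, Tape.mk₂, Tape.write_mk', Tape.move_right_mk',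
    ListBlank.head_cons, ListBlank.tail_cons, ListBlank.cons_default_nil, ListBlank.tail_mk,
    List.map_tail]

lemma stackTape_push (l : List Bool) (b : Bool) :
    ((stackTape l).move .left).write (some b) = stackTape (b :: l) := by
  simp only [stackTape, Tape.mk₁, Tape.mk₂, Tape.write_mk', Tape.move_left_mk',
    ListBlank.tail_mk, List.map_cons, ListBlank.cons_mk, List.tail_nil, List.tail_cons]

lemma stackTape_nil_left : (stackTape []).move .left = stackTape [] := by
  simp only [stackTape, Tape.mk₁, Tape.mk₂, Tape.move_left_mk', List.map_nil, ListBlank.tail_mk,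
    ListBlank.head_mk, List.tail_nil, List.headI]
  exact congrArg _ ListBlank.cons_default_nil

end StackTape

namespace Prog

/-- The states of the Turing machine that runs `p`: those of `p`, and states that remember the
second half of a push (the symbol is written in the step after the head has moved). -/
abbrev TState (p : Prog) : Type := p.σ ⊕ (Option p.σ × Fin 7 × Bool)

/-- What the Turing machine does in a state of `p`. The state after the exit of `p` is `ex`, and `f`
embeds the states. -/
def action (p : Prog) {q : ℕ} (f : p.TState → Fin q) (ex : Option (Fin q)) :
    p.TState → (Fin 7 → Option Bool) → PTMAction 7 q
  | .inl a, s =>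
    let nx := (p.δ a s).2.elim ex fun a' => some (f (.inl a'))
    match (p.δ a s).1 with
    | .skip => ⟨nx, s, fun _ => none, none⟩
    | .pop i => ⟨nx, Function.update s i none, Function.update (fun _ => none) i (some .right), none⟩
    | .emit b => ⟨nx, s, fun _ => none, some b⟩
    | .push i b => ⟨some (f (.inr ((p.δ a s).2, i, b))), s,
        Function.update (fun _ => none) i (some .left), none⟩
  | .inr (a, i, b), s =>
    ⟨a.elim ex fun a' => some (f (.inl a')), Function.update s i (some b), fun _ => none, none⟩

variable {n : ℕ} {δ : Fin (n + 1) → (Fin 7 → Option Bool) → Bool → PTMAction 7 (n + 1)}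

/-- The machine configuration with given state and memory. -/
def toCfg (δ : Fin (n + 1) → (Fin 7 → Option Bool) → Bool → PTMAction 7 (n + 1))
    (q : Option (Fin (n + 1))) (m : Mem) : PTM.Cfg ⟨5, n, δ⟩ :=
  ⟨q, fun i => stackTape (m.1 i), m.2⟩

lemma foldl_step_none (M : PTM) (c : M.Cfg) (h : c.state = none) (l : List Bool) :
    l.foldl M.step c = c := by
  induction l with
  | nil => rfl
  | cons b l ih =>
    have : M.step c b = c := by simp [PTM.step, h]
    rw [List.foldl_cons, this, ih]

lemma machine_step {p : Prog} {f : p.TState → Fin (n + 1)} {ex : Option (Fin (n + 1))}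
    (H : ∀ x s b, δ (f x) s b = p.action f ex x s) (q : p.σ) (m : Mem) :
    ∃ k ≤ 2, ∀ ρ : List Bool, ρ.length = k →
      ρ.foldl (PTM.step ⟨5, n, δ⟩) (toCfg δ (some (f (.inl q))) m) =
        toCfg δ ((p.step (some q, m)).1.elim ex fun a' => some (f (.inl a')))
          (p.step (some q, m)).2 := by
  have hs : ∀ i, (stackTape (m.1 i)).write (m.1 i).head? = stackTape (m.1 i) := fun i => by
    rw [← stackTape_head]; exact Turing.Tape.write_self _
  have h1 := fun b => H (.inl q) (fun i => (m.1 i).head?) b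
  simp only [action] at h1
  rw [step]
  rcases e : (p.δ q fun i => (m.1 i).head?).1 with _ | ⟨i, b⟩ | i | b
  · refine ⟨1, by norm_num, fun ρ hρ => ?_⟩
    obtain ⟨b, rfl⟩ := List.length_eq_one_iff.1 hρ
    simp only [e] at h1
    simp only [List.foldl_cons, List.foldl_nil, PTM.step, toCfg, stackTape_head, h1,
      StackOp.apply]
    simp [hs, PTM.moveHead]
  · refine ⟨2, by norm_num, fun ρ hρ => ?_⟩
    obtain ⟨b1, b2, rfl⟩ := List.length_eq_two.1 hρ
    simp only [e] at h1
    simp only [List.foldl_cons, List.foldl_nil, PTM.step, toCfg, stackTape_head, h1,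
      StackOp.apply, H, action]
    simp only [Option.toList_none, List.append_nil, PTM.Cfg.mk.injEq, true_and, and_true]
    funext j
    by_cases hj : j = i
    · subst hj
      simp [hs, PTM.moveHead, stackTape_push]
    · simp [hj, hs, PTM.moveHead, stackTape_head]
  · refine ⟨1, by norm_num, fun ρ hρ => ?_⟩
    obtain ⟨b, rfl⟩ := List.length_eq_one_iff.1 hρ
    simp only [e] at h1
    simp only [List.foldl_cons, List.foldl_nil, PTM.step, toCfg, stackTape_head, h1,
      StackOp.apply]
    simp only [Option.toList_none, List.append_nil, PTM.Cfg.mk.injEq, true_and, and_true]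
    funext j
    by_cases hj : j = i
    · subst hj
      simp [PTM.moveHead, stackTape_pop]
    · simp [hj, hs, PTM.moveHead]
  · refine ⟨1, by norm_num, fun ρ hρ => ?_⟩
    obtain ⟨b, rfl⟩ := List.length_eq_one_iff.1 hρ
    simp only [e] at h1
    simp only [List.foldl_cons, List.foldl_nil, PTM.step, toCfg, stackTape_head, h1,
      StackOp.apply]
    simp [hs, PTM.moveHead]

/-- A machine whose control contains that of the program `p` runs `p`. The number of steps does not
depend on the random bits. -/
lemma machine_run {p : Prog} {f : p.TState → Fin (n + 1)} {ex : Option (Fin (n + 1))}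
    (H : ∀ x s b, δ (f x) s b = p.action f ex x s) {N : ℕ} {q : p.σ} {m m' : Mem}
    (h : p.step^[N] (some q, m) = (none, m')) :
    ∃ k ≤ 2 * N, ∀ ρ : List Bool, ρ.length = k →
      ρ.foldl (PTM.step ⟨5, n, δ⟩) (toCfg δ (some (f (.inl q))) m) = toCfg δ ex m' := by
  induction N generalizing q m with
  | zero => simp at h
  | succ N ih =>
    obtain ⟨k, hk, hk'⟩ := machine_step H q m
    rw [Function.iterate_succ_apply] at h
    rcases e : p.step (some q, m) with ⟨_ | q', m1⟩
    · rw [e, step_none] at h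
      refine ⟨k, by omega, fun ρ hρ => ?_⟩
      rw [hk' ρ hρ, e]
      simp_all
    · rw [e] at h
      obtain ⟨k2, hk2, hk2'⟩ := ih h
      refine ⟨k + k2, by omega, fun ρ hρ => ?_⟩
      rw [← List.take_append_drop k ρ, List.foldl_append, hk' _ (by simp; omega), e]
      exact hk2' _ (by simp; omega)

/-- The action in the state that loads random bits: for every symbol on stack `6`, which is
consumed, a bit `b` is put on stack `3`. The head of tape `3` is ahead by one cell meanwhile, so that
a single step suffices for each bit. -/
def loadAction {q : ℕ} (self next : Fin q) (s : Fin 7 → Option Bool) (b : Bool) : PTMAction 7 q :=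
  if s 6 = none then ⟨some next, s, Function.update (fun _ => none) 3 (some .right), none⟩
  else ⟨some self, Function.update (Function.update s 6 none) 3 (some b),
    Function.update (Function.update (fun _ => none) 6 (some .right)) 3 (some .left), none⟩

lemma machine_load {L S : Fin (n + 1)} {g : Bool → Bool}
    (H : ∀ s b, δ L s b = loadAction L S s (g b)) (s : Fin 7 → List Bool) (o l ρ : List Bool)
    (h6 : s 6 = List.replicate ρ.length true) (h3 : s 3 = l) (b : Bool) :
    (ρ ++ [b]).foldl (PTM.step ⟨5, n, δ⟩)
      ⟨some L, Function.update (fun i => stackTape (s i)) 3 ((stackTape l).move .left), o⟩ =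
      toCfg δ (some S)
        (Function.update (Function.update s 6 []) 3 ((ρ.map g).reverse ++ l), o) := by
  induction ρ generalizing s l with
  | nil =>
    have e : ((Function.update (fun i => stackTape (s i)) 3 ((stackTape l).move .left) : Fin 7 →
        Turing.Tape (Option Bool)) 6).head = none := by
      rw [Function.update_of_ne (by decide), h6]; rfl
    simp only [List.nil_append, List.foldl_cons, List.foldl_nil, PTM.step, toCfg, H, loadAction]
    rw [if_pos e]
    simp only [Option.toList_none, List.append_nil, PTM.Cfg.mk.injEq, true_and, and_true]
    funext j
    rw [Turing.Tape.write_self]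
    by_cases hj : j = 3
    · subst hj
      simp [PTM.moveHead]
    · by_cases hj6 : j = 6
      · subst hj6
        rw [Function.update_of_ne (show (6 : Fin 7) ≠ 3 by decide)]
        simp [PTM.moveHead, h6]
      · simp [hj, hj6, PTM.moveHead]
  | cons c ρ ih =>
    have e : ((Function.update (fun i => stackTape (s i)) 3 ((stackTape l).move .left) : Fin 7 →
        Turing.Tape (Option Bool)) 6).head = some true := by
      rw [Function.update_of_ne (by decide), h6]; rfl
    have h1 := ih (Function.update (Function.update s 6 (s 6).tail) 3 (g c :: l)) (g c :: l)
      (by simp [h6, List.replicate_succ]) (by simp)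
    rw [List.cons_append, List.foldl_cons]
    have h2 : PTM.step ⟨5, n, δ⟩ ⟨some L,
          Function.update (fun i => stackTape (s i)) 3 ((stackTape l).move .left), o⟩ c =
        ⟨some L, Function.update (fun i => stackTape (Function.update
          (Function.update s 6 (s 6).tail) 3 (g c :: l) i)) 3
          ((stackTape (g c :: l)).move .left), o⟩ := by
      simp only [PTM.step, H, loadAction]
      rw [if_neg (by rw [e]; simp)]
      simp only [Option.toList_none, List.append_nil, PTM.Cfg.mk.injEq, true_and, and_true]
      funext j
      by_cases hj : j = 3
      · subst hj
        simp [PTM.moveHead, stackTape_push]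
      · by_cases hj6 : j = 6
        · subst hj6
          rw [Function.update_of_ne (show (6 : Fin 7) ≠ 3 by decide),
            Function.update_of_ne (show (6 : Fin 7) ≠ 3 by decide),
            Function.update_of_ne (show (6 : Fin 7) ≠ 3 by decide)]
          simp only [PTM.moveHead, Function.update_self, stackTape_pop]
          rw [Function.update_of_ne (show (6 : Fin 7) ≠ 3 by decide)]
          simp
        · simp [hj, hj6, PTM.moveHead, Turing.Tape.write_self]
    rw [h2, h1]
    congr 2
    funext j
    by_cases hj : j = 3
    · subst hj; simp
    · by_cases hj6 : j = 6
      · subst hj6; simp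
      · simp [hj, hj6]

/-- The initial memory. -/
def initMem (x α : List Bool) : Mem := mem x α [] [] [] [] [] []

lemma init_eq (x α : List Bool) (q : Option (Fin (n + 1))) (hq : q = some 0) :
    PTM.init ⟨5, n, δ⟩ x α = toCfg δ q (initMem x α) := by
  subst hq
  simp only [PTM.init, toCfg, PTM.Cfg.mk.injEq, true_and, initMem, and_true]
  funext i
  fin_cases i <;> rfl

/-- Two deterministic programs `p₁` and `p₂` are turned into a machine that runs `p₁`, which leaves
a number `R` in unary on stack `6`, then puts `R` random bits on stack `3`, and then runs `p₂`. With
constant `g`, the bits are not random and the machine is deterministic. -/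
theorem exists_machine (p₁ p₂ : Prog) (g : Bool → Bool) :
    ∃ M : PTM, ((∀ b b', g b = g b') → M.Deterministic) ∧
      ∀ (x α : List Bool) (N₁ : ℕ) (m₁ : Mem) (R : ℕ), p₁.Ex (initMem x α) N₁ m₁ →
        m₁.1 6 = List.replicate R true → m₁.1 3 = [] →
        ∃ k ≤ 2 * N₁, ∀ (ρ₁ ρ₂ ρ₃ : List Bool) (N₂ : ℕ) (m₂ : Mem), ρ₁.length = k →
          ρ₂.length = R → 2 * N₂ + 1 ≤ ρ₃.length →
          p₂.Ex (Function.update (Function.update m₁.1 6 []) 3 (ρ₂.map g).reverse, m₁.2) N₂ m₂ →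
          ((ρ₁ ++ ρ₂ ++ ρ₃).foldl M.step (M.init x α)).state = none ∧
          ((ρ₁ ++ ρ₂ ++ ρ₃).foldl M.step (M.init x α)).out = m₂.2 := by
  classical
  have := p₁.fin
  have := p₂.fin
  obtain ⟨n, e, he⟩ : ∃ (n : ℕ) (e : p₁.TState ⊕ Unit ⊕ p₂.TState ≃ Fin (n + 1)),
      e (.inl (.inl p₁.start)) = 0 := by
    have h : 0 < Fintype.card (p₁.TState ⊕ Unit ⊕ p₂.TState) :=
      Fintype.card_pos_iff.2 ⟨.inl (.inl p₁.start)⟩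
    obtain ⟨n, hn⟩ := Nat.exists_eq_succ_of_ne_zero h.ne'
    let e := Fintype.equivFinOfCardEq hn
    exact ⟨n, e.trans (Equiv.swap (e (.inl (.inl p₁.start))) 0), by simp⟩
  let f₁ : p₁.TState → Fin (n + 1) := fun a => e (.inl a)
  let L : Fin (n + 1) := e (.inr (.inl ()))
  let f₂ : p₂.TState → Fin (n + 1) := fun a => e (.inr (.inr a))
  let S : Fin (n + 1) := f₂ (.inl p₂.start)
  let δ : Fin (n + 1) → (Fin 7 → Option Bool) → Bool → PTMAction 7 (n + 1) := fun q s b =>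
    match e.symm q with
    | .inl a => p₁.action f₁ (some L) a s
    | .inr (.inl _) => loadAction L S s (g b)
    | .inr (.inr a) => p₂.action f₂ none a s
  have H₁ : ∀ a s b, δ (f₁ a) s b = p₁.action f₁ (some L) a s := fun a s b => by simp [δ, f₁]
  have HL : ∀ s b, δ L s b = loadAction L S s (g b) := fun s b => by simp [δ, L]
  have H₂ : ∀ a s b, δ (f₂ a) s b = p₂.action f₂ none a s := fun a s b => by simp [δ, f₂]
  refine ⟨⟨5, n, δ⟩, fun hg q s b b' => ?_, fun x α N₁ m₁ R h₁ h6 h3 => ?_⟩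
  · change δ q s b = δ q s b'
    simp only [δ]
    split
    · rfl
    · rw [hg b b']
    · rfl
  · obtain ⟨k, hk, hk'⟩ := machine_run H₁ h₁
    refine ⟨k, hk, fun ρ₁ ρ₂ ρ₃ N₂ m₂ l₁ l₂ l₃ h₂ => ?_⟩
    obtain ⟨k₂, hk₂, hk₂'⟩ := machine_run H₂ h₂
    obtain ⟨b, ρ₃, rfl⟩ := List.exists_cons_of_length_pos (by omega : 0 < ρ₃.length)
    simp only [List.length_cons] at l₃
    have e1 : ρ₁ ++ ρ₂ ++ b :: ρ₃ = ρ₁ ++ ((ρ₂ ++ [b]) ++ (ρ₃.take k₂ ++ ρ₃.drop k₂)) := by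
      simp
    have e2 : toCfg δ (some L) m₁ = ⟨some L, Function.update (fun i => stackTape (m₁.1 i)) 3
        ((stackTape []).move .left), m₁.2⟩ := by
      simp only [toCfg, PTM.Cfg.mk.injEq, true_and, and_true]
      funext j
      by_cases hj : j = 3
      · subst hj; simp [h3, stackTape_nil_left]
      · simp [hj]
    have e3 := machine_load HL m₁.1 m₁.2 [] ρ₂ (by rw [h6, l₂]) h3 b
    rw [List.append_nil] at e3
    rw [e1, List.foldl_append, List.foldl_append, List.foldl_append,
      init_eq x α (some (f₁ (.inl p₁.start))) (by simp [f₁, he]), hk' ρ₁ l₁, e2, e3,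
      hk₂' (ρ₃.take k₂) (by simp; omega), foldl_step_none _ _ rfl]
    exact ⟨rfl, rfl⟩

end Prog

/-! ### Averages over strings of random bits -/

/-- The average of `f` over the strings of length `n`. -/
noncomputable def avg (n : ℕ) (f : List Bool → ℝ) : ℝ :=
  (∑ r : Fin n → Bool, f (List.ofFn r)) / 2 ^ n

open Classical in
/-- The fraction of the strings of length `n` that satisfy `P`. -/
noncomputable def prob (n : ℕ) (P : List Bool → Prop) : ℝ := avg n fun r => if P r then 1 else 0

lemma avg_zero (f : List Bool → ℝ) : avg 0 f = f [] := by simp [avg]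

lemma avg_const (n : ℕ) (a : ℝ) : avg n (fun _ => a) = a := by simp [avg]

lemma avg_congr {n : ℕ} {f g : List Bool → ℝ} (h : ∀ r, r.length = n → f r = g r) :
    avg n f = avg n g := by
  unfold avg
  rw [Finset.sum_congr rfl fun r _ => h (List.ofFn r) (by simp)]

lemma avg_mono {n : ℕ} {f g : List Bool → ℝ} (h : ∀ r, r.length = n → f r ≤ g r) :
    avg n f ≤ avg n g := by
  unfold avg
  exact div_le_div_of_nonneg_right (Finset.sum_le_sum fun r _ => h (List.ofFn r) (by simp))
    (by positivity)

lemma avg_add (n : ℕ) (f g : List Bool → ℝ) :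
    avg n (fun r => f r + g r) = avg n f + avg n g := by
  simp [avg, Finset.sum_add_distrib, add_div]

lemma avg_mul_left (n : ℕ) (a : ℝ) (f : List Bool → ℝ) :
    avg n (fun r => a * f r) = a * avg n f := by
  simp [avg, ← Finset.mul_sum, mul_div_assoc]

/-- Disjoint segments of a random string are independent. -/
lemma avg_mul (a b : ℕ) (f g : List Bool → ℝ) :
    avg (a + b) (fun r => f (r.take a) * g (r.drop a)) = avg a f * avg b g := by
  unfold avg
  rw [← (Fin.appendEquiv a b).sum_comp, Fintype.sum_prod_type, pow_add, div_mul_div_comm,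
    Finset.sum_mul_sum]
  congr 1
  refine Finset.sum_congr rfl fun u _ => Finset.sum_congr rfl fun v _ => ?_
  simp only [Fin.appendEquiv, Equiv.coe_fn_mk, List.ofFn_fin_append]
  rw [List.take_left' (by simp), List.drop_left' (by simp)]

lemma avg_take (a b : ℕ) (f : List Bool → ℝ) :
    avg (a + b) (fun r => f (r.take a)) = avg a f := by
  simpa [avg_const] using avg_mul a b f fun _ => 1

lemma avg_drop (a b : ℕ) (f : List Bool → ℝ) :
    avg (a + b) (fun r => f (r.drop a)) = avg b f := by
  simpa [avg_const] using avg_mul a b (fun _ => 1) f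

lemma prob_congr {n : ℕ} {P Q : List Bool → Prop} (h : ∀ r, r.length = n → (P r ↔ Q r)) :
    prob n P = prob n Q := by
  refine avg_congr fun r hr => ?_
  classical exact if_congr (h r hr) rfl rfl

lemma prob_mono {n : ℕ} {P Q : List Bool → Prop} (h : ∀ r, r.length = n → P r → Q r) :
    prob n P ≤ prob n Q := by
  refine avg_mono fun r hr => ?_
  by_cases hP : P r
  · simp [hP, h r hr hP]
  · simp only [hP, if_false]
    split <;> norm_num

lemma prob_nonneg (n : ℕ) (P : List Bool → Prop) : 0 ≤ prob n P := by
  have : avg n (fun _ => 0) ≤ prob n P := avg_mono fun r _ => by split <;> norm_num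
  rwa [avg_const] at this

lemma prob_true {n : ℕ} {P : List Bool → Prop} (h : ∀ r, r.length = n → P r) : prob n P = 1 := by
  rw [← avg_const n 1]
  exact avg_congr fun r hr => if_pos (h r hr)

lemma prob_not (n : ℕ) (P : List Bool → Prop) : prob n (fun r => ¬ P r) = 1 - prob n P := by
  have : prob n (fun r => ¬ P r) + prob n P = 1 := by
    unfold prob
    rw [← avg_add]
    refine (avg_congr fun r _ => ?_).trans (avg_const n 1)
    by_cases h : P r <;> simp [h]
  linarith

lemma prob_and (a b : ℕ) (P Q : List Bool → Prop) :
    prob (a + b) (fun r => P (r.take a) ∧ Q (r.drop a)) = prob a P * prob b Q := by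
  unfold prob
  rw [← avg_mul]
  refine avg_congr fun r _ => ?_
  by_cases h : P (r.take a) <;> by_cases h' : Q (r.drop a) <;> simp [h, h']

lemma prob_take (a b : ℕ) (P : List Bool → Prop) :
    prob (a + b) (fun r => P (r.take a)) = prob a P := by
  classical
  exact avg_take a b fun r => if P r then 1 else 0

lemma prob_drop (a b : ℕ) (P : List Bool → Prop) :
    prob (a + b) (fun r => P (r.drop a)) = prob b P := by
  classical
  exact avg_drop a b fun r => if P r then 1 else 0

namespace PTM

/-- The configuration after reading the random bits `ρ`. -/
def runList (M : PTM) (x α ρ : List Bool) : M.Cfg := ρ.foldl M.step (M.init x α)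

lemma outputProb_eq (M : PTM) (x α : List Bool) (T : ℕ) (y : List Bool) :
    M.outputProb x α T y = prob T fun ρ => (M.runList x α ρ).out = y := by
  classical
  unfold outputProb prob avg
  congr 1
  dsimp only
  rw [Nat.card_eq_fintype_card, Fintype.card_subtype, Finset.card_filter, Nat.cast_sum]
  refine Finset.sum_congr rfl fun r _ => ?_
  rw [Nat.cast_ite, Nat.cast_one, Nat.cast_zero]
  by_cases h : (M.run x α r).out = y
  · rw [if_pos h]; exact (if_pos h).symm
  · rw [if_neg h]; exact (if_neg h).symm

lemma haltsWithin_iff (M : PTM) (x α : List Bool) (T : ℕ) :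
    M.HaltsWithin x α T ↔ ∀ ρ : List Bool, ρ.length = T → (M.runList x α ρ).state = none := by
  constructor
  · rintro h ρ rfl
    simpa [run, runList] using h fun i => ρ[i]
  · intro h r
    exact h (List.ofFn r) (by simp)

lemma runList_append_of_halted {M : PTM} {x α ρ : List Bool}
    (h : (M.runList x α ρ).state = none) (ρ' : List Bool) :
    M.runList x α (ρ ++ ρ') = M.runList x α ρ := by
  unfold runList at *
  rw [List.foldl_append, Prog.foldl_step_none _ _ h]

lemma HaltsWithin.mono {M : PTM} {x α : List Bool} {T T' : ℕ} (h : M.HaltsWithin x α T)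
    (hT : T ≤ T') : M.HaltsWithin x α T' := by
  rw [haltsWithin_iff] at *
  intro ρ hρ
  have h1 := h (ρ.take T) (by simp; omega)
  rw [← List.take_append_drop T ρ, runList_append_of_halted h1, h1]

lemma HaltsWithin.outputProb_eq {M : PTM} {x α : List Bool} {T T' : ℕ} (h : M.HaltsWithin x α T)
    (hT : T ≤ T') (y : List Bool) : M.outputProb x α T' y = M.outputProb x α T y := by
  obtain ⟨k, rfl⟩ := Nat.exists_eq_add_of_le hT
  rw [haltsWithin_iff] at h
  rw [PTM.outputProb_eq, PTM.outputProb_eq, ← prob_take T k]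
  refine prob_congr fun ρ hρ => ?_
  have h1 := h (ρ.take T) (by simp; omega)
  conv_lhs => rw [← List.take_append_drop T ρ, runList_append_of_halted h1]

lemma DecidesAt.mono {M : PTM} {L : Language Bool} {x α : List Bool} {T T' : ℕ}
    (h : M.DecidesAt L x α T) (hT : T ≤ T') : M.DecidesAt L x α T' :=
  ⟨h.1.mono hT, by rw [h.1.outputProb_eq hT]; exact h.2⟩

end PTM

/-! ### From polynomial-time transformations to Turing machines -/

namespace Transforms
open SExp Prog

/-- Two transformations make a machine: the first one computes from a constant `e`, the input and
the advice a number `R` of random bits and further data, the second one computes the output from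
the random bits and these data. The exponent of the time bound does not depend on the constant. -/
theorem exists_machine_aux {ι : Type*} {B : ι → ℕ} {x α : ι → List Bool} {e d : ι → SExp}
    {R : ι → ℕ} {G : ι → List Bool → List Bool} (g : Bool → Bool)
    (h₁ : Transforms B (fun i => .cons (e i) (.cons (ofBits (x i)) (ofBits (α i))))
      fun i => .cons (ofNat (R i)) (d i))
    (h₂ : Transforms (fun s : (i : ι) × {r : List Bool // r.length = R i} => B s.1)
      (fun s => .cons (ofBits (s.2.1.map g)) (d s.1)) fun s => ofBits (G s.1 s.2.1)) :
    ∃ c, ∀ e₀, ∃ M : PTM, ((∀ b b', g b = g b') → M.Deterministic) ∧ ∀ i, e i = e₀ →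
      ∃ k n, k + R i + n = (B i + 2) ^ c ∧ ∀ ρ : List Bool, ρ.length = (B i + 2) ^ c →
        (M.runList (x i) (α i) ρ).state = none ∧
        (M.runList (x i) (α i) ρ).out = G i ((ρ.drop k).take (R i)) := by
  obtain ⟨hin, hmid, p₁, T₁, hT₁, hp₁⟩ := h₁
  obtain ⟨-, hout, p₂, T₂, ⟨c₂, hc₂⟩, hp₂⟩ := h₂
  obtain ⟨c₃, hc₃⟩ := hout
  obtain ⟨c, hc⟩ := (PolyBdd.const 25).mul (((((hin.add hmid).add hT₁).add
    (show PolyBdd B fun i => (B i + 2) ^ c₂ from ⟨c₂, fun _ => le_rfl⟩)).add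
    (show PolyBdd B fun i => (B i + 2) ^ c₃ from ⟨c₃, fun _ => le_rfl⟩)).add (PolyBdd.const 2))
  refine ⟨c, fun e₀ => ?_⟩
  obtain ⟨M, hdet, hM⟩ := Prog.exists_machine ((readAll e₀).seq (p₁.seq takeUnary))
    ((op (.push 2 false)).seq (consBits.seq ((op (.push 2 true)).seq (p₂.seq emitLoop)))) g
  refine ⟨M, hdet, fun i hi => ?_⟩
  subst hi
  have hci := hc i
  simp only [size_cons, size_ofNat] at hci
  have hx := length_le_size_ofBits (x i)
  have hα := length_le_size_ofBits (α i)
  have h2 : p₁.Ex (mem [] [] (SExp.cons (e i) (.cons (ofBits (x i)) (ofBits (α i)))).code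
      [] [] [] [] []) (T₁ i) (mem [] [] (SExp.cons (ofNat (R i)) (d i)).code [] [] [] [] []) := by
    have := hp₁ i [] [] [] [] []
    rwa [List.append_nil, List.append_nil] at this
  obtain ⟨k, hk, hrun⟩ := hM (x i) (α i) _ _ (R i)
    ((ex_readAll (e i)).seq (h2.seq (ex_takeUnary (R i) (d i))))
    rfl rfl
  refine ⟨k, (B i + 2) ^ c - (k + R i), by omega, fun ρ hρ => ?_⟩
  have hlen : ((ρ.drop k).take (R i)).length = R i := by simp; omega
  obtain ⟨w', hw'⟩ := ex_emitLoop (i := []) (a := []) (w := []) (x := []) (y := []) (c := [])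
    (r := []) (o := []) (G i ((ρ.drop k).take (R i)))
  have h3 := hp₂ ⟨i, _, hlen⟩ [] [] [] [] []
  have h4 := (Ex.push2 (i := []) (a := []) (w := (d i).code)
    (x := (((ρ.drop k).take (R i)).map g).reverse) (y := []) (c := [])
    (r := []) (o := []) false).seq ((ex_consBits []).seq ((Ex.push2 true).seq
      (Ex.seq (by simpa [code] using h3) hw')))
  have h5 := hc₂ ⟨i, _, hlen⟩
  have h6 := hc₃ ⟨i, _, hlen⟩
  have h7 := length_le_size_ofBits (G i ((ρ.drop k).take (R i)))
  dsimp only at h5 h6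
  have hl : (List.map g ((ρ.drop k).take (R i))).reverse.length = R i := by
    rw [List.length_reverse, List.length_map, hlen]
  rw [hl] at h4
  have := hrun (ρ.take k) ((ρ.drop k).take (R i)) ((ρ.drop k).drop (R i))
    (1 + (8 * R i + 1 + (1 + (T₂ ⟨i, _, hlen⟩ +
      (7 * (G i ((ρ.drop k).take (R i))).length + 1))))) _ (by simp; omega) hlen
    (by simp only [List.length_drop, hρ]; omega)
    (by
      convert h4 using 2
      funext j; fin_cases j <;> rfl)
  rw [List.append_assoc, List.take_append_drop, List.take_append_drop] at this
  exact ⟨this.1, this.2.trans (by simp)⟩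

/-- The machine of `exists_machine_aux` with random bits: the distribution of its output. -/
theorem exists_machine {ι : Type*} {B : ι → ℕ} {x α : ι → List Bool} {e d : ι → SExp}
    {R : ι → ℕ} {G : ι → List Bool → List Bool}
    (h₁ : Transforms B (fun i => .cons (e i) (.cons (ofBits (x i)) (ofBits (α i))))
      fun i => .cons (ofNat (R i)) (d i))
    (h₂ : Transforms (fun s : (i : ι) × {r : List Bool // r.length = R i} => B s.1)
      (fun s => .cons (ofBits s.2.1) (d s.1)) fun s => ofBits (G s.1 s.2.1)) :
    ∃ c, ∀ e₀, ∃ M : PTM, ∀ i, e i = e₀ → ∀ T, (B i + 2) ^ c ≤ T →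
      M.HaltsWithin (x i) (α i) T ∧
      ∀ y, M.outputProb (x i) (α i) T y = prob (R i) fun r => G i r = y := by
  obtain ⟨c, hc⟩ := exists_machine_aux (G := G) id h₁ (by simpa using h₂)
  refine ⟨c, fun e₀ => ?_⟩
  obtain ⟨M, -, hM⟩ := hc e₀
  refine ⟨M, fun i hi T hT => ?_⟩
  obtain ⟨k, n, hkn, h⟩ := hM i hi
  have hh : M.HaltsWithin (x i) (α i) ((B i + 2) ^ c) :=
    (M.haltsWithin_iff _ _ _).2 fun ρ hρ => (h ρ hρ).1
  refine ⟨hh.mono hT, fun y => ?_⟩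
  rw [hh.outputProb_eq hT, PTM.outputProb_eq, ← hkn, add_assoc,
    prob_congr (Q := fun ρ => G i ((ρ.drop k).take (R i)) = y)
      (fun ρ hρ => by rw [(h ρ (by omega)).2]),
    prob_drop k (R i + n) fun ρ => G i (ρ.take (R i)) = y, prob_take _ _ fun r => G i r = y]

end Transforms

/-! ### A universal machine, as a function on trees -/

namespace SExp

/-- Reversal of a list. -/
def rev (l : SExp) : SExp := fold cons l nil

lemma size_fold_cons (l s : SExp) : (fold cons l s).size + 1 = l.size + s.size := by
  induction l generalizing s with
  | nil => simp; omega
  | cons a b _ ih => have := ih (cons a s); simp at *; omega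

lemma size_rev (l : SExp) : l.rev.size = l.size := by
  have := size_fold_cons l nil
  simpa [rev] using this

lemma fold_cons_ofList (l l' : List SExp) :
    fold cons (ofList l) (ofList l') = ofList (l.reverse ++ l') := by
  induction l generalizing l' with
  | nil => rfl
  | cons a l ih => simpa using ih (a :: l')

lemma rev_ofList (l : List SExp) : (ofList l).rev = ofList l.reverse :=
  (fold_cons_ofList l []).trans (by rw [List.append_nil])

lemma rev_ofBits (l : List Bool) : (ofBits l).rev = ofBits l.reverse := by
  simp [ofBits, rev_ofList]

/-- Delete from `x` as many entries as the list `l` has. -/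
def dropAs (l x : SExp) : SExp := fold (fun _ s => s.tl) l x

lemma dropAs_ofNat (n : ℕ) (l : List SExp) : dropAs (ofNat n) (ofList l) = ofList (l.drop n) := by
  induction n generalizing l with
  | zero => rfl
  | succ n ih => cases l with
    | nil => simpa [dropAs] using ih []
    | cons a l => simpa [dropAs] using ih l

lemma dropAs_ofNat_ofNat (m n : ℕ) : dropAs (ofNat m) (ofNat n) = ofNat (n - m) :=
  (dropAs_ofNat m _).trans (by rw [List.drop_replicate]; rfl)

lemma size_dropAs_le (l x : SExp) : (dropAs l x).size ≤ x.size := by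
  have := size_fold_le (f := fun _ s => s.tl) (K := 0) (l := l) (fun _ s _ => size_tl_le s) x
  rw [dropAs]
  simpa using this

/-- The symbol under the head of a tape, which is the pair of the reversed part to the left of the
head and the part from the head on. -/
def tapeHead (t : SExp) : SExp := t.tl.hd

/-- Descend in a ternary tree along the symbol `h`. -/
def triSel (h t : SExp) : SExp := h.sel t.hd (h.hd.sel t.tl.hd t.tl.tl)

/-- Write on a tape and move its head. -/
def applyTape (op t : SExp) : SExp :=
  op.tl.sel (cons t.hd (cons op.hd t.tl.tl))
    (op.tl.hd.sel (cons t.hd.tl (cons t.hd.hd (cons op.hd t.tl.tl)))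
      (cons (cons op.hd t.hd) t.tl.tl))

/-- Apply a list of operations to a list of tapes. -/
def applyTapes (ops tapes : SExp) : SExp :=
  (fold (fun op s => cons s.hd.tl (cons (applyTape op s.hd.hd) s.tl)) ops (cons tapes nil)).tl.rev

/-- The action for a state, a list of tapes, and a random bit. -/
def findAction (tab q tapes b : SExp) : SExp :=
  b.sel (fold (fun tp t => triSel (tapeHead tp) t) tapes (dropAs q.tl tab).hd).hd
    (fold (fun tp t => triSel (tapeHead tp) t) tapes (dropAs q.tl tab).hd).tl

/-- The configuration that results from an action. -/
def applyAction (act tapes out : SExp) : SExp :=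
  cons act.hd (cons (applyTapes act.tl.hd tapes) (act.tl.tl.sel out (cons act.tl.tl.hd out)))

/-- One step of the machine with transition table `tab` in the configuration `c`, which consists of
the state, the list of tapes, and the reversed output. -/
def simStep (tab b c : SExp) : SExp :=
  c.hd.sel c (applyAction (findAction tab c.hd c.tl.hd b) c.tl.hd c.tl.tl)

lemma size_triSel_le (h t : SExp) : (triSel h t).size ≤ t.size := by
  have := size_hd_le t
  have := size_tl_le t
  have := size_hd_le t.tl
  have := size_tl_le t.tl
  unfold triSel
  cases h with
  | nil => simpa
  | cons a b => cases a <;> simp <;> omega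

lemma size_hd_add_tl (t : SExp) : t.hd.size + t.tl.size ≤ t.size + 1 := by
  cases t <;> simp
  omega

lemma size_applyTape_le (op t : SExp) : (applyTape op t).size ≤ t.size + op.size + 5 := by
  have h1 := size_hd_add_tl t
  have h2 := size_hd_add_tl t.hd
  have h3 := size_hd_add_tl t.tl
  have h4 := size_hd_le op
  have h5 := one_le_size t.hd.tl
  have h6 := one_le_size t.tl.hd
  unfold applyTape
  cases op.tl with
  | nil => simp; omega
  | cons a b => cases a <;> simp <;> omega

lemma size_applyTapes_le (ops tapes : SExp) :
    (applyTapes ops tapes).size ≤ tapes.size + 2 + ops.size * (ops.size + 10) := by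
  unfold applyTapes
  rw [size_rev]
  refine (size_tl_le _).trans ((size_fold_le (K := ops.size + 10) (fun op s hop => ?_) _).trans ?_)
  · have h1 := size_applyTape_le op s.hd.hd
    have h2 := size_hd_add_tl s
    have h3 := size_hd_add_tl s.hd
    simp
    omega
  · simp

lemma size_findAction_le (tab q tapes b : SExp) : (findAction tab q tapes b).size ≤ tab.size := by
  have h1 := size_fold_le (f := fun tp t => triSel (tapeHead tp) t) (K := 0) (l := tapes)
    (fun _ _ _ => size_triSel_le _ _) (dropAs q.tl tab).hd
  have h2 := size_hd_le (dropAs q.tl tab)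
  have h3 := size_dropAs_le q.tl tab
  simp only [mul_zero, add_zero] at h1
  unfold findAction
  cases b with
  | nil => exact (size_hd_le _).trans (by omega)
  | cons _ _ => exact (size_tl_le _).trans (by omega)

lemma size_simStep_le (tab b c : SExp) :
    (simStep tab b c).size ≤ c.size + (tab.size * (tab.size + 10) + 2 * tab.size + 10) := by
  have h0 := size_findAction_le tab c.hd c.tl.hd b
  have h0' := one_le_size c.hd
  unfold simStep
  generalize e : findAction tab c.hd c.tl.hd b = act at *
  cases h : c.hd with
  | nil => simp
  | cons u v =>
    rw [← h]
    have h1 := size_applyTapes_le act.tl.hd c.tl.hd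
    have h2 := size_hd_le act
    have h3 := size_tl_le act
    have h4 := size_hd_le act.tl
    have h5 := size_tl_le act.tl
    have h6 := size_hd_le act.tl.tl
    have h7 := size_hd_add_tl c
    have h8 := size_hd_add_tl c.tl
    have h9 : act.tl.hd.size * (act.tl.hd.size + 10) ≤ tab.size * (tab.size + 10) :=
      Nat.mul_le_mul (by omega) (by omega)
    have h10 := size_sel_le act.tl.tl c.tl.tl (cons act.tl.tl.hd c.tl.tl)
    have h11 : (act.tl.tl.sel c.tl.tl (cons act.tl.tl.hd c.tl.tl)).size
        ≤ act.tl.tl.hd.size + c.tl.tl.size + 1 := by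
      cases act.tl.tl with
      | nil => simp; omega
      | cons u v => simp
    simp only [applyAction, h, sel_cons, size_cons]
    omega

/-- Run the machine for as many steps as `T` tells, with random bits from a list. State: the pair of
the rest of this list and the configuration. -/
def simRun (tab T s : SExp) : SExp :=
  fold (fun _ s => cons s.hd.tl (simStep tab s.hd.hd s.tl)) T s

/-- The initial tape that holds `x`. -/
def loadTape (x : SExp) : SExp := cons nil (fold (fun h s => cons (cons h nil) s) x nil).rev

/-- The initial configuration on input `x` with advice `a` of a machine with description `M`. -/
def simInit (M x a : SExp) : SExp :=
  cons (ofNat 1) (cons (cons (loadTape x) (cons (loadTape a)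
    (fold (fun _ s => cons (cons nil nil) s) M.hd nil))) nil)

/-- A fold over a list whose step function has no parameter. -/
lemma polyTime_fold' {f : SExp → SExp → SExp} {l s : SExp → SExp}
    (hf : PolyTime fun y => f y.hd y.tl)
    (hsize : ∃ c, ∀ h s, (f h s).size ≤ s.size + (h.size + 2) ^ c)
    (hl : PolyTime l) (hs : PolyTime s) : PolyTime fun x => fold f (l x) (s x) := by
  obtain ⟨c, hc⟩ := hsize
  refine PolyTime.fold (f := fun _ => f) (e := fun _ => nil) ?_ ⟨c, fun x h s => ?_⟩
    (PolyTime.const _) hl hs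
  · have := hf.comp (g := fun y => cons y.tl.hd y.tl.tl) (by fun_prop)
    simpa using this
  · refine (hc h s).trans (Nat.add_le_add_left (Nat.pow_le_pow_left ?_ c) _)
    omega

@[fun_prop] lemma polyTime_rev {f : SExp → SExp} (hf : PolyTime f) : PolyTime fun x => (f x).rev :=
  polyTime_fold' (by fun_prop) ⟨1, fun h s => by simp; omega⟩ hf (by fun_prop)

@[fun_prop] lemma polyTime_dropAs {f g : SExp → SExp} (hf : PolyTime f) (hg : PolyTime g) :
    PolyTime fun x => dropAs (f x) (g x) :=
  polyTime_fold' (by fun_prop) ⟨1, fun h s => (size_tl_le s).trans (by omega)⟩ hf hg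

@[fun_prop] lemma polyTime_triSel {f g : SExp → SExp} (hf : PolyTime f) (hg : PolyTime g) :
    PolyTime fun x => triSel (f x) (g x) := by unfold triSel; fun_prop

@[fun_prop] lemma polyTime_tapeHead {f : SExp → SExp} (hf : PolyTime f) :
    PolyTime fun x => tapeHead (f x) := by unfold tapeHead; fun_prop

@[fun_prop] lemma polyTime_applyTape {f g : SExp → SExp} (hf : PolyTime f) (hg : PolyTime g) :
    PolyTime fun x => applyTape (f x) (g x) := by unfold applyTape; fun_prop

@[fun_prop] lemma polyTime_applyTapes {f g : SExp → SExp} (hf : PolyTime f) (hg : PolyTime g) :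
    PolyTime fun x => applyTapes (f x) (g x) := by
  unfold applyTapes
  refine polyTime_rev (PolyTime.tl (polyTime_fold' (by fun_prop) ⟨4, fun op s => ?_⟩ hf
    (by fun_prop)))
  have h1 := size_applyTape_le op s.hd.hd
  have h2 := size_hd_add_tl s
  have h3 := size_hd_add_tl s.hd
  have h4 : op.size + 10 ≤ (op.size + 2) ^ 4 := by
    have : op.size + 2 ≤ (op.size + 2) ^ 3 := Nat.le_self_pow (by norm_num) _
    have := one_le_size op
    have : 3 ^ 3 ≤ (op.size + 2) ^ 3 := Nat.pow_le_pow_left (by omega) 3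
    rw [pow_succ]
    nlinarith
  simp
  omega

@[fun_prop] lemma polyTime_findAction {f g h k : SExp → SExp} (hf : PolyTime f) (hg : PolyTime g)
    (hh : PolyTime h) (hk : PolyTime k) :
    PolyTime fun x => findAction (f x) (g x) (h x) (k x) := by
  have : PolyTime fun x => fold (fun tp t => triSel (tapeHead tp) t) (h x)
      (dropAs (g x).tl (f x)).hd :=
    polyTime_fold' (by fun_prop) ⟨1, fun h s => (size_triSel_le _ _).trans (by omega)⟩ hh
      (by fun_prop)
  unfold findAction
  fun_prop

@[fun_prop] lemma polyTime_simStep {f g h : SExp → SExp} (hf : PolyTime f) (hg : PolyTime g)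
    (hh : PolyTime h) : PolyTime fun x => simStep (f x) (g x) (h x) := by
  unfold simStep applyAction; fun_prop

@[fun_prop] lemma polyTime_simRun {f g h : SExp → SExp} (hf : PolyTime f) (hg : PolyTime g)
    (hh : PolyTime h) : PolyTime fun x => simRun (f x) (g x) (h x) := by
  unfold simRun
  refine PolyTime.fold (f := fun tab _ s => cons s.hd.tl (simStep tab s.hd.hd s.tl)) (by fun_prop)
    ⟨5, fun tab b s => ?_⟩ hf hg hh
  have h1 := size_simStep_le tab s.hd.hd s.tl
  have h2 := size_hd_add_tl s
  have h3 := size_tl_le s.hd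
  have h4 : tab.size * (tab.size + 10) + 2 * tab.size + 12 ≤ (tab.size + b.size + 2) ^ 5 := by
    refine le_trans ?_ (Nat.pow_le_pow_left (by omega : tab.size + 2 ≤ _) 5)
    nlinarith [Nat.zero_le tab.size, Nat.zero_le (tab.size ^ 2), Nat.zero_le (tab.size ^ 3),
      Nat.zero_le (tab.size ^ 4), Nat.zero_le (tab.size ^ 5)]
  simp
  omega

@[fun_prop] lemma polyTime_loadTape {f : SExp → SExp} (hf : PolyTime f) :
    PolyTime fun x => loadTape (f x) := by
  have : PolyTime fun x => fold (fun h s => cons (cons h nil) s) (f x) nil :=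
    polyTime_fold' (by fun_prop) ⟨2, fun h s => by simp; nlinarith⟩ hf (by fun_prop)
  unfold loadTape
  fun_prop

@[fun_prop] lemma polyTime_simInit {f g h : SExp → SExp} (hf : PolyTime f) (hg : PolyTime g)
    (hh : PolyTime h) : PolyTime fun x => simInit (f x) (g x) (h x) := by
  have : PolyTime fun x => fold (fun _ s => cons (cons nil nil) s) (f x).hd nil :=
    polyTime_fold' (by fun_prop) ⟨2, fun h s => by
      have : 2 ^ 2 ≤ (h.size + 2) ^ 2 := Nat.pow_le_pow_left (by omega) 2
      simp
      omega⟩ (by fun_prop) (by fun_prop)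
  unfold simInit
  fun_prop

end SExp

/-! ### Correctness of the universal machine -/

namespace PTM
open Turing

/-- A tape symbol as a tree; the blank is `nil`, also beyond the end of a list. -/
def symTree : Option Bool → SExp
  | none => nil
  | some b => cons (ofBool b) nil

/-- A head move as a tree. -/
def moveTree : Option Dir → SExp
  | none => nil
  | some .left => cons nil nil
  | some .right => cons (cons nil nil) nil

/-- A state as a tree: `nil` for halting, and `i + 1` in unary notation for the state `i`. -/
def stateTree {q : ℕ} : Option (Fin q) → SExp
  | none => nil
  | some i => ofNat (i.val + 1)

/-- An action as a tree: the next state, the list of tape operations, and the emitted symbol. -/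
def actionTree {k q : ℕ} (a : PTMAction k q) : SExp :=
  cons (stateTree a.next) (cons
    (ofList (List.ofFn fun i => cons (symTree (a.write i)) (moveTree (a.move i))))
    (symTree a.emit))

/-- The ternary tree that stores the values of a function of `k` symbols. -/
def trie : (k : ℕ) → ((Fin k → Option Bool) → SExp) → SExp
  | 0, f => f Fin.elim0
  | k + 1, f => cons (trie k fun v => f (Fin.cons none v))
      (cons (trie k fun v => f (Fin.cons (some false) v))
        (trie k fun v => f (Fin.cons (some true) v)))

/-- The transition table of a machine as a tree: the list over the states of the ternary trees over
the symbols read, whose leaves are the pairs of the actions for the two values of the random bit. -/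
def table (M : PTM) : SExp :=
  ofList (List.ofFn fun q => trie (M.extraTapes + 2) fun s =>
    cons (actionTree (M.δ q s false)) (actionTree (M.δ q s true)))

/-- The description of a machine for the universal machine. -/
def desc (M : PTM) : SExp := cons (ofNat M.extraTapes) M.table

/-- A list of tape symbols as a tree. -/
def symsTree (l : List (Option Bool)) : SExp := ofList (l.map symTree)

/-- The tree `d` represents the configuration `c`. Tapes are represented by finite lists that cover
their non-blank parts. -/
def Represents {M : PTM} (c : M.Cfg) (d : SExp) : Prop :=
  ∃ L R : Fin (M.extraTapes + 2) → List (Option Bool),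
    (∀ i, c.tape i = Tape.mk' (ListBlank.mk (L i)) (ListBlank.mk (R i))) ∧
    d = cons (stateTree c.state) (cons
      (ofList (List.ofFn fun i => cons (symsTree (L i)) (symsTree (R i)))) (ofBits c.out.reverse))

@[simp] lemma symTree_hd (l : List (Option Bool)) : (symsTree l).hd = symTree l.headI := by
  cases l <;> rfl

@[simp] lemma symTree_tl (l : List (Option Bool)) : (symsTree l).tl = symsTree l.tail := by
  cases l <;> rfl

lemma symsTree_cons (a : Option Bool) (l : List (Option Bool)) :
    cons (symTree a) (symsTree l) = symsTree (a :: l) := rfl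

lemma triSel_symTree (a : Option Bool) (x y z : SExp) :
    triSel (symTree a) (cons x (cons y z)) = match a with
      | none => x | some false => y | some true => z := by
  rcases a with _ | _ | _ <;> rfl

lemma fold_triSel {k : ℕ} (f : (Fin k → Option Bool) → SExp)
    (L R : Fin k → List (Option Bool)) :
    fold (fun tp t => triSel (tapeHead tp) t)
      (ofList (List.ofFn fun i => cons (symsTree (L i)) (symsTree (R i)))) (trie k f) =
      f fun i => (R i).headI := by
  induction k with
  | zero => simp only [List.ofFn_zero, ofList_nil, fold_nil, trie]; congr; funext i; exact i.elim0
  | succ k ih =>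
    rw [List.ofFn_succ, ofList_cons, fold_cons, tapeHead, tl_cons, symTree_hd, trie, triSel_symTree]
    have e : ∀ a, ((fun i : Fin (k + 1) => (R i).headI) = Fin.cons a fun i => (R i.succ).headI) ↔
        (R 0).headI = a := fun a => by
      constructor
      · intro h; exact congrFun h 0
      · rintro rfl; funext i; refine Fin.cases ?_ (fun i => ?_) i <;> simp
    rcases h : (R 0).headI with _ | _ | _ <;> simp only [(e _).2 h] <;> exact ih _ _ _

lemma applyTapes_ofList {k : ℕ} (g h : Fin k → SExp) :
    applyTapes (ofList (List.ofFn g)) (ofList (List.ofFn h)) =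
      ofList (List.ofFn fun i => applyTape (g i) (h i)) := by
  have key : ∀ k (g h : Fin k → SExp) (acc : List SExp),
      (fold (fun op s => cons s.hd.tl (cons (applyTape op s.hd.hd) s.tl)) (ofList (List.ofFn g))
        (cons (ofList (List.ofFn h)) (ofList acc))).tl =
      ofList ((List.ofFn fun i => applyTape (g i) (h i)).reverse ++ acc) := by
    intro k
    induction k with
    | zero => intro g h acc; simp
    | succ k ih =>
      intro g h acc
      simp only [List.ofFn_succ, ofList_cons, fold_cons, hd_cons, tl_cons, List.reverse_cons,
        List.append_assoc]
      exact ih _ _ (_ :: acc)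
  have := key k g h []
  rw [ofList_nil] at this
  rw [applyTapes, this, rev_ofList]
  simp

/-- The left and the right part of a tape after writing `a` and moving by `m`. -/
lemma applyTape_tree (a : Option Bool) (m : Option Dir) (l r : List (Option Bool)) :
    ∃ l' r', moveHead ((Tape.mk' (ListBlank.mk l) (ListBlank.mk r)).write a) m =
        Tape.mk' (ListBlank.mk l') (ListBlank.mk r') ∧
      applyTape (cons (symTree a) (moveTree m)) (cons (symsTree l) (symsTree r)) =
        cons (symsTree l') (symsTree r') := by
  rcases m with _ | _ | _
  · exact ⟨l, a :: r.tail, by simp [moveHead, Tape.write_mk'], by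
      simp [applyTape, moveTree, symsTree_cons]⟩
  · exact ⟨l.tail, l.headI :: a :: r.tail, by simp [moveHead, Tape.write_mk'], by
      simp [applyTape, moveTree, symsTree_cons]⟩
  · exact ⟨a :: l, r.tail, by simp [moveHead, Tape.write_mk'], by
      simp [applyTape, moveTree, symsTree_cons]⟩

lemma Represents.step {M : PTM} {c : M.Cfg} {d : SExp} (h : Represents c d) (b : Bool) :
    Represents (M.step c b) (simStep M.table (ofBool b) d) := by
  obtain ⟨L, R, hc, rfl⟩ := h
  obtain ⟨st, tp, out⟩ := c
  rcases st with _ | q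
  · exact ⟨L, R, hc, rfl⟩
  · dsimp only at hc
    have hhead : ∀ i, (tp i).head = (R i).headI := fun i => by rw [hc]; simp
    have e1 : findAction M.table (ofNat (q.val + 1))
        (ofList (List.ofFn fun i => cons (symsTree (L i)) (symsTree (R i)))) (ofBool b) =
        actionTree (M.δ q (fun i => (tp i).head) b) := by
      have h1 : (dropAs (ofNat (q.val + 1)).tl M.table).hd = trie (M.extraTapes + 2) fun s =>
          cons (actionTree (M.δ q s false)) (actionTree (M.δ q s true)) := by
        rw [ofNat_succ, tl_cons, table, dropAs_ofNat, List.drop_eq_getElem_cons (by rw [List.length_ofFn]; exact q.2)]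
        simp only [List.getElem_ofFn, ofList_cons, hd_cons]
      rw [findAction, h1, fold_triSel]
      simp only [hhead]
      cases b <;> rfl
    choose L' R' h1 h2 using fun i => applyTape_tree
      ((M.δ q (fun i => (tp i).head) b).write i) ((M.δ q (fun i => (tp i).head) b).move i)
      (L i) (R i)
    refine ⟨L', R', fun i => ?_, ?_⟩
    · simp only [PTM.step]
      rw [hc i, h1]
    · simp only [simStep, hd_cons, tl_cons, stateTree, ofNat_succ, sel_cons]
      rw [← ofNat_succ, e1]
      simp only [applyAction, actionTree, hd_cons, tl_cons, applyTapes_ofList, h2, PTM.step]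
      congr 2
      rcases (M.δ q (fun i => (tp i).head) b).emit with _ | _ <;> simp [symTree]

lemma fold_loadTape (x : List Bool) (l : List (Option Bool)) :
    fold (fun h s => cons (cons h nil) s) (ofBits x) (symsTree l) =
      symsTree ((x.map some).reverse ++ l) := by
  induction x generalizing l with
  | nil => rfl
  | cons b x ih =>
    rw [ofBits_cons, fold_cons]
    exact (ih (some b :: l)).trans (by simp)

lemma loadTape_ofBits (x : List Bool) :
    loadTape (ofBits x) = cons nil (symsTree (x.map some)) := by
  have := fold_loadTape x []
  rw [symsTree, List.map_nil, ofList_nil] at this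
  rw [loadTape, this, symsTree, rev_ofList]
  simp [symsTree]

lemma represents_init (M : PTM) (x α : List Bool) :
    Represents (M.init x α) (simInit M.desc (ofBits x) (ofBits α)) := by
  refine ⟨fun _ => [], fun i => if i = 0 then x.map some else if i = 1 then α.map some else [],
    fun i => ?_, ?_⟩
  · simp only [init]
    split_ifs <;> rfl
  · rw [simInit, loadTape_ofBits, loadTape_ofBits, List.ofFn_succ, List.ofFn_succ]
    have e : ∀ n, fold (fun _ s => cons (cons nil nil) s) (ofNat n) nil =
        ofList (List.replicate n (cons nil nil)) := by
      intro n
      rw [fold_ofNat]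
      induction n with
      | zero => rfl
      | succ n ih => rw [Function.iterate_succ_apply', ih]; rfl
    simp only [desc, hd_cons, e, init, ofList_cons, stateTree]
    have h2 : (fun i : Fin M.extraTapes => cons (symsTree []) (symsTree
        (if i.succ.succ = 0 then x.map some else if i.succ.succ = 1 then α.map some else []))) =
        fun _ => cons nil nil := by
      funext i
      have h3 : i.succ.succ ≠ 1 := fun h => by simp [Fin.ext_iff] at h
      rw [if_neg (Fin.succ_ne_zero _), if_neg h3]
      rfl
    simp only [h2, List.ofFn_const]
    rfl

/-- The universal machine simulates every machine. -/
lemma simRun_table {M : PTM} {c : M.Cfg} {d : SExp} (h : Represents c d) (T : ℕ) (r : List Bool)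
    (hr : T ≤ r.length) :
    ∃ d', simRun M.table (ofNat T) (cons (ofBits r) d) = cons (ofBits (r.drop T)) d' ∧
      Represents ((r.take T).foldl M.step c) d' := by
  induction T generalizing r c d with
  | zero => exact ⟨d, rfl, h⟩
  | succ T ih =>
    cases r with
    | nil => simp at hr
    | cons b r => exact ih (h.step b) r (by simpa using hr)

end PTM

/-! ### Majority votes -/

/-- The number of those among the first `K` blocks of length `T` of `r` that satisfy `v`. -/
def tally (v : List Bool → Bool) (T : ℕ) : ℕ → List Bool → ℕ
  | 0, _ => 0
  | K + 1, r => (v (r.take T)).toNat + tally v T K (r.drop T)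

/-- The majority vote of `v` on the first `K` blocks of length `T` of `r`. -/
def majority (v : List Bool → Bool) (T K : ℕ) (r : List Bool) : Bool :=
  decide (tally (fun s => !v s) T K r < tally v T K r)

lemma tally_take (v : List Bool → Bool) (T K : ℕ) (r : List Bool) :
    tally v T K (r.take (K * T)) = tally v T K r := by
  induction K generalizing r with
  | zero => rfl
  | succ K ih =>
    rw [tally, tally, List.take_take, Nat.min_eq_left (by rw [Nat.add_mul]; omega), ← ih (r.drop T),
      List.drop_take]
    congr 3
    rw [Nat.add_mul]; omega

lemma majority_take (v : List Bool → Bool) (T K : ℕ) (r : List Bool) :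
    majority v T K (r.take (K * T)) = majority v T K r := by
  simp only [majority, tally_take]

/-- Each wrong vote weighs `3/2` and each right vote `2/3`, so that the product of the weights is at
least `1` if the majority is wrong. The expected weight of a vote is at most `17/18`. -/
lemma prob_majority_ne {v : List Bool → Bool} {T : ℕ} {b : Bool}
    (hv : 2 / 3 ≤ prob T fun s => v s = b) (K : ℕ) :
    prob (K * T) (fun r => majority v T K r ≠ b) ≤ (17 / 18 : ℝ) ^ K := by
  set W : ℕ → List Bool → ℝ := fun K r =>
    (3 / 2 : ℝ) ^ tally (fun s => v s != b) T K r * (2 / 3 : ℝ) ^ tally (fun s => v s == b) T K r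
    with hW
  have h1 : ∀ K, avg (K * T) (W K) ≤ (17 / 18 : ℝ) ^ K := by
    intro K
    induction K with
    | zero => simp [hW, avg_zero, tally]
    | succ K ih =>
      have e1 : (K + 1) * T = T + K * T := by ring
      have e2 : ∀ r, W (K + 1) r = (fun s => if v s = b then (2 / 3 : ℝ) else 3 / 2) (r.take T) *
          W K (r.drop T) := by
        intro r
        simp only [hW, tally]
        by_cases h : v (r.take T) = b
        · simp [h, pow_add]; ring
        · have h1 : (v (r.take T) == b) = false := beq_false_of_ne h
          have h2 : (v (r.take T) != b) = true := by simp [bne, h1]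
          simp [h, h1, h2, pow_add]; ring
      have e3 : avg T (fun s => if v s = b then (2 / 3 : ℝ) else 3 / 2) ≤ 17 / 18 := by
        have e4 : avg T (fun s => if v s = b then (2 / 3 : ℝ) else 3 / 2) =
            3 / 2 - 5 / 6 * prob T fun s => v s = b := by
          have : avg T (fun s => if v s = b then (2 / 3 : ℝ) else 3 / 2) +
              avg T (fun s => 5 / 6 * if v s = b then (1 : ℝ) else 0) = 3 / 2 := by
            rw [← avg_add]
            refine (avg_congr fun s _ => ?_).trans (avg_const T _)
            split <;> norm_num
          rw [avg_mul_left] at this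
          have e5 : prob T (fun s => v s = b) = avg T (fun s => if v s = b then (1 : ℝ) else 0) :=
            avg_congr fun s _ => by split <;> rfl
          rw [e5]
          linarith
        rw [e4]
        linarith
      rw [e1, avg_congr fun r _ => e2 r,
        avg_mul T (K * T) (fun s => if v s = b then (2 / 3 : ℝ) else 3 / 2) (W K), pow_succ']
      exact mul_le_mul e3 ih ((avg_const (K * T) 0).symm.le.trans
        (avg_mono fun r _ => by positivity)) (by norm_num)
  refine le_trans (avg_mono fun r _ => ?_) (h1 K)
  have h2 : 0 ≤ W K r := by positivity
  split_ifs with h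
  · have h3 : tally (fun s => v s == b) T K r ≤ tally (fun s => v s != b) T K r := by
      cases b
      · have h4 : majority v T K r = true := by simpa using h
        have h5 : (fun s => v s == false) = fun s => !v s := by funext s; cases v s <;> rfl
        have h6 : (fun s => v s != false) = v := by funext s; cases v s <;> rfl
        rw [h5, h6]
        exact (of_decide_eq_true h4).le
      · have h4 : majority v T K r = false := by simpa using h
        have h5 : (fun s => v s == true) = v := by funext s; cases v s <;> rfl
        have h6 : (fun s => v s != true) = fun s => !v s := by funext s; cases v s <;> rfl
        rw [h5, h6]
        exact not_lt.1 (of_decide_eq_false h4)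
    obtain ⟨k, hk⟩ := Nat.exists_eq_add_of_le h3
    simp only [hW, hk]
    have h7 : (3 / 2 : ℝ) ^ (tally (fun s => v s == b) T K r + k) *
        (2 / 3 : ℝ) ^ tally (fun s => v s == b) T K r = (3 / 2 : ℝ) ^ k := by
      rw [pow_add, mul_right_comm, ← mul_pow]; norm_num
    rw [h7]
    exact one_le_pow₀ (by norm_num)
  · exact h2

/-- The majority votes of `v i, …, v (i + m - 1)` on consecutive segments of `r`. -/
def majorities (v : ℕ → List Bool → Bool) (T K : ℕ) : ℕ → ℕ → List Bool → List Bool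
  | 0, _, _ => []
  | m + 1, i, r => majority (v i) T K r :: majorities v T K m (i + 1) (r.drop (K * T))

lemma prob_majorities {v : ℕ → List Bool → Bool} {T : ℕ} {b : ℕ → Bool}
    (hv : ∀ i, 2 / 3 ≤ prob T fun s => v i s = b i) (K m i : ℕ) :
    (1 - (17 / 18 : ℝ) ^ K) ^ m ≤ prob (m * (K * T))
      fun r => majorities v T K m i r = (List.range' i m).map b := by
  induction m generalizing i with
  | zero => rw [prob_true]; · simp
            intro r _; rfl
  | succ m ih =>
    have e1 : (m + 1) * (K * T) = K * T + m * (K * T) := by ring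
    have h1 := prob_majority_ne (hv i) K
    have h2 := prob_not (K * T) fun r => majority (v i) T K r = b i
    have h3 : (17 / 18 : ℝ) ^ K ≤ 1 := pow_le_one₀ (by norm_num) (by norm_num)
    rw [e1, pow_succ', prob_congr (Q := fun r => (majority (v i) T K (r.take (K * T)) = b i) ∧
      majorities v T K m (i + 1) (r.drop (K * T)) = (List.range' (i + 1) m).map b)
      (fun r _ => by simp [majorities, majority_take, List.range'_succ]),
      prob_and (K * T) (m * (K * T)) (fun r => majority (v i) T K r = b i)
        (fun r => majorities v T K m (i + 1) r = (List.range' (i + 1) m).map b)]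
    exact mul_le_mul (by linarith) (ih _) (pow_nonneg (by linarith) _) (prob_nonneg _ _)

/-- With `51 m` trials for each of `m` votes, all majorities are right with probability `2/3`. -/
lemma two_thirds_le_prob_majorities {v : ℕ → List Bool → Bool} {T : ℕ} {b : ℕ → Bool}
    (hv : ∀ i, 2 / 3 ≤ prob T fun s => v i s = b i) (m i : ℕ) :
    2 / 3 ≤ prob (m * (51 * m * T))
      fun r => majorities v T (51 * m) m i r = (List.range' i m).map b := by
  refine le_trans ?_ (prob_majorities hv (51 * m) m i)
  have h0 : 0 < (1 + 3 * m : ℝ) := by positivity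
  have h1 : (17 / 18 : ℝ) ^ (51 * m) ≤ 1 / (1 + 3 * m) := by
    have h2 := one_add_mul_le_pow (a := (1 / 17 : ℝ)) (by norm_num) (51 * m)
    rw [show (17 / 18 : ℝ) = (1 + 1 / 17)⁻¹ by norm_num, inv_pow, ← one_div]
    refine one_div_le_one_div_of_le h0 (le_trans (le_of_eq ?_) h2)
    push_cast
    ring
  have h3 := one_add_mul_le_pow (a := -(17 / 18 : ℝ) ^ (51 * m)) (by
    have : (17 / 18 : ℝ) ^ (51 * m) ≤ 1 := pow_le_one₀ (by norm_num) (by norm_num)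
    linarith) m
  rw [← sub_eq_add_neg] at h3
  refine le_trans ?_ h3
  have h4 : m * (17 / 18 : ℝ) ^ (51 * m) ≤ 1 / 3 := by
    refine (mul_le_mul_of_nonneg_left h1 (Nat.cast_nonneg m)).trans ?_
    rw [mul_one_div, div_le_div_iff₀ h0 (by norm_num)]
    linarith
  linarith

/-! ### Enumeration of the strings of a given length -/

/-- The binary expansion of `i` with `n` digits, beginning with the lowest one. -/
def digits : ℕ → ℕ → List Bool
  | 0, _ => []
  | n + 1, i => decide (i % 2 = 1) :: digits n (i / 2)

@[simp] lemma length_digits (n i : ℕ) : (digits n i).length = n := by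
  induction n generalizing i with
  | zero => rfl
  | succ n ih => simp [digits, ih]

lemma digits_zero (n : ℕ) : digits n 0 = List.replicate n false := by
  induction n with
  | zero => rfl
  | succ n ih => simp [digits, ih, List.replicate_succ]

lemma digits_injective {n i j : ℕ} (hi : i < 2 ^ n) (hj : j < 2 ^ n)
    (h : digits n i = digits n j) : i = j := by
  induction n generalizing i j with
  | zero => simp at hi hj; omega
  | succ n ih =>
    simp only [digits, List.cons.injEq, decide_eq_decide] at h
    rw [pow_succ] at hi hj
    have := ih (by omega) (by omega) h.2
    omega

lemma exists_digits (x : List Bool) : ∃ i < 2 ^ x.length, digits x.length i = x := by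
  induction x with
  | nil => exact ⟨0, by simp, rfl⟩
  | cons b x ih =>
    obtain ⟨i, hi, h⟩ := ih
    refine ⟨2 * i + b.toNat, ?_, ?_⟩
    · rw [List.length_cons, pow_succ]; cases b <;> simp <;> omega
    · cases b
      · simp [digits, h]
      · simp only [List.length_cons, digits, Bool.toNat_true]
        rw [show (2 * i + 1) / 2 = i by omega, show (2 * i + 1) % 2 = 1 by omega, h]
        rfl

/-- Binary increment without change of length. -/
def incBits : Bool → List Bool → List Bool
  | _, [] => []
  | c, b :: l => xor b c :: incBits (b && c) l

lemma incBits_false (l : List Bool) : incBits false l = l := by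
  induction l with
  | nil => rfl
  | cons b l ih => simp [incBits, ih]

lemma incBits_digits (n i : ℕ) : incBits true (digits n i) = digits n (i + 1) := by
  induction n generalizing i with
  | zero => rfl
  | succ n ih =>
    rcases Nat.mod_two_eq_zero_or_one i with h | h
    · have h1 : (i + 1) / 2 = i / 2 := by omega
      have h2 : (i + 1) % 2 = 1 := by omega
      simp [digits, incBits, h, h1, h2, incBits_false]
    · have h1 : (i + 1) / 2 = i / 2 + 1 := by omega
      have h2 : (i + 1) % 2 = 0 := by omega
      simp [digits, incBits, h, h1, h2, ih]

namespace SExp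

/-- One step of the increment. The state consists of the carry and the reversed list of the previous
results. -/
def incStep (h s : SExp) : SExp :=
  s.hd.sel (cons nil (cons h s.tl))
    (h.sel (cons nil (cons (cons nil nil) s.tl)) (cons (cons nil nil) (cons nil s.tl)))

/-- Binary increment on trees. -/
def inc (x : SExp) : SExp := (fold incStep x (cons (cons nil nil) nil)).tl.rev

lemma fold_incStep (c : Bool) (l : List Bool) (acc : List Bool) :
    (fold incStep (ofBits l) (cons (ofBool c) (ofBits acc))).tl =
      ofBits ((incBits c l).reverse ++ acc) := by
  induction l generalizing c acc with
  | nil => rfl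
  | cons b l ih =>
    have := ih (b && c) ((xor b c) :: acc)
    rw [ofBits_cons, fold_cons]
    cases b <;> cases c <;> simpa [incStep, incBits] using this

lemma inc_ofBits (l : List Bool) : inc (ofBits l) = ofBits (incBits true l) := by
  have := fold_incStep true l []
  rw [ofBits_nil, ofBool_true] at this
  rw [inc, this, rev_ofBits]
  simp

lemma size_fold_incStep (x c acc : SExp) :
    (fold incStep x (cons c acc)).size ≤ x.size + c.size + acc.size := by
  induction x generalizing c acc with
  | nil => simp
  | cons h t _ ih =>
    rw [fold_cons]
    cases c with
    | nil =>
      refine (ih nil (cons h acc)).trans ?_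
      simp; omega
    | cons u v =>
      have hu := one_le_size u
      have hv := one_le_size v
      cases h with
      | nil => exact (ih nil (cons (cons nil nil) acc)).trans (by simp; omega)
      | cons a b => exact (ih (cons nil nil) (cons nil acc)).trans (by simp; omega)

lemma size_inc_le (x : SExp) : x.inc.size ≤ x.size + 4 := by
  unfold inc
  rw [size_rev]
  have := size_fold_incStep x (cons nil nil) nil
  exact (size_tl_le _).trans (by simpa using this)

@[fun_prop] lemma polyTime_inc {f : SExp → SExp} (hf : PolyTime f) : PolyTime fun x => (f x).inc := by
  unfold inc
  refine polyTime_rev (PolyTime.tl (polyTime_fold' (by unfold incStep; fun_prop)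
    ⟨3, fun h s => ?_⟩ hf (by fun_prop)))
  have h1 : h.size + 6 ≤ (h.size + 2) ^ 3 := by
    have : 2 ^ 2 ≤ (h.size + 2) ^ 2 := Nat.pow_le_pow_left (by omega) 2
    rw [pow_succ]
    nlinarith
  have h2 := size_tl_le s
  unfold incStep
  cases s.hd with
  | nil => simp; omega
  | cons u v => cases h <;> simp at * <;> omega

/-! ### Truth tables by majority votes -/

/-- One vote. The parameters `p` are the description of a machine, the time, the input and the
advice; the state `s` consists of random bits and the numbers of votes for `1` and for `0`. -/
def voteStep (p s : SExp) : SExp :=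
  (simRun p.hd.tl p.tl.hd (cons s.hd (simInit p.hd p.tl.tl.hd p.tl.tl.tl))).tl.tl.tl.hd.sel
    (cons (simRun p.hd.tl p.tl.hd (cons s.hd (simInit p.hd p.tl.tl.hd p.tl.tl.tl))).hd
      (cons s.tl.hd (cons nil s.tl.tl)))
    (cons (simRun p.hd.tl p.tl.hd (cons s.hd (simInit p.hd p.tl.tl.hd p.tl.tl.tl))).hd
      (cons (cons nil s.tl.hd) s.tl.tl))

/-- As many votes as `K` tells. -/
def votes (p K r : SExp) : SExp := fold (fun _ s => voteStep p s) K (cons r (cons nil nil))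

/-- One entry of the truth table. The parameters `p` are the description of a machine, the time, the
advice and the number of votes; the state `s` consists of random bits, the input, and the reversed
list of the previous entries. -/
def tableStep (p s : SExp) : SExp :=
  cons (votes (cons p.hd (cons p.tl.hd (cons s.tl.hd p.tl.tl.hd))) p.tl.tl.tl s.hd).hd
    (cons s.tl.hd.inc (cons ((dropAs
      (votes (cons p.hd (cons p.tl.hd (cons s.tl.hd p.tl.tl.hd))) p.tl.tl.tl s.hd).tl.tl
      (votes (cons p.hd (cons p.tl.hd (cons s.tl.hd p.tl.tl.hd))) p.tl.tl.tl s.hd).tl.hd).sel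
        nil (cons nil nil)) s.tl.tl))

/-- The first entries of a truth table, as many as `m` tells, beginning with the input `z`. -/
def tableFun (p m z r : SExp) : SExp :=
  (fold (fun _ s => tableStep p s) m (cons r (cons z nil))).tl.tl.rev

lemma simRun_hd (tab T s : SExp) : (simRun tab T s).hd = dropAs T s.hd := by
  unfold simRun dropAs
  induction T generalizing s with
  | nil => rfl
  | cons h t _ ih => simp only [fold_cons]; rw [ih]; rfl

lemma fold_induction {f : SExp → SExp → SExp} {P : SExp → Prop} (l : SExp) {s : SExp} (hs : P s)
    (h : ∀ h s, P s → P (f h s)) : P (fold f l s) := by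
  induction l generalizing s with
  | nil => exact hs
  | cons a t _ ih => exact ih (h a s hs)

lemma size_voteStep_hd_le (p s : SExp) : (voteStep p s).hd.size ≤ s.hd.size := by
  unfold voteStep
  rw [simRun_hd, hd_cons]
  have := size_dropAs_le p.tl.hd s.hd
  unfold sel
  split <;> simpa using this

lemma size_voteStep_le (p s : SExp) : (voteStep p s).size ≤ s.size + 10 := by
  unfold voteStep
  rw [simRun_hd, hd_cons]
  have h1 := size_dropAs_le p.tl.hd s.hd
  have h2 := size_hd_add_tl s
  have h3 := size_hd_add_tl s.tl
  unfold sel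
  split <;> simp <;> omega

lemma size_votes_hd_le (p K r : SExp) : (votes p K r).hd.size ≤ r.size :=
  fold_induction (P := fun s => s.hd.size ≤ r.size) K le_rfl
    fun _ s hs => (size_voteStep_hd_le p s).trans hs

lemma size_tableStep_le (p s : SExp) : (tableStep p s).size ≤ s.size + 20 := by
  unfold tableStep
  have h1 := size_votes_hd_le (cons p.hd (cons p.tl.hd (cons s.tl.hd p.tl.tl.hd))) p.tl.tl.tl s.hd
  have h2 := size_hd_add_tl s
  have h3 := size_hd_add_tl s.tl
  have h4 := size_inc_le s.tl.hd
  have h5 := fun x => size_sel_le x nil (cons nil nil)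
  have h6 := h5 (dropAs
      (votes (cons p.hd (cons p.tl.hd (cons s.tl.hd p.tl.tl.hd))) p.tl.tl.tl s.hd).tl.tl
      (votes (cons p.hd (cons p.tl.hd (cons s.tl.hd p.tl.tl.hd))) p.tl.tl.tl s.hd).tl.hd)
  simp at *
  omega

@[fun_prop] lemma polyTime_voteStep {f g : SExp → SExp} (hf : PolyTime f) (hg : PolyTime g) :
    PolyTime fun x => voteStep (f x) (g x) := by unfold voteStep; fun_prop

lemma le_pow_five (k l : ℕ) (h : k ≤ 32) : k ≤ (l + 2) ^ 5 :=
  h.trans (Nat.pow_le_pow_left (by omega : 2 ≤ l + 2) 5)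

@[fun_prop] lemma polyTime_votes {f g h : SExp → SExp} (hf : PolyTime f) (hg : PolyTime g)
    (hh : PolyTime h) : PolyTime fun x => votes (f x) (g x) (h x) :=
  PolyTime.fold (f := fun p _ s => voteStep p s) (by fun_prop)
    ⟨5, fun x a s => (size_voteStep_le x s).trans
      (Nat.add_le_add_left (le_pow_five 10 _ (by norm_num)) _)⟩ hf hg (by fun_prop)

@[fun_prop] lemma polyTime_tableStep {f g : SExp → SExp} (hf : PolyTime f) (hg : PolyTime g) :
    PolyTime fun x => tableStep (f x) (g x) := by unfold tableStep; fun_prop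

@[fun_prop] lemma polyTime_tableFun {f g h k : SExp → SExp} (hf : PolyTime f) (hg : PolyTime g)
    (hh : PolyTime h) (hk : PolyTime k) : PolyTime fun x => tableFun (f x) (g x) (h x) (k x) := by
  have : PolyTime fun x => fold (fun _ s => tableStep (f x) s) (g x) (cons (k x) (cons (h x) nil)) :=
    PolyTime.fold (f := fun p _ s => tableStep p s) (by fun_prop)
      ⟨5, fun x a s => (size_tableStep_le x s).trans
        (Nat.add_le_add_left (le_pow_five 20 _ (by norm_num)) _)⟩ hf hg (by fun_prop)
  unfold tableFun
  fun_prop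

end SExp

namespace PTM

/-- The bit that the machine has written last. -/
def vote (M : PTM) (x α ρ : List Bool) : Bool := (M.runList x α ρ).out.reverse.headI

lemma hd_ofBits (l : List Bool) : (ofBits l).hd = ofBool l.headI := by cases l <;> rfl

lemma Represents.out {M : PTM} {c : M.Cfg} {d : SExp} (h : Represents c d) :
    d.tl.tl = ofBits c.out.reverse := by
  obtain ⟨L, R, -, rfl⟩ := h
  rfl

lemma voteStep_eq (M : PTM) (x α : List Bool) (T : ℕ) (r : List Bool) (hr : T ≤ r.length)
    (y n : ℕ) :
    voteStep (cons M.desc (cons (ofNat T) (cons (ofBits x) (ofBits α))))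
      (cons (ofBits r) (cons (ofNat y) (ofNat n))) =
    cons (ofBits (r.drop T)) (cons (ofNat (y + (M.vote x α (r.take T)).toNat))
      (ofNat (n + (!M.vote x α (r.take T)).toNat))) := by
  obtain ⟨d', h1, h2⟩ := simRun_table (represents_init M x α) T r hr
  simp only [voteStep, hd_cons, tl_cons]
  have h3 : M.desc.tl = M.table := rfl
  rw [h3, h1]
  simp only [hd_cons, tl_cons, h2.out, hd_ofBits]
  change (ofBool (M.vote x α (r.take T))).sel _ _ = _
  cases M.vote x α (r.take T) <;> rfl

lemma votes_eq (M : PTM) (x α : List Bool) (T K : ℕ) (r : List Bool) (hr : K * T ≤ r.length) :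
    votes (cons M.desc (cons (ofNat T) (cons (ofBits x) (ofBits α)))) (ofNat K) (ofBits r) =
    cons (ofBits (r.drop (K * T))) (cons (ofNat (tally (M.vote x α) T K r))
      (ofNat (tally (fun s => !M.vote x α s) T K r))) := by
  have key : ∀ K r y n, K * T ≤ r.length → fold (fun _ s => voteStep
      (cons M.desc (cons (ofNat T) (cons (ofBits x) (ofBits α)))) s) (ofNat K)
      (cons (ofBits r) (cons (ofNat y) (ofNat n))) =
      cons (ofBits (r.drop (K * T))) (cons (ofNat (y + tally (M.vote x α) T K r))
        (ofNat (n + tally (fun s => !M.vote x α s) T K r))) := by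
    intro K
    induction K with
    | zero => intro r y n _; simp [tally]
    | succ K ih =>
      intro r y n hr
      rw [Nat.add_mul, one_mul] at hr
      rw [ofNat_succ, fold_cons, voteStep_eq M x α T r (by omega), ih _ _ _ (by simp; omega),
        List.drop_drop, tally, tally, Nat.add_mul, one_mul, Nat.add_comm T, Nat.add_assoc,
        Nat.add_assoc]
  have := key K r 0 0 hr
  simp only [zero_add, ofNat_zero] at this
  exact this

lemma tableStep_eq (M : PTM) (x α : List Bool) (T K : ℕ) (r l : List Bool)
    (hr : K * T ≤ r.length) :
    tableStep (cons M.desc (cons (ofNat T) (cons (ofBits α) (ofNat K))))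
      (cons (ofBits r) (cons (ofBits x) (ofBits l))) =
    cons (ofBits (r.drop (K * T))) (cons (ofBits (incBits true x))
      (ofBits (majority (M.vote x α) T K r :: l))) := by
  simp only [tableStep, hd_cons, tl_cons, votes_eq M x α T K r hr, inc_ofBits, ofBits_cons]
  congr 3
  rw [dropAs_ofNat_ofNat, majority]
  by_cases h : tally (fun s => !M.vote x α s) T K r < tally (M.vote x α) T K r
  · obtain ⟨k, hk⟩ := Nat.exists_eq_succ_of_ne_zero (Nat.sub_pos_of_lt h).ne'
    rw [hk, decide_eq_true h]
    rfl
  · rw [Nat.sub_eq_zero_of_le (not_lt.1 h), decide_eq_false h]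
    rfl

lemma tableFun_eq (M : PTM) (α : List Bool) (T K n m : ℕ) (r : List Bool)
    (hr : m * (K * T) ≤ r.length) :
    tableFun (cons M.desc (cons (ofNat T) (cons (ofBits α) (ofNat K)))) (ofNat m)
      (ofBits (List.replicate n false)) (ofBits r) =
    ofBits (majorities (fun i => M.vote (digits n i) α) T K m 0 r) := by
  have key : ∀ m i r l, m * (K * T) ≤ r.length →
      (fold (fun _ s => tableStep (cons M.desc (cons (ofNat T) (cons (ofBits α) (ofNat K)))) s)
        (ofNat m) (cons (ofBits r) (cons (ofBits (digits n i)) (ofBits l)))).tl.tl =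
      ofBits ((majorities (fun i => M.vote (digits n i) α) T K m i r).reverse ++ l) := by
    intro m
    induction m with
    | zero => intro i r l _; rfl
    | succ m ih =>
      intro i r l hr
      rw [Nat.add_mul, one_mul] at hr
      rw [ofNat_succ, fold_cons, tableStep_eq M _ α T K r l (by omega), incBits_digits,
        ih _ _ _ (by simp; omega)]
      simp [majorities]
  have := key m 0 r [] hr
  rw [List.append_nil, digits_zero, ofBits_nil] at this
  rw [tableFun, this, rev_ofBits, List.reverse_reverse]

end PTM

/-! ### Arithmetic, parsing and search on trees -/

namespace SExp

lemma ofBits_replicate_false (n : ℕ) : ofBits (List.replicate n false) = ofNat n := by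
  simp [ofBits, ofNat]

/-- The length of a list plus a number, in unary notation. -/
def addLen (l x : SExp) : SExp := fold (fun _ s => cons nil s) l x

lemma addLen_ofList (l : List SExp) (n : ℕ) : addLen (ofList l) (ofNat n) = ofNat (l.length + n) := by
  induction l generalizing n with
  | nil => simp [addLen]
  | cons a l ih =>
    have := ih (n + 1)
    rw [List.length_cons, show l.length + 1 + n = l.length + (n + 1) by ring]
    exact this

lemma addLen_ofBits (l : List Bool) (n : ℕ) : addLen (ofBits l) (ofNat n) = ofNat (l.length + n) := by
  rw [ofBits, addLen_ofList, List.length_map]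

lemma addLen_ofNat (m n : ℕ) : addLen (ofNat m) (ofNat n) = ofNat (m + n) := by
  rw [ofNat, addLen_ofList, List.length_replicate]

/-- The product of two numbers in unary notation. -/
def mulNat (x y : SExp) : SExp := fold (fun _ s => addLen y s) x nil

lemma mulNat_ofNat (m n : ℕ) : mulNat (ofNat m) (ofNat n) = ofNat (m * n) := by
  rw [mulNat, fold_ofNat]
  induction m with
  | zero => simp
  | succ m ih => rw [Function.iterate_succ_apply', ih, addLen_ofNat]; congr 1; ring

/-- Twice a number in unary notation. -/
def double (x : SExp) : SExp := addLen x x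

lemma double_ofNat (n : ℕ) : double (ofNat n) = ofNat (2 * n) := by
  rw [double, addLen_ofNat, two_mul]

lemma size_addLen_le (l x : SExp) : (addLen l x).size ≤ x.size + l.size * 2 :=
  size_fold_le (fun _ s _ => by simp; omega) x

@[fun_prop] lemma polyTime_addLen {f g : SExp → SExp} (hf : PolyTime f) (hg : PolyTime g) :
    PolyTime fun x => addLen (f x) (g x) :=
  polyTime_fold' (by fun_prop)
    ⟨5, fun h s => by have := le_pow_five 2 h.size (by norm_num); simp; omega⟩ hf hg

@[fun_prop] lemma polyTime_mulNat {f g : SExp → SExp} (hf : PolyTime f) (hg : PolyTime g) :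
    PolyTime fun x => mulNat (f x) (g x) :=
  PolyTime.fold (f := fun y _ s => addLen y s) (by fun_prop)
    ⟨2, fun x h s => (size_addLen_le x s).trans (by
      have := Nat.pow_le_pow_left (show x.size + 2 ≤ x.size + h.size + 2 by omega) 2
      nlinarith)⟩ hg hf (by fun_prop)

@[fun_prop] lemma polyTime_double {f : SExp → SExp} (hf : PolyTime f) :
    PolyTime fun x => double (f x) := by unfold double; fun_prop

/-- One step of the parser of codes of trees, which reads the code from the end. The state is the
stack of the trees that have been found. -/
def parseStep (h s : SExp) : SExp :=
  h.sel (cons nil s) (cons (cons s.hd s.tl.hd) s.tl.tl)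

/-- The first tree whose code stands in a list of bits. -/
def parse (l : SExp) : SExp := (fold parseStep l.rev nil).hd

lemma parse_code (d : SExp) (l : List Bool) : parse (ofBits (d.code ++ l)) = d := by
  have h : ∀ l, fold parseStep (ofBits l).rev nil =
      l.foldr (fun b s => parseStep (ofBool b) s) nil := fun l => by
    rw [rev_ofBits, fold_ofBits, List.foldl_reverse]
  have key : ∀ (d : SExp) (l : List Bool), (d.code ++ l).foldr
      (fun b s => parseStep (ofBool b) s) nil =
      cons d (l.foldr (fun b s => parseStep (ofBool b) s) nil) := by
    intro d
    induction d with
    | nil => intro l; rfl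
    | cons a b iha ihb =>
      intro l
      rw [code, List.cons_append, List.foldr_cons, List.append_assoc, iha, ihb]
      rfl
  rw [parse, h, key, hd_cons]

@[fun_prop] lemma polyTime_parse {f : SExp → SExp} (hf : PolyTime f) :
    PolyTime fun x => parse (f x) := by
  refine PolyTime.hd (polyTime_fold' (by unfold parseStep; fun_prop) ⟨5, fun h s => ?_⟩
    (by fun_prop) (by fun_prop))
  have h1 := le_pow_five 5 h.size (by norm_num)
  have h2 := size_hd_add_tl s
  have h3 := size_hd_add_tl s.tl
  unfold parseStep
  cases h <;> simp at * <;> omega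

/-- Equality of lists of bits of the same length. -/
def eqBits (x y : SExp) : SExp :=
  (fold (fun h s => cons s.hd.tl (h.sel (s.hd.hd.sel s.tl nil) (s.hd.hd.sel nil s.tl))) x
    (cons y (cons nil nil))).tl

lemma eqBits_ofBits {x y : List Bool} (h : x.length = y.length) :
    eqBits (ofBits x) (ofBits y) = ofBool (decide (x = y)) := by
  have key : ∀ (x y : List Bool) (b : Bool), x.length = y.length →
      (fold (fun h s => cons s.hd.tl (h.sel (s.hd.hd.sel s.tl nil) (s.hd.hd.sel nil s.tl)))
        (ofBits x) (cons (ofBits y) (ofBool b))).tl = ofBool (b && decide (x = y)) := by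
    intro x
    induction x with
    | nil => intro y b h; simp [List.length_eq_zero_iff.1 h.symm]
    | cons c x ih =>
      intro y b h
      cases y with
      | nil => simp at h
      | cons d y =>
        have h1 := ih y (b && (c == d)) (by simpa using h)
        rw [ofBits_cons, fold_cons]
        cases c <;> cases d <;> simpa using h1
  exact (key x y true h).trans (by simp)

@[fun_prop] lemma polyTime_eqBits {f g : SExp → SExp} (hf : PolyTime f) (hg : PolyTime g) :
    PolyTime fun x => eqBits (f x) (g x) := by
  refine PolyTime.tl (polyTime_fold' (by fun_prop) ⟨5, fun h s => ?_⟩ hf (by fun_prop))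
  have h1 := le_pow_five 5 h.size (by norm_num)
  have h2 := size_hd_add_tl s
  have h3 := size_tl_le s.hd
  generalize (h.size + 2) ^ 5 = k at *
  cases h <;> cases s.hd.hd <;> simp <;> omega

/-- The entry with index `x` of a table, where the indices are counted in binary with as many digits
as `x` has. -/
def lookup (x w : SExp) : SExp :=
  ((fold (fun h s => cons s.hd.inc ((eqBits s.hd x).sel s.tl h)) w
    (cons (addLen x nil) nil)).tl).sel nil (cons nil nil)

@[fun_prop] lemma polyTime_lookup {f g : SExp → SExp} (hf : PolyTime f) (hg : PolyTime g) :
    PolyTime fun x => lookup (f x) (g x) := by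
  have := PolyTime.fold (f := fun x h s => cons s.hd.inc ((eqBits s.hd x).sel s.tl h))
    (s := fun x => cons (addLen (f x) nil) nil)
    (by fun_prop) ⟨5, fun x h s => ?_⟩ hf hg (by fun_prop)
  · unfold lookup
    fun_prop
  · have h1 : x.size + h.size + 10 ≤ (x.size + h.size + 2) ^ 5 := by
      generalize x.size + h.size = k
      have : 2 ^ 4 ≤ (k + 2) ^ 4 := Nat.pow_le_pow_left (by omega) 4
      rw [pow_succ]
      nlinarith
    have h2 := size_hd_add_tl s
    have h3 := size_inc_le s.hd
    have h4 := size_sel_le (eqBits s.hd x) s.tl h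
    simp
    omega

end SExp

/-- The entry with index `x` of the table `w` whose first entry has index `i`; the last one if there
are several, and `a` if there is none. -/
def lookupBits (x : List Bool) : ℕ → List Bool → Bool → Bool
  | _, [], a => a
  | i, b :: w, a => lookupBits x (i + 1) w (if digits x.length i = x then b else a)

lemma lookup_ofBits (x w : List Bool) :
    lookup (ofBits x) (ofBits w) = ofBool (lookupBits x 0 w false) := by
  have key : ∀ (w : List Bool) (i : ℕ) (a : Bool),
      (fold (fun h s => cons s.hd.inc ((eqBits s.hd (ofBits x)).sel s.tl h)) (ofBits w)
        (cons (ofBits (digits x.length i)) (ofBool a))).tl = ofBool (lookupBits x i w a) := by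
    intro w
    induction w with
    | nil => intro i a; rfl
    | cons b w ih =>
      intro i a
      have := ih (i + 1) (if digits x.length i = x then b else a)
      rw [lookupBits, ← this, ofBits_cons, fold_cons, hd_cons, tl_cons,
        eqBits_ofBits (by simp), inc_ofBits, incBits_digits]
      by_cases h : digits x.length i = x <;> simp [h]
  have h := key w 0 false
  have h0 := addLen_ofBits x 0
  rw [digits_zero, ofBits_replicate_false] at h
  rw [ofNat_zero, Nat.add_zero] at h0
  rw [lookup, h0, ← ofBool_false, h]
  cases lookupBits x 0 w false <;> rfl

lemma lookupBits_map {x : List Bool} {b : ℕ → Bool} {v : Bool} (m i : ℕ) (a : Bool)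
    (h : ∀ j, i ≤ j → j < i + m → digits x.length j = x → b j = v)
    (h' : a = v ∨ ∃ j, i ≤ j ∧ j < i + m ∧ digits x.length j = x) :
    lookupBits x i ((List.range' i m).map b) a = v := by
  induction m generalizing i a with
  | zero =>
    rcases h' with rfl | ⟨j, h1, h2, -⟩
    · rfl
    · omega
  | succ m ih =>
    rw [List.range'_succ, List.map_cons, lookupBits]
    refine ih _ _ (fun j h1 h2 => h j (by omega) (by omega)) ?_
    by_cases hi : digits x.length i = x
    · left; rw [if_pos hi]; exact h i le_rfl (by omega) hi
    · rw [if_neg hi]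
      refine h'.imp_right ?_
      rintro ⟨j, h1, h2, h3⟩
      rcases h1.eq_or_lt with rfl | h1
      · exact absurd h3 hi
      · exact ⟨j, h1, by omega, h3⟩

namespace Transforms
variable {ι : Type*} {B : ι → ℕ} {F : ι → SExp}

lemma foldN_ofNat (f : SExp → SExp → SExp) {j n : ℕ} (h : j ≤ n) (s : SExp) :
    foldN f j (ofNat n) s = (f nil)^[j] s := by
  induction j generalizing n s with
  | zero => rfl
  | succ j ih =>
    obtain ⟨n, rfl⟩ := Nat.exists_eq_succ_of_ne_zero (by omega : n ≠ 0)
    exact ih (by omega) _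

lemma len_ofList (l : List SExp) : (ofList l).len = l.length := by
  induction l with
  | nil => rfl
  | cons a l ih => simp [len, ih]

lemma len_ofNat (n : ℕ) : (ofNat n).len = n := by rw [ofNat, len_ofList, List.length_replicate]

/-- Exponentiation is possible in time polynomial in the result. -/
lemma two_pow {k : ι → ℕ} (h : Transforms B F fun i => ofNat (k i))
    (hk : PolyBdd B fun i => 2 ^ k i) : Transforms B F fun i => ofNat (2 ^ k i) := by
  have h0 : ∀ j, (fun s => double s)^[j] (ofNat 1) = ofNat (2 ^ j) := fun j => by
    induction j with
    | zero => rfl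
    | succ j ih => rw [Function.iterate_succ_apply', ih, double_ofNat, pow_succ']
  have := Transforms.fold (f := fun _ _ s => double s) (E := fun _ => nil) (S := fun _ => ofNat 1)
    (by fun_prop) (.const h.bdd_left _) h (.const h.bdd_left _) (fun i => 2 * 2 ^ k i + 1)
    (((PolyBdd.const 2).mul hk).add (.const 1)) ?_
  · simpa only [fold_ofNat, h0] using this
  · intro i j hj
    rw [len_ofNat] at hj
    rw [foldN_ofNat _ hj, h0, size_ofNat]
    have : 2 ^ j ≤ 2 ^ k i := Nat.pow_le_pow_right (by norm_num) hj
    omega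

lemma foldN_ofBits (f : SExp → SExp → SExp) (j : ℕ) (l : List Bool) (s : SExp) :
    foldN f j (ofBits l) s = SExp.fold f (ofBits (l.take j)) s := by
  induction j generalizing l s with
  | zero => rfl
  | succ j ih =>
    cases l with
    | nil => rfl
    | cons b l => exact ih _ _

lemma foldr_bits (n : ℕ) : n.bits.foldr (fun b s => 2 * s + b.toNat) 0 = n := by
  induction n using Nat.binaryRec' with
  | zero => simp
  | bit b n h ih =>
    rw [Nat.bits_append_bit _ _ h, List.foldr_cons, ih, Nat.bit_val]

/-- The conversion from binary to unary is possible in time polynomial in the result. -/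
lemma ofBinary {n : ι → ℕ} (h : Transforms B F fun i => ofBits (n i).bits)
    (hn : PolyBdd B n) : Transforms B F fun i => ofNat (n i) := by
  have h0 : ∀ (l : List Bool) (k : ℕ),
      SExp.fold (fun h s => h.sel (double s) (.cons nil (double s))) (ofBits l) (ofNat k) =
        ofNat (l.foldl (fun s b => 2 * s + b.toNat) k) := by
    intro l
    induction l with
    | nil => intro k; rfl
    | cons b l ih =>
      intro k
      rw [ofBits_cons, fold_cons, List.foldl_cons, ← ih]
      cases b <;> simp [double_ofNat]
  have hmono : ∀ (l : List Bool) (k : ℕ), k ≤ l.foldl (fun s b => 2 * s + b.toNat) k := by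
    intro l
    induction l with
    | nil => intro k; rfl
    | cons b l ih =>
      intro k
      exact le_trans (show k ≤ 2 * k + b.toNat by omega) (ih _)
  have h1 : Transforms B F fun i => ofBits (n i).bits.reverse := by
    have := h.app (f := rev) (by fun_prop)
    simpa only [rev_ofBits] using this
  have := Transforms.fold (f := fun _ h s => h.sel (double s) (.cons nil (double s)))
    (E := fun _ => nil) (S := fun _ => ofNat 0)
    (by fun_prop) (.const h.bdd_left _) h1 (.const h.bdd_left _) (fun i => 2 * n i + 1)
    (((PolyBdd.const 2).mul hn).add (.const 1)) ?_
  · simpa only [h0, List.foldl_reverse, foldr_bits] using this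
  · intro i j _
    rw [foldN_ofBits, h0, size_ofNat]
    have h2 : ((n i).bits.reverse.take j).foldl (fun s b => 2 * s + b.toNat) 0 ≤ n i := by
      conv_rhs => rw [← foldr_bits (n i), ← List.foldl_reverse,
        ← List.take_append_drop j (n i).bits.reverse, List.foldl_append]
      exact hmono _ _
    omega

/-- The integer part of the binary logarithm. -/
lemma log_two {m : ι → ℕ} (h : Transforms B F fun i => ofNat (m i)) :
    Transforms B F fun i => ofNat (Nat.log 2 (m i)) := by
  let f : SExp → SExp → SExp → SExp := fun x _ s =>
    (dropAs x (double s.hd)).sel (.cons (double s.hd) (.cons nil s.tl)) s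
  have h0 : ∀ m j : ℕ, (f (ofNat m) nil)^[j] (.cons (ofNat 1) (ofNat 0)) =
      .cons (ofNat (2 ^ min j (Nat.log 2 m))) (ofNat (min j (Nat.log 2 m))) := by
    intro m j
    induction j with
    | zero => simp; rfl
    | succ j ih =>
      rw [Function.iterate_succ_apply', ih]
      simp only [f, hd_cons, tl_cons, double_ofNat, ← pow_succ']
      rw [dropAs_ofNat_ofNat]
      by_cases hj : j < Nat.log 2 m
      · have h1 : 2 ^ (j + 1) ≤ m := Nat.pow_le_of_le_log (by
          rintro rfl; simp at hj) hj
        rw [Nat.min_eq_left hj.le, Nat.min_eq_left hj, Nat.sub_eq_zero_of_le h1]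
        rfl
      · have h1 : m < 2 ^ (Nat.log 2 m + 1) := Nat.lt_pow_succ_log_self (by norm_num) m
        rw [Nat.min_eq_right (by omega), Nat.min_eq_right (by omega)]
        obtain ⟨k, hk⟩ := Nat.exists_eq_succ_of_ne_zero (Nat.sub_pos_of_lt h1).ne'
        rw [hk]
        rfl
  have := Transforms.fold (f := f) (E := fun i => ofNat (m i)) (L := fun i => ofNat (m i))
    (S := fun _ => .cons (ofNat 1) (ofNat 0)) (by simp only [f]; fun_prop) h h (.const h.bdd_left _)
    (fun i => 5 * (ofNat (m i)).size) ((PolyBdd.const 5).mul h.bdd) ?_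
  · have := this.tl
    simp only [fold_ofNat, h0, tl_cons] at this
    convert this using 3 with i
    exact (Nat.min_eq_right (Nat.log_le_self 2 _)).symm
  · intro i j hj
    rw [len_ofNat] at hj
    rw [foldN_ofNat _ hj, h0]
    have h1 : 2 ^ min j (Nat.log 2 (m i)) ≤ m i + 1 := by
      refine (Nat.pow_le_pow_right (by norm_num) (min_le_right _ _)).trans ?_
      rcases Nat.eq_zero_or_pos (m i) with h | h
      · simp [h]
      · exact (Nat.pow_log_le_self 2 h.ne').trans (by omega)
    have h2 : min j (Nat.log 2 (m i)) ≤ m i := (min_le_left _ _).trans hj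
    simp
    omega

end Transforms

/-! ### Machines that simulate other machines -/

/-- The reversed output of the simulation of the machine with description `D` on input `a`, with
random bits `r`. -/
def SExp.simOut (D a T r : SExp) : SExp := (simRun D.tl T (.cons r (simInit D a nil))).tl.tl.tl

namespace PTM

lemma DecidesAt.two_thirds_le_prob_vote {M : PTM} {L : Language Bool} {x α : List Bool} {T : ℕ}
    {b : Bool} (h : M.DecidesAt L x α T) (hb : b = true ↔ x ∈ L) :
    2 / 3 ≤ prob T fun ρ => M.vote x α ρ = b := by
  classical
  refine h.2.trans ?_
  rw [outputProb_eq]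
  refine prob_mono fun ρ _ hρ => ?_
  rw [vote, hρ]
  by_cases hx : x ∈ L
  · rw [hb.2 hx]; simp [hx]
  · rw [Bool.eq_false_iff.2 (mt hb.1 hx)]; simp [hx]

lemma simOut_desc (M : PTM) (a ρ : List Bool) :
    simOut M.desc (ofBits a) (ofNat ρ.length) (ofBits ρ) =
      ofBits (M.runList a [] ρ).out.reverse := by
  obtain ⟨d, hd, h⟩ := simRun_table (represents_init M a []) ρ.length ρ le_rfl
  have : simOut M.desc (ofBits a) (ofNat ρ.length) (ofBits ρ) = d.tl.tl := by
    rw [simOut]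
    change (simRun M.table (ofNat ρ.length)
      (.cons (ofBits ρ) (simInit M.desc (ofBits a) (ofBits [])))).tl.tl.tl = _
    rw [hd]; rfl
  rw [this, h.out, List.take_length]
  rfl

end PTM

@[fun_prop] lemma polyTime_simOut {f g h k : SExp → SExp} (hf : PolyTime f) (hg : PolyTime g)
    (hh : PolyTime h) (hk : PolyTime k) : PolyTime fun x => simOut (f x) (g x) (h x) (k x) := by
  unfold simOut; fun_prop

lemma polyBdd_size_ofBits {ι : Type*} {B R : ι → ℕ} (hR : PolyBdd B R) :
    PolyBdd (fun s : (i : ι) × {r : List Bool // r.length = R i} => B s.1)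
      fun s => (ofBits s.2.1).size :=
  (((PolyBdd.const 4).mul (hR.comp Sigma.fst)).add (.const 1)).mono fun s => by
    have := size_ofBits s.2.1
    rw [s.2.2] at this
    exact this

/-- Machines that compute, by majority votes, the beginning of the truth table of the function that
`M i` computes on inputs of length `n i` with advice `α i`. -/
lemma exists_table_machine {ι : Type*} {B : ι → ℕ} {x a α : ι → List Bool} {e : ι → SExp}
    {M : ι → PTM} {T m n : ι → ℕ}
    (h : Transforms B (fun i => .cons (e i) (.cons (ofBits (x i)) (ofBits (a i)))) fun i =>
      .cons (.cons (M i).desc (.cons (ofNat (T i)) (ofBits (α i))))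
        (.cons (ofNat (m i)) (ofNat (n i)))) :
    ∃ c, ∀ e₀, ∃ N : PTM, ∀ i, e i = e₀ → ∀ T', (B i + 2) ^ c ≤ T' →
      N.HaltsWithin (x i) (a i) T' ∧ ∀ b : ℕ → Bool,
        (∀ j, 2 / 3 ≤ prob (T i) fun r => (M i).vote (digits (n i) j) (α i) r = b j) →
        2 / 3 ≤ N.outputProb (x i) (a i) T' ((List.range' 0 (m i)).map b) := by
  have hm : Transforms B _ fun i => ofNat (m i) := h.tl.hd
  have hT : Transforms B _ fun i => ofNat (T i) := h.hd.tl.hd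
  have hK := Transforms.app (f := fun y => mulNat (ofNat 51) y) (by fun_prop) hm
  simp only [mulNat_ofNat] at hK
  have hR := Transforms.app (f := fun y => mulNat y.hd (mulNat y.tl.hd y.tl.tl)) (by fun_prop)
    (hm.cons (hK.cons hT))
  simp only [hd_cons, tl_cons, mulNat_ofNat] at hR
  have h₁ := hR.cons ((h.hd.hd.cons (h.hd.tl.hd.cons (h.hd.tl.tl.cons hK))).cons
    (h.tl.hd.cons h.tl.tl))
  simp only [hd_cons, tl_cons] at h₁
  have hRB : PolyBdd B fun i => m i * (51 * m i * T i) := hR.bdd.mono fun i => by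
    rw [size_ofNat]; omega
  obtain ⟨c, hc⟩ := Transforms.exists_machine (G := fun i r =>
    majorities (fun j => (M i).vote (digits (n i) j) (α i)) (T i) (51 * m i) (m i) 0 r) h₁ (by
      have := Transforms.app (f := fun y => tableFun y.tl.hd y.tl.tl.hd y.tl.tl.tl y.hd)
        (by fun_prop) (Transforms.refl (F := fun s : (i : ι) × {r : List Bool //
          r.length = m i * (51 * m i * T i)} => .cons (ofBits s.2.1) (SExp.cons
            (.cons (M s.1).desc (.cons (ofNat (T s.1)) (.cons (ofBits (α s.1))
              (ofNat (51 * m s.1))))) (.cons (ofNat (m s.1)) (ofNat (n s.1)))))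
          (B := fun s => B s.1) ((((polyBdd_size_ofBits hRB).add
            (h₁.tl.bdd.comp Sigma.fst)).add (.const 1)).mono fun s => by simp))
      simp only [hd_cons, tl_cons] at this
      convert this using 2 with s
      rw [← ofBits_replicate_false (n s.1), PTM.tableFun_eq _ _ _ _ _ _ _ s.2.2.ge])
  refine ⟨c, fun e₀ => (hc e₀).imp fun N hN i hi T' hT' => ⟨(hN i hi T' hT').1, fun b hb => ?_⟩⟩
  rw [(hN i hi T' hT').2]
  exact two_thirds_le_prob_majorities hb _ _

/-- Machines that simulate a machine with description `D i` on input `a i` and look up the input `x i`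
in the truth table that is the output. -/
lemma exists_lookup_machine {ι : Type*} {B : ι → ℕ} {x α : ι → List Bool} {e D a : ι → SExp}
    {T : ι → ℕ}
    (h : Transforms B (fun i => .cons (e i) (.cons (ofBits (x i)) (ofBits (α i)))) fun i =>
      .cons (ofNat (T i)) (.cons (D i) (a i))) :
    ∃ c, ∀ e₀, ∃ N : PTM, ∀ i, e i = e₀ → ∀ T', (B i + 2) ^ c ≤ T' →
      N.HaltsWithin (x i) (α i) T' ∧ ∀ w : List Bool,
        2 / 3 ≤ prob (T i) (fun r => simOut (D i) (a i) (ofNat (T i)) (ofBits r) =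
          ofBits w.reverse) →
        2 / 3 ≤ N.outputProb (x i) (α i) T' [lookupBits (x i) 0 w false] := by
  have h₁ := h.hd.cons (h.hd.cons (h.tl.cons (Transforms.refl h.bdd_left).tl.hd))
  simp only [hd_cons, tl_cons] at h₁
  have hRB : PolyBdd B T := h.hd.bdd.mono fun i => by rw [hd_cons, size_ofNat]; omega
  have hl : ∀ u v, ∃ b, lookup u v = ofBool b := fun u v => by
    have : ∀ y, ∃ b, sel y nil (.cons nil nil) = ofBool b := by
      rintro (_ | _)
      exacts [⟨false, rfl⟩, ⟨true, rfl⟩]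
    exact this _
  choose g hg using hl
  obtain ⟨c, hc⟩ := Transforms.exists_machine (G := fun i r => [g (ofBits (x i))
      (simOut (D i) (a i) (ofNat (T i)) (ofBits r)).rev]) h₁ (by
    have := Transforms.app (f := fun y => .cons (lookup y.tl.tl.tl
        (simOut y.tl.tl.hd.hd y.tl.tl.hd.tl y.tl.hd y.hd).rev) nil) (by fun_prop)
      (Transforms.refl (F := fun s : (i : ι) × {r : List Bool // r.length = T i} =>
        .cons (ofBits s.2.1) (.cons (ofNat (T s.1)) (.cons (.cons (D s.1) (a s.1))
          (ofBits (x s.1))))) (B := fun s => B s.1) ((((polyBdd_size_ofBits hRB).add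
            (h₁.tl.bdd.comp Sigma.fst)).add (.const 1)).mono fun s => by simp))
    simp only [hd_cons, tl_cons] at this
    convert this using 2 with s
    rw [ofBits_cons, ← hg]
    rfl)
  refine ⟨c, fun e₀ => (hc e₀).imp fun N hN i hi T' hT' => ⟨(hN i hi T' hT').1, fun w hw => ?_⟩⟩
  rw [(hN i hi T' hT').2]
  refine hw.trans (prob_mono fun r _ hr => ?_)
  have h2 := hg (ofBits (x i)) (ofBits w)
  rw [lookup_ofBits] at h2
  rw [hr, rev_ofBits, List.reverse_reverse]
  revert h2
  cases lookupBits (x i) 0 w false <;> cases g (ofBits (x i)) (ofBits w) <;> simp [ofBool]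

/-! ### Sizes of descriptions -/

namespace PTM

lemma length_encodeSymbol (s : Option Bool) : (encodeSymbol s).length = 2 := by
  cases s <;> rfl

lemma length_encodeMove (d : Option Turing.Dir) : (encodeMove d).length = 2 := by
  rcases d with _ | _ | _ <;> rfl

lemma size_symTree_le (s : Option Bool) : (symTree s).size ≤ 5 := by
  rcases s with _ | _ | _ <;> simp [symTree]

lemma size_moveTree_le (d : Option Turing.Dir) : (moveTree d).size ≤ 5 := by
  rcases d with _ | _ | _ <;> simp [moveTree]

lemma size_ofList_le {α : Type*} {e : α → SExp} {f : α → ℕ} {K : ℕ} (l : List α)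
    (h : ∀ a, (e a).size + 1 ≤ K * f a) : (ofList (l.map e)).size ≤ 1 + K * (l.map f).sum := by
  induction l with
  | nil => simp
  | cons a l ih =>
    have := h a
    simp only [List.map_cons, ofList_cons, size_cons, List.sum_cons, mul_add]
    omega

lemma size_actionTree_le {k q : ℕ} (a : PTMAction k q) :
    (actionTree a).size ≤ 4 * (encodeAction a).length := by
  have h1 : (stateTree a.next).size ≤ 2 * (encodeState a.next).length ∧
      1 ≤ (encodeState a.next).length := by
    cases a.next <;> simp [stateTree, encodeState]
    omega
  have h2 : (ofList (List.ofFn fun i => cons (symTree (a.write i)) (moveTree (a.move i)))).size ≤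
      1 + 3 * (List.ofFn fun i => encodeSymbol (a.write i) ++ encodeMove (a.move i)).flatten.length := by
    have := size_ofList_le (K := 3) (f := fun i => (encodeSymbol (a.write i) ++
      encodeMove (a.move i)).length) (e := fun i => cons (symTree (a.write i)) (moveTree (a.move i)))
      (List.finRange k) fun i => by
        have := size_symTree_le (a.write i)
        have := size_moveTree_le (a.move i)
        simp [length_encodeSymbol, length_encodeMove]
        omega
    rw [List.length_flatten, List.ofFn_eq_map, List.ofFn_eq_map, List.map_map]
    exact this
  have h3 := size_symTree_le a.emit
  simp only [actionTree, encodeAction, List.length_append, size_cons, length_encodeSymbol]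
  omega

lemma size_trie_le (k : ℕ) (f : (Fin k → Option Bool) → SExp) :
    (trie k f).size + 1 ≤ ((tuples k).map fun s => (f s).size + 1).sum := by
  induction k with
  | zero => simp [trie, tuples]
  | succ k ih =>
    have h1 := ih fun v => f (Fin.cons none v)
    have h2 := ih fun v => f (Fin.cons (some false) v)
    have h3 := ih fun v => f (Fin.cons (some true) v)
    simp only [trie, tuples, size_cons, List.flatMap_cons, List.flatMap_nil, List.map_append,
      List.map_map, List.sum_append, List.append_nil]
    simp only [Function.comp_def]
    omega

/-- The tree that describes a machine is not much larger than the binary encoding. -/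
lemma size_desc_le (M : PTM) : M.desc.size ≤ 5 * M.encode.length := by
  have h1 : M.table.size ≤ 1 + 5 * ((List.finRange (M.extraStates + 1)).map fun q =>
      ((tuples (M.extraTapes + 2)).flatMap fun s =>
        [false, true].flatMap fun b => encodeAction (M.δ q s b)).length).sum := by
    rw [table, List.ofFn_eq_map]
    refine size_ofList_le _ fun q => (size_trie_le _ _).trans ?_
    rw [List.length_flatMap, ← List.sum_map_mul_left]
    refine List.sum_le_sum fun s _ => ?_
    have h2 := size_actionTree_le (M.δ q s false)
    have h3 := size_actionTree_le (M.δ q s true)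
    have h4 : ∀ b, 1 ≤ (encodeAction (M.δ q s b)).length := fun b => by
      simp [encodeAction, length_encodeSymbol]; omega
    have h5 := h4 false
    have h6 := h4 true
    simp
    omega
  simp only [desc, encode, size_cons, size_ofNat, List.length_append, List.length_replicate,
    List.length_flatMap, List.length_singleton] at h1 ⊢
  omega

lemma one_le_length_encode (M : PTM) : 1 ≤ M.encode.length := by
  simp [encode]; omega

end PTM

/-- If some machine outputs `x` at all, then the minimum in the definition of `rKt x` is attained. -/
lemma exists_rKt_eq {x : List Bool} {M : PTM} {a : List Bool} {t : ℕ} (ht : 1 ≤ t)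
    (h : 2 / 3 ≤ M.outputProb a [] t x) :
    ∃ (M : PTM) (a : List Bool) (t : ℕ), 2 / 3 ≤ M.outputProb a [] t x ∧ 1 ≤ t ∧
      rKt x = M.encode.length + a.length + Nat.clog 2 t := by
  obtain ⟨M, a, t, h1, h2, h3⟩ := Nat.sInf_mem
    (s := {s : ℕ | ∃ (M : PTM) (a : List Bool) (t : ℕ), 1 ≤ t ∧ 2 / 3 ≤ M.outputProb a [] t x ∧
      s = M.encode.length + a.length + Nat.clog 2 t}) ⟨_, M, a, t, ht, h, rfl⟩
  exact ⟨M, a, t, h2, h1, h3⟩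

lemma rKt_le {x : List Bool} {M : PTM} {a : List Bool} {t : ℕ} (ht : 1 ≤ t)
    (h : 2 / 3 ≤ M.outputProb a [] t x) :
    rKt x ≤ M.encode.length + a.length + Nat.clog 2 t := Nat.sInf_le ⟨M, a, t, ht, h, rfl⟩

/-! ### Numerical estimates -/

lemma succ_le_mul_two_pow_div {c : ℕ} (hc : 0 < c) (n : ℕ) : n + 1 ≤ c * 2 ^ (n / c) := by
  have h1 : n / c + 1 ≤ 2 ^ (n / c) := Nat.lt_two_pow_self
  have h2 := Nat.div_add_mod n c
  have h3 := Nat.mod_lt n hc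
  have h4 := Nat.mul_le_mul_left c h1
  rw [mul_add] at h4
  omega

lemma pow_le_mul_two_pow {B K N c : ℕ} (h : B ≤ K * 2 ^ (N / (c + 1))) :
    B ^ c ≤ K ^ c * 2 ^ N := by
  refine (Nat.pow_le_pow_left h c).trans ?_
  rw [mul_pow, ← pow_mul]
  refine Nat.mul_le_mul_left _ (Nat.pow_le_pow_right (by norm_num) ?_)
  exact (Nat.mul_le_mul_left _ c.le_succ).trans (Nat.div_mul_le_self N (c + 1))

lemma log_two_eq (n : ℕ) : Nat.log 2 n = n.bits.length - 1 := by
  rw [Nat.size_eq_bits_len]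
  rcases Nat.eq_zero_or_pos n with rfl | hn
  · simp
  · have h1 : 0 < n.size := Nat.size_pos.2 hn
    refine (Nat.log_eq_iff (Or.inr ⟨by norm_num, hn.ne'⟩)).2 ⟨Nat.lt_size.1 (by omega), ?_⟩
    rw [Nat.sub_add_cancel h1]
    exact Nat.lt_size_self n

lemma length_bits_le_clog (n : ℕ) : n.bits.length ≤ Nat.clog 2 n + 1 := by
  rw [Nat.size_eq_bits_len, Nat.size_le]
  exact (Nat.le_pow_clog (by norm_num) n).trans_lt (Nat.pow_lt_pow_right (by norm_num) (by omega))

/-! ### The machines for the two implications -/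

namespace Transforms
variable {ι : Type*} {B : ι → ℕ} {F : ι → SExp}

lemma nat_succ {m : ι → ℕ} (h : Transforms B F fun i => ofNat (m i)) :
    Transforms B F fun i => ofNat (m i + 1) :=
  (Transforms.const h.bdd_left nil).cons h

lemma nat_add {m n : ι → ℕ} (h : Transforms B F fun i => ofNat (m i))
    (h' : Transforms B F fun i => ofNat (n i)) : Transforms B F fun i => ofNat (m i + n i) := by
  have := Transforms.app (f := fun y => addLen y.hd y.tl) (by fun_prop) (h.cons h')
  simpa only [hd_cons, tl_cons, addLen_ofNat] using this

lemma nat_mul {m n : ι → ℕ} (h : Transforms B F fun i => ofNat (m i))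
    (h' : Transforms B F fun i => ofNat (n i)) : Transforms B F fun i => ofNat (m i * n i) := by
  have := Transforms.app (f := fun y => mulNat y.hd y.tl) (by fun_prop) (h.cons h')
  simpa only [hd_cons, tl_cons, mulNat_ofNat] using this

lemma length {l : ι → List Bool} (h : Transforms B F fun i => ofBits (l i)) :
    Transforms B F fun i => ofNat (l i).length := by
  have := Transforms.app (f := fun y => addLen y (ofNat 0)) (by fun_prop) h
  simpa only [addLen_ofBits, add_zero] using this

end Transforms

lemma PolyBdd.size_ofBits {ι : Type*} {B : ι → ℕ} {l : ι → List Bool}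
    (h : PolyBdd B fun i => (l i).length) : PolyBdd B fun i => (ofBits (l i)).size :=
  (((PolyBdd.const 4).mul h).add (.const 1)).mono fun _ => SExp.size_ofBits _

lemma PolyBdd.size_cons {ι : Type*} {B : ι → ℕ} {F G : ι → SExp} (h : PolyBdd B fun i => (F i).size)
    (h' : PolyBdd B fun i => (G i).size) : PolyBdd B fun i => (SExp.cons (F i) (G i)).size :=
  ((h.add h').add (.const 1)).mono fun _ => by simp

lemma PolyBdd.two_pow_mul {ι : Type*} {B m : ι → ℕ} (h : PolyBdd B fun i => 2 ^ m i) (K : ℕ) :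
    PolyBdd B fun i => 2 ^ (K * (m i + 1)) :=
  (((PolyBdd.const 2).mul h).pow K).mono fun i => by rw [← pow_succ', ← pow_mul, mul_comm]

/-- A machine that constructs the truth tables of a language which another machine decides. -/
lemma exists_truthTable_machine (M : PTM) (K : ℕ) :
    ∃ (N : PTM) (c : ℕ), ∀ m : ℕ,
      N.HaltsWithin (List.replicate m true) [] (2 ^ (c * (m + 1))) ∧ ∀ b : ℕ → Bool,
        (∀ j, 2 / 3 ≤ prob (2 ^ (K * (m + 1)))
          fun r => M.vote (digits (Nat.log 2 m) j) [] r = b j) →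
        2 / 3 ≤ N.outputProb (List.replicate m true) [] (2 ^ (c * (m + 1)))
          ((List.range' 0 m).map b) := by
  have hB : PolyBdd (fun m => 2 ^ m) fun m => m := .of_le fun m => Nat.lt_two_pow_self.le
  let F : ℕ → SExp := fun m => .cons nil (.cons (ofBits (List.replicate m true)) (ofBits []))
  have h0 : Transforms (fun m => 2 ^ m) F F :=
    .refl ((PolyBdd.const 1).size_cons ((PolyBdd.size_ofBits (by simpa using hB)).size_cons
      (.const 1)))
  have hm : Transforms (fun m => 2 ^ m) F fun m => ofNat m := by
    simpa using Transforms.length (l := fun m => List.replicate m true) h0.tl.hd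
  have hT := ((Transforms.const h0.bdd_left (ofNat K)).nat_mul hm.nat_succ).two_pow
    (PolyBdd.self.two_pow_mul K)
  obtain ⟨c, hc⟩ := exists_table_machine (M := fun _ => M) (α := fun _ => [])
    (((Transforms.const h0.bdd_left M.desc).cons (hT.cons (Transforms.const h0.bdd_left nil))).cons
      (hm.cons hm.log_two))
  obtain ⟨N, hN⟩ := hc nil
  refine ⟨N, 2 * c, fun m => hN m rfl _ ?_⟩
  have h1 : 2 ^ m + 2 ≤ 2 ^ (2 * (m + 1)) := by
    have : 1 ≤ 2 ^ m := Nat.one_le_two_pow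
    rw [show 2 * (m + 1) = m + 2 + m by ring, pow_add, pow_add]
    nlinarith
  calc (2 ^ m + 2) ^ c ≤ (2 ^ (2 * (m + 1))) ^ c := Nat.pow_le_pow_left h1 c
    _ = 2 ^ (2 * c * (m + 1)) := by rw [← pow_mul]; ring_nf

/-- A machine that finds in the advice the description `D` of a machine, an input for it, and the
time `t` in binary, and looks up its own input in the truth table that is the output. -/
lemma exists_advice_machine : ∃ (N : PTM) (c : ℕ), ∀ (x : List Bool) (pad : ℕ) (D : SExp) (t : ℕ),
    D.tl.tl = ofBits t.bits → ∀ T, (D.size + x.length + pad + t + 2) ^ c ≤ T →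
      N.HaltsWithin x (D.code ++ List.replicate pad false) T ∧ ∀ w : List Bool,
        2 / 3 ≤ prob t (fun r => simOut D.hd D.tl.hd (ofNat t) (ofBits r) = ofBits w.reverse) →
        2 / 3 ≤ N.outputProb x (D.code ++ List.replicate pad false) T [lookupBits x 0 w false] := by
  let ι := {p : (List Bool × ℕ) × (SExp × ℕ) // p.2.1.tl.tl = ofBits p.2.2.bits}
  let B : ι → ℕ := fun p => p.1.2.1.size + p.1.1.1.length + p.1.1.2 + p.1.2.2
  let F : ι → SExp := fun p => .cons nil (.cons (ofBits p.1.1.1)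
    (ofBits (p.1.2.1.code ++ List.replicate p.1.1.2 false)))
  have h0 : Transforms B F F :=
    .refl ((PolyBdd.const 1).size_cons ((PolyBdd.size_ofBits (.of_le fun p => by
      simp only [B]; omega)).size_cons (PolyBdd.size_ofBits (.of_le fun p => by
      change _ ≤ p.1.2.1.code.length + p.1.1.1.length + p.1.1.2 + p.1.2.2
      simp only [List.length_append, List.length_replicate]
      omega))))
  have hD := Transforms.app (f := parse) (by fun_prop) h0.tl.tl
  simp only [F, tl_cons, parse_code] at hD
  have ht : (fun p : ι => p.1.2.1.tl.tl) = fun p => ofBits p.1.2.2.bits := funext Subtype.prop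
  have hT : Transforms B F fun p : ι => ofNat p.1.2.2 := Transforms.ofBinary (ht ▸ hD.tl.tl) (.of_le fun p => by simp only [B]; omega)
  obtain ⟨c, hc⟩ := exists_lookup_machine (hT.cons (hD.hd.cons hD.tl.hd))
  obtain ⟨N, hN⟩ := hc nil
  exact ⟨N, c, fun x pad D t h T hT => hN ⟨((x, pad), (D, t)), h⟩ rfl T hT⟩

/-- Machines that compute the beginning of the truth table of the function that `M` computes on
inputs of length `n` with advice `α` within `c * 2 ^ (|α| + 1) + c` steps. Their inputs consist of
`n` in binary and `α`. -/
lemma exists_compressing_machine : ∃ c₀, ∀ (M : PTM) (c C : ℕ), ∃ N : PTM, ∀ (n : ℕ) (α : List Bool),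
    ∃ a : List Bool, a.length ≤ 4 * n.bits.length + 4 * α.length + 3 ∧
    ∀ T, (M.desc.size + c + C + n + 2 ^ α.length + 2) ^ c₀ ≤ T → ∀ b : ℕ → Bool,
      (∀ j, 2 / 3 ≤ prob (c * 2 ^ (α.length + 1) + c) fun r => M.vote (digits n j) α r = b j) →
      2 / 3 ≤ N.outputProb a [] T ((List.range' 0 (C * α.length)).map b) := by
  let ι := ((PTM × ℕ × ℕ) × ℕ × List Bool)
  let e : ι → SExp := fun p => .cons p.1.1.desc (.cons (ofNat p.1.2.1) (ofNat p.1.2.2))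
  let a : ι → SExp := fun p => .cons (ofBits p.2.1.bits) (ofBits p.2.2)
  let B : ι → ℕ := fun p => p.1.1.desc.size + p.1.2.1 + p.1.2.2 + p.2.1 + 2 ^ p.2.2.length
  have ha : ∀ p : ι, (a p).size ≤ 4 * p.2.1.bits.length + 4 * p.2.2.length + 3 := fun p => by
    have := SExp.size_ofBits p.2.1.bits
    have := SExp.size_ofBits p.2.2
    simp only [a, SExp.size_cons]
    omega
  have hn : ∀ n : ℕ, n.bits.length ≤ n := fun n => by
    rw [Nat.size_eq_bits_len, Nat.size_le]; exact Nat.lt_two_pow_self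
  have hα : ∀ p : ι, p.2.2.length ≤ 2 ^ p.2.2.length := fun p => Nat.lt_two_pow_self.le
  have hBa : PolyBdd B fun p => (a p).size :=
    (((PolyBdd.const 4).mul .self).add (.const 3)).mono fun p => by
      have := ha p
      have := hn p.2.1
      have := hα p
      simp only [B]
      omega
  have hBe : PolyBdd B fun p => (e p).size :=
    (((PolyBdd.const 2).mul .self).add (.const 4)).mono fun p => by
      have := Nat.two_pow_pos p.2.2.length
      simp only [B, e, SExp.size_cons, size_ofNat]
      omega
  let F : ι → SExp := fun p => .cons (e p) (.cons (ofBits (a p).code) (ofBits []))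
  have h0 : Transforms B F F :=
    .refl (hBe.size_cons ((PolyBdd.size_ofBits (l := fun p => (a p).code) hBa).size_cons (.const 1)))
  have he : Transforms B F e := h0.hd
  have hp := Transforms.app (f := parse) (by fun_prop) h0.tl.hd
  have e1 : ∀ p : ι, parse (ofBits (a p).code) = a p := fun p => by
    simpa using parse_code (a p) []
  simp only [F, tl_cons, hd_cons, e1] at hp
  have hc : Transforms B F fun p : ι => ofNat p.1.2.1 := he.tl.hd
  have hC : Transforms B F fun p : ι => ofNat p.1.2.2 := he.tl.tl
  have hx : Transforms B F fun p : ι => ofNat p.2.1 := Transforms.ofBinary (n := fun p : ι => p.2.1)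
    hp.hd (.of_le fun p => Nat.le_add_right_of_le (Nat.le_add_left _ _))
  have hl : Transforms B F fun p : ι => ofNat p.2.2.length := Transforms.length
    (l := fun p : ι => p.2.2) hp.tl
  have hT := (hc.nat_mul (hl.nat_succ.two_pow (by
    simpa only [one_mul] using PolyBdd.two_pow_mul (.of_le fun p => by
      simp only [B]; omega) 1))).nat_add hc
  obtain ⟨c₀, h⟩ := exists_table_machine (M := fun p : ι => p.1.1) (α := fun p => p.2.2)
    ((he.hd.cons (hT.cons hp.tl)).cons ((hC.nat_mul hl).cons hx))
  refine ⟨c₀, fun M c C => ?_⟩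
  obtain ⟨N, hN⟩ := h (e ((M, c, C), 0, []))
  exact ⟨N, fun n α => ⟨_, ha ((M, c, C), n, α), fun T hT =>
    (hN ((M, c, C), n, α) rfl T hT).2⟩⟩

/-- A simulation that runs until the simulated machine halts. -/
lemma Transforms.simulate {ι : Type*} {B : ι → ℕ} {F : ι → SExp} {M : ι → PTM}
    {x y : ι → List Bool} {T : ι → ℕ}
    (h : Transforms B F fun i => .cons (M i).desc (ofBits (x i))) (hT : PolyBdd B T)
    (hh : ∀ i, ((M i).runList (x i) [] (List.replicate (T i) false)).state = none)
    (hy : ∀ i, ((M i).runList (x i) [] (List.replicate (T i) false)).out = y i) :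
    Transforms B F fun i => ofBits (y i).reverse := by
  classical
  let g : SExp → SExp := fun s => .cons (simStep s.tl.hd nil s.tl.tl).hd
    (.cons s.tl.hd (simStep s.tl.hd nil s.tl.tl))
  let c : ι → ℕ → SExp := fun i j => (simStep (M i).table nil)^[j]
    (simInit (M i).desc (ofBits (x i)) nil)
  have hc : ∀ i j, PTM.Represents ((M i).runList (x i) [] (List.replicate j false)) (c i j) := by
    intro i j
    induction j with
    | zero => exact PTM.represents_init (M i) (x i) []
    | succ j ih =>
      have := ih.step false
      simp only [c, Function.iterate_succ_apply']
      rw [List.replicate_succ', PTM.runList, List.foldl_append]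
      exact this
  have hg : ∀ i j, g^[j] (.cons (c i 0).hd (.cons (M i).table (c i 0))) =
      .cons (c i j).hd (.cons (M i).table (c i j)) := by
    intro i j
    induction j with
    | zero => rfl
    | succ j ih =>
      rw [Function.iterate_succ_apply', ih]
      simp only [c, Function.iterate_succ_apply']
      rfl
  have hsize : ∀ i j, (c i j).size ≤ (c i 0).size +
      j * ((M i).table.size * ((M i).table.size + 10) + 2 * (M i).table.size + 10) := by
    intro i j
    induction j with
    | zero => simp
    | succ j ih =>
      have := size_simStep_le (M i).table nil (c i j)
      simp only [c, Function.iterate_succ_apply'] at *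
      rw [add_mul]
      omega
  have hhd : ∀ i j, (c i j).hd = nil ↔
      ((M i).runList (x i) [] (List.replicate j false)).state = none := by
    intro i j
    obtain ⟨L, R, -, e⟩ := hc i j
    rw [e, hd_cons]
    cases ((M i).runList (x i) [] (List.replicate j false)).state <;> simp [PTM.stateTree]
  have hex : ∀ i, ∃ j, (c i j).hd = nil := fun i => ⟨T i, (hhd i _).2 (hh i)⟩
  have hle : ∀ i, Nat.find (hex i) ≤ T i := fun i => Nat.find_le ((hhd i _).2 (hh i))
  have hout : ∀ i, (c i (Nat.find (hex i))).tl.tl = ofBits (y i).reverse := by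
    intro i
    rw [(hc i _).out, ← hy i]
    obtain ⟨l, hl⟩ := Nat.exists_eq_add_of_le (hle i)
    conv_rhs => rw [hl, List.replicate_add, PTM.runList_append_of_halted
      ((hhd i _).1 (Nat.find_spec (hex i)))]
  have h1 : Transforms B F fun i => .cons (c i 0).hd (.cons (M i).table (c i 0)) :=
    Transforms.app (f := fun y => .cons (simInit y.hd y.tl nil).hd
      (.cons y.hd.tl (simInit y.hd y.tl nil))) (by fun_prop) h
  have h2 := Transforms.iterateWhile (B := B) (f := g)
    (F := fun i => .cons (c i 0).hd (.cons (M i).table (c i 0)))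
    (by simp only [g]; fun_prop) (fun i => Nat.find (hex i)) (hT.mono hle)
    (fun i => 2 * ((c i 0).size + T i *
      ((M i).table.size * ((M i).table.size + 10) + 2 * (M i).table.size + 10)) +
      (M i).table.size + 2)
    (((((PolyBdd.const 2).mul (h1.tl.tl.bdd.add (hT.mul
      (((h1.tl.hd.bdd.mul (h1.tl.hd.bdd.add (.const 10))).add
        ((PolyBdd.const 2).mul h1.tl.hd.bdd)).add (.const 10))))).add h1.tl.hd.bdd).add (.const 2)))
    (fun i j hj => by
      rw [hg]
      have h3 := hsize i j
      have h4 := Nat.mul_le_mul_right ((M i).table.size * ((M i).table.size + 10) +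
        2 * (M i).table.size + 10) (hj.trans (hle i))
      have h5 := size_hd_le (c i j)
      simp only [SExp.size_cons]
      omega)
    (fun i j hj => by rw [hg]; exact Nat.find_min (hex i) hj)
    (fun i => by rw [hg]; exact Nat.find_spec (hex i))
  have h3 := (h1.trans h2).tl.tl.tl.tl
  simp only [hg, tl_cons, hout] at h3
  exact h3

lemma Transforms.replicate_true {ι : Type*} {B : ι → ℕ} {F : ι → SExp} {m : ι → ℕ}
    (h : Transforms B F fun i => ofNat (m i)) :
    Transforms B F fun i => ofBits (List.replicate (m i) true) := by
  have h1 := Transforms.app (f := fun y => SExp.fold (fun _ s => .cons (ofBool true) s) y nil)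
    (polyTime_fold' (by fun_prop) ⟨5, fun u s => by
      have := le_pow_five 4 u.size (by norm_num)
      simp [ofBool]; omega⟩ (by fun_prop) (by fun_prop)) h
  have e : ∀ n, SExp.fold (fun _ s => .cons (ofBool true) s) (ofNat n) nil =
      ofBits (List.replicate n true) := fun n => by
    rw [fold_ofNat]
    induction n with
    | zero => rfl
    | succ n ih => rw [Function.iterate_succ_apply', ih, List.replicate_succ, ofBits_cons]
  simpa only [e] using h1

/-- Machines that compute `τ = t (|x|)` with the help of `M`, simulate `A` on `1 ^ m`, where
`m = C * log τ`, and look up the input `x` in the truth table that is the output. -/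
lemma exists_hierarchy_machine (A : PTM) (cA C : ℕ) : ∃ c, ∀ (M : PTM), ∃ N : PTM,
    ∀ (τ T : ℕ) (x : List Bool), M.HaltsWithin (List.replicate x.length true) [] T →
      (∀ r : Fin T → Bool, (M.run (List.replicate x.length true) [] r).out = τ.bits) →
      ∀ T', (M.desc.size + T + x.length + 2 ^ (cA * (C * Nat.log 2 τ + 1)) + 2) ^ c ≤ T' →
      N.HaltsWithin x [] T' ∧ ∀ w : List Bool,
        2 / 3 ≤ A.outputProb (List.replicate (C * Nat.log 2 τ) true) []
          (2 ^ (cA * (C * Nat.log 2 τ + 1))) w →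
        2 / 3 ≤ N.outputProb x [] T' [lookupBits x 0 w false] := by
  let ι := {p : (PTM × List Bool) × ℕ × ℕ //
    (p.1.1.runList (List.replicate p.1.2.length true) [] (List.replicate p.2.2 false)).state = none ∧
    (p.1.1.runList (List.replicate p.1.2.length true) [] (List.replicate p.2.2 false)).out =
      p.2.1.bits}
  let B : ι → ℕ := fun p => p.1.1.1.desc.size + p.1.2.2 + p.1.1.2.length +
    2 ^ (cA * (C * Nat.log 2 p.1.2.1 + 1))
  have hB : ∀ p, p.1.1.1.desc.size + p.1.2.2 + p.1.1.2.length ≤ B p := fun p => Nat.le_add_right _ _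
  let F : ι → SExp := fun p => .cons p.1.1.1.desc (.cons (ofBits p.1.1.2) (ofBits []))
  have h0 : Transforms B F F :=
    .refl ((PolyBdd.of_le fun p => by have := hB p; omega).size_cons ((PolyBdd.size_ofBits
      (.of_le fun p => by have := hB p; omega)).size_cons (.const 1)))
  have hn : Transforms B F fun p : ι => ofNat p.1.1.2.length :=
    Transforms.length (l := fun p : ι => p.1.1.2) h0.tl.hd
  have hb := Transforms.simulate (M := fun p : ι => p.1.1.1) (T := fun p => p.1.2.2)
    (h0.hd.cons hn.replicate_true) (.of_le fun p => by have := hB p; omega)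
    (fun p => p.2.1) (fun p => p.2.2)
  have hlog : Transforms B F fun p : ι => ofNat (Nat.log 2 p.1.2.1) := by
    have h1 := hb.length.tl
    have : ∀ n, (ofNat n).tl = ofNat (n - 1) := fun n => by cases n <;> rfl
    simpa only [this, List.length_reverse, ← log_two_eq] using h1
  have hm := (Transforms.const h0.bdd_left (ofNat C)).nat_mul hlog
  have hT := ((Transforms.const h0.bdd_left (ofNat cA)).nat_mul hm.nat_succ).two_pow
    (.of_le fun p => Nat.le_add_left _ _)
  obtain ⟨c, hc⟩ := exists_lookup_machine (D := fun _ => A.desc)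
    (hT.cons ((Transforms.const h0.bdd_left A.desc).cons hm.replicate_true))
  refine ⟨c, fun M => (hc M.desc).imp fun N hN τ T x h1 h2 T' hT' => ?_⟩
  have h3 : M.runList (List.replicate x.length true) [] (List.replicate T false) =
      M.run (List.replicate x.length true) [] fun _ : Fin T => false := by
    rw [PTM.run, List.ofFn_const]; rfl
  obtain ⟨h4, h5⟩ := hN ⟨((M, x), (τ, T)), by rw [h3]; exact h1 _, by rw [h3]; exact h2 _⟩ rfl T' hT'
  refine ⟨h4, fun w hw => h5 w ?_⟩
  rw [PTM.outputProb_eq] at hw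
  refine hw.trans (prob_mono fun r hr hr' => ?_)
  rw [← hr, PTM.simOut_desc, hr']

lemma bits_two_pow (n : ℕ) : (2 ^ n).bits = List.replicate n false ++ [true] := by
  induction n with
  | zero => simp
  | succ n ih =>
    rw [pow_succ', Nat.bit0_bits _ (by positivity), ih]
    rfl

lemma timeConstructible_two_pow_two_pow (j : ℕ) : TimeConstructible fun n => 2 ^ 2 ^ (n - j) := by
  let B : ℕ → ℕ := fun n => 2 ^ (n - j) + n
  let F : ℕ → SExp := fun n => .cons nil (.cons (ofBits (List.replicate n true)) (ofBits []))
  have h0 : Transforms B F F :=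
    .refl ((PolyBdd.const 1).size_cons ((PolyBdd.size_ofBits (.of_le fun n => by
      simp [B])).size_cons (.const 1)))
  have hn : Transforms B F fun n => ofNat n := by
    simpa using Transforms.length (l := fun n => List.replicate n true) h0.tl.hd
  have hd := Transforms.app (f := fun y => dropAs (ofNat j) y) (by fun_prop) hn
  simp only [dropAs_ofNat_ofNat] at hd
  have hb := Transforms.app (f := fun y => addLen y (ofBits [true])) (by fun_prop)
    (hd.two_pow (.of_le fun n => by simp [B]))
  have e : ∀ n, addLen (ofNat n) (ofBits [true]) = ofBits (2 ^ n).bits := fun n => by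
    rw [bits_two_pow, addLen, fold_ofNat]
    induction n with
    | zero => rfl
    | succ n ih => rw [Function.iterate_succ_apply', ih, List.replicate_succ]; rfl
  simp only [e] at hb
  obtain ⟨c, hc⟩ := Transforms.exists_machine_aux (G := fun n _ => (2 ^ 2 ^ (n - j)).bits)
    (fun _ => false) ((Transforms.const h0.bdd_left (ofNat 0)).cons hb) (by
      have := (Transforms.refl (F := fun s : (n : ℕ) × {r : List Bool // r.length = 0} =>
        SExp.cons (ofBits (s.2.1.map fun _ => false)) (ofBits (2 ^ 2 ^ (s.1 - j)).bits))
        (B := fun s => B s.1) (((PolyBdd.const 1).mono fun s => by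
          rw [List.length_eq_zero_iff.1 s.2.2]; rfl).size_cons (hb.bdd.comp Sigma.fst))).tl
      simpa only [tl_cons] using this)
  obtain ⟨M, hM, h⟩ := hc nil
  refine ⟨M, hM fun _ _ => rfl, ((j + 2) * (c + 1)) ^ c, fun n => ?_⟩
  have hT : (B n + 2) ^ c ≤ ((j + 2) * (c + 1)) ^ c * 2 ^ 2 ^ (n - j) +
      ((j + 2) * (c + 1)) ^ c := by
    refine le_trans (pow_le_mul_two_pow ?_) (Nat.le_add_right _ _)
    have h1 := Nat.mul_le_mul_left (j + 2) (succ_le_mul_two_pow_div c.succ_pos (2 ^ (n - j)))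
    rw [← mul_assoc] at h1
    refine le_trans ?_ h1
    have h2 : n - j < 2 ^ (n - j) := Nat.lt_two_pow_self
    dsimp only [B]
    have h3 : n ≤ n - j + j := by omega
    nlinarith
  obtain ⟨k, m, hk, h⟩ := h n rfl
  have h1 : M.HaltsWithin (List.replicate n true) [] ((B n + 2) ^ c) :=
    (M.haltsWithin_iff _ _ _).2 fun ρ hρ => (h ρ hρ).1
  refine ⟨h1.mono hT, fun r => ?_⟩
  have hl : ((List.ofFn r).take ((B n + 2) ^ c)).length = (B n + 2) ^ c := by
    rw [List.length_take, List.length_ofFn]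
    exact min_eq_left hT
  obtain ⟨h2, h3⟩ := h _ hl
  change (M.runList (List.replicate n true) [] (List.ofFn r)).out = _
  rw [← List.take_append_drop ((B n + 2) ^ c) (List.ofFn r), PTM.runList_append_of_halted h2, h3]

/-! ### The two implications -/

/-- Truth tables of hard languages have large `rKt` complexity. Otherwise, for infinitely many lengths,
the best programs for them are short advice that makes the language easy on these lengths. -/
lemma exists_lt_mul_rKt : ∃ Q : ℕ, ∀ (j : ℕ) (L : Language Bool) (w : ℕ → List Bool),
    (∀ m, ∃ (M : PTM) (a : List Bool) (t : ℕ), 1 ≤ t ∧ 2 / 3 ≤ M.outputProb a [] t (w m)) →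
    (∀ (m : ℕ) (x : List Bool), m ≠ 0 → x.length = Nat.log 2 m →
      (lookupBits x 0 (w m) false = true ↔ x ∈ L)) →
    L ∉ infinitelyOften (BPTIMEAdvice (fun n => 2 ^ 2 ^ (n - j))
      fun n => Nat.log 2 (2 ^ 2 ^ (n - j))) →
    ∃ n₀, ∀ m, m ≠ 0 → n₀ ≤ Nat.log 2 m → 2 ^ (Nat.log 2 m - j) < Q * rKt (w m) := by
  classical
  obtain ⟨N, c, hN⟩ := exists_advice_machine
  refine ⟨c + 14, fun j L w hw hlook hL => ?_⟩
  by_contra! hcon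
  refine hL ?_
  let good : ℕ → ℕ → Prop := fun n m => m ≠ 0 ∧ Nat.log 2 m = n ∧
    (c + 14) * rKt (w m) ≤ 2 ^ (n - j)
  let L' : Language Bool := {x | (∃ m, good x.length m) ∧ x ∈ L}
  -- For every length there is an advice string with its description, time bound, and result.
  have key : ∀ n, ∃ (D : SExp) (t : ℕ) (v : List Bool), D.tl.tl = ofBits t.bits ∧
      D.size ≤ 2 ^ (n - j) ∧ t ≤ 2 ^ (2 ^ (n - j) / (c + 1)) ∧
      2 / 3 ≤ prob t (fun r => simOut D.hd D.tl.hd (ofNat t) (ofBits r) = ofBits v.reverse) ∧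
      ∀ x : List Bool, x.length = n → (lookupBits x 0 v false = true ↔ x ∈ L') := by
    intro n
    by_cases h : ∃ m, good n m
    · obtain ⟨m, hm, hn, hs⟩ := h
      obtain ⟨M₀, a₀, t₀, ht₀, h₀⟩ := hw m
      obtain ⟨M, a, t, h1, h2, h3⟩ := exists_rKt_eq ht₀ h₀
      refine ⟨.cons M.desc (.cons (ofBits a) (ofBits t.bits)), t, w m, rfl, ?_, ?_, ?_, ?_⟩
      · have h4 := M.size_desc_le
        have h5 := SExp.size_ofBits a
        have h6 := SExp.size_ofBits t.bits
        have h7 := length_bits_le_clog t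
        have h8 := M.one_le_length_encode
        have h9 : 14 * rKt (w m) ≤ (c + 14) * rKt (w m) := Nat.mul_le_mul_right _ (by omega)
        simp only [SExp.size_cons]
        omega
      · refine (Nat.le_pow_clog (by norm_num : 1 < 2) t).trans
          (Nat.pow_le_pow_right (by norm_num) ?_)
        rw [Nat.le_div_iff_mul_le (by omega)]
        have h4 : rKt (w m) * (c + 1) ≤ (c + 14) * rKt (w m) := by nlinarith
        have h5 : Nat.clog 2 t * (c + 1) ≤ rKt (w m) * (c + 1) := Nat.mul_le_mul_right _ (by omega)
        omega
      · rw [PTM.outputProb_eq] at h1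
        refine h1.trans (prob_mono fun r hr hr' => ?_)
        subst hr
        exact (PTM.simOut_desc M a r).trans (by rw [hr'])
      · intro x hx
        rw [hlook m x hm (hx.trans hn.symm)]
        exact ⟨fun h => ⟨⟨m, hm, hn.trans hx.symm, by rw [hx]; exact hs⟩, h⟩, fun h => h.2⟩
    · refine ⟨nil, 0, [], by simp, ?_, by positivity, ?_, ?_⟩
      · exact Nat.one_le_two_pow
      · rw [prob_true (fun r _ => ?_)]
        · norm_num
        · rfl
      · rintro x rfl
        exact ⟨fun h' => (Bool.false_ne_true h').elim, fun h' => (h h'.1).elim⟩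
  choose D t v h1 h2 h3 h4 h5 using key
  refine ⟨L', ⟨N, (2 * j + 10 + 3 * (c + 1)) ^ c, fun n => (D n).code ++
    List.replicate (2 ^ (n - j) - (D n).size) false, fun n => ?_, fun x => ?_⟩, ?_⟩
  · have := h2 n
    change _ = Nat.log 2 (2 ^ 2 ^ (n - j))
    rw [Nat.log_pow (by norm_num : 1 < 2), List.length_append, List.length_replicate]
    exact Nat.add_sub_cancel' this
  · have hT : ((D x.length).size + x.length + (2 ^ (x.length - j) - (D x.length).size) +
        t x.length + 2) ^ c ≤ (2 * j + 10 + 3 * (c + 1)) ^ c * 2 ^ 2 ^ (x.length - j) +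
        (2 * j + 10 + 3 * (c + 1)) ^ c := by
      refine le_trans (pow_le_mul_two_pow ?_) (Nat.le_add_right _ _)
      have e1 := succ_le_mul_two_pow_div c.succ_pos (2 ^ (x.length - j))
      have e2 := h2 x.length
      have e3 := h3 x.length
      have e4 : x.length - j < 2 ^ (x.length - j) := Nat.lt_two_pow_self
      have e5 : x.length ≤ x.length - j + j := by omega
      have e6 : 1 ≤ 2 ^ (2 ^ (x.length - j) / (c + 1)) := Nat.one_le_two_pow
      simp only [Nat.succ_eq_add_one] at e1
      generalize 2 ^ (2 ^ (x.length - j) / (c + 1)) = P at *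
      generalize 2 ^ (x.length - j) = R at *
      calc _ ≤ 2 * R + j + P + 2 := by omega
        _ ≤ _ := by nlinarith
    obtain ⟨h6, h7⟩ := hN x _ _ _ (h1 x.length) _ hT
    refine ⟨h6, ?_⟩
    have := h7 _ (h4 x.length)
    convert this using 3
    rw [← Bool.coe_iff_coe]
    simp only [decide_eq_true_eq]
    exact (h5 x.length x rfl).symm
  · rw [Filter.frequently_atTop]
    intro n₀
    obtain ⟨m, hm, hn, hs⟩ := hcon n₀
    exact ⟨_, hn, fun x hx => ⟨fun h => ⟨⟨m, hm, hx.symm, by rw [hx]; exact hs⟩, h⟩, fun h => h.2⟩⟩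

/-- A time hierarchy theorem for the time bounds `2 ^ 2 ^ (n - j)` yields a construction of strings of
large `rKt` complexity. -/
lemma exists_construction_of_hierarchy {k : ℕ} {lam : ℝ} (hlam : 0 < lam)
    (H : ∀ t : ℕ → ℕ, TimeConstructible t →
      (∀ᶠ n : ℕ in Filter.atTop, n ≤ t n ∧ (t n : ℝ) ≤ (2 : ℝ) ^ (lam * (2 : ℝ) ^ n)) →
      ∃ L : Language Bool, L ∈ BPTIME (fun n => t n ^ k) ∧
        L ∉ infinitelyOften (BPTIMEAdvice t (fun n => Nat.log 2 (t n)))) :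
    ∃ ε : ℝ, 0 < ε ∧ ∃ (A : PTM) (c : ℕ), ∀ m : ℕ,
      A.HaltsWithin (List.replicate m true) [] (2 ^ (c * (m + 1))) ∧
      ∃ w : List Bool, w.length = m ∧
        2 / 3 ≤ A.outputProb (List.replicate m true) [] (2 ^ (c * (m + 1))) w ∧
        ε * (m : ℝ) ≤ (rKt w : ℝ) := by
  classical
  obtain ⟨Q, hQ⟩ := exists_lt_mul_rKt
  obtain ⟨j, hj⟩ := exists_pow_lt_of_lt_one hlam (by norm_num : (1 / 2 : ℝ) < 1)
  have hexp : ∀ᶠ n : ℕ in Filter.atTop, n ≤ 2 ^ 2 ^ (n - j) ∧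
      ((2 ^ 2 ^ (n - j) : ℕ) : ℝ) ≤ (2 : ℝ) ^ (lam * (2 : ℝ) ^ n) := by
    filter_upwards [Filter.eventually_ge_atTop (2 * j)] with n hn
    obtain ⟨i, rfl⟩ := Nat.exists_eq_add_of_le (show j ≤ n by omega)
    rw [Nat.add_sub_cancel_left]
    constructor
    · have h1 : i + 1 ≤ 2 ^ i := Nat.lt_two_pow_self
      have h2 : 2 ^ (i + 1) ≤ 2 ^ 2 ^ i := Nat.pow_le_pow_right (by norm_num) h1
      rw [pow_succ] at h2
      omega
    · push_cast
      rw [← Real.rpow_natCast 2 (2 ^ i)]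
      refine Real.rpow_le_rpow_of_exponent_le (by norm_num) ?_
      have h1 : (1 / 2 : ℝ) ^ j * 2 ^ (j + i) = 2 ^ i := by
        rw [pow_add, ← mul_assoc, ← mul_pow]; norm_num
      push_cast
      rw [← h1]
      exact mul_le_mul_of_nonneg_right hj.le (by positivity)
  obtain ⟨L, ⟨M, c, hM⟩, hL⟩ := H _ (timeConstructible_two_pow_two_pow j) hexp
  obtain ⟨A, cA, hA⟩ := exists_truthTable_machine M (c + 1 + k)
  let w : ℕ → List Bool := fun m =>
    (List.range' 0 m).map fun i => decide (digits (Nat.log 2 m) i ∈ L)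
  have hw : ∀ m, 2 / 3 ≤ A.outputProb (List.replicate m true) [] (2 ^ (cA * (m + 1))) (w m) := by
    refine fun m => (hA m).2 _ fun i => ?_
    refine PTM.DecidesAt.two_thirds_le_prob_vote ((hM _).mono ?_) (by simp)
    rw [length_digits]
    have h1 : 2 ^ (Nat.log 2 m - j) ≤ m + 1 := by
      rcases eq_or_ne m 0 with rfl | hm
      · simp
      · exact (Nat.pow_le_pow_right (by norm_num) (Nat.sub_le _ _)).trans
          ((Nat.pow_log_le_self 2 hm).trans (Nat.le_succ m))
    have h2 : (2 ^ 2 ^ (Nat.log 2 m - j)) ^ k ≤ 2 ^ ((m + 1) * k) := by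
      rw [← pow_mul]
      exact Nat.pow_le_pow_right (by norm_num) (Nat.mul_le_mul_right k h1)
    have h3 : c < 2 ^ c := Nat.lt_two_pow_self
    have h4 : 1 ≤ 2 ^ ((m + 1) * k) := Nat.one_le_two_pow
    calc _ ≤ c * 2 ^ ((m + 1) * k) + c := by gcongr
      _ ≤ 2 ^ (c + 1) * 2 ^ ((m + 1) * k) := by rw [pow_succ]; nlinarith
      _ ≤ 2 ^ ((c + 1 + k) * (m + 1)) := by
        rw [← pow_add]
        refine Nat.pow_le_pow_right (by norm_num) ?_
        nlinarith [Nat.zero_le (c * m)]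
  have hpos : ∀ m, 1 ≤ rKt (w m) := fun m => by
    obtain ⟨M', a, t, -, -, h⟩ := exists_rKt_eq Nat.one_le_two_pow (hw m)
    have := M'.one_le_length_encode
    omega
  obtain ⟨n₀, hn₀⟩ := hQ j L w (fun m => ⟨A, _, _, Nat.one_le_two_pow, hw m⟩) (by
    intro m x hm hx
    obtain ⟨i, hi, hix⟩ := exists_digits x
    rw [lookupBits_map (v := decide (x ∈ L)) m 0 false]
    · simp
    · intro i _ _ h
      rw [← hx, h]
    · refine Or.inr ⟨i, Nat.zero_le _, ?_, hix⟩
      rw [hx] at hi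
      have := Nat.pow_log_le_self 2 hm
      omega) hL
  have hmain : ∀ m, m ≤ (Q * 2 ^ (j + 1) + 2 ^ n₀) * rKt (w m) := by
    intro m
    have h0 := hpos m
    rcases eq_or_ne m 0 with rfl | hm
    · exact Nat.zero_le _
    have h1 : m < 2 ^ (Nat.log 2 m + 1) := Nat.lt_pow_succ_log_self (by norm_num) m
    rcases le_or_gt n₀ (Nat.log 2 m) with h | h
    · have h2 := hn₀ m hm h
      have h3 : 2 ^ (Nat.log 2 m + 1) ≤ 2 ^ (j + 1) * 2 ^ (Nat.log 2 m - j) := by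
        rw [← pow_add]
        exact Nat.pow_le_pow_right (by norm_num) (by omega)
      have h4 := Nat.mul_le_mul_left (2 ^ (j + 1)) h2.le
      have h5 : 2 ^ (j + 1) * (Q * rKt (w m)) = Q * 2 ^ (j + 1) * rKt (w m) := by ring
      rw [add_mul]
      omega
    · have h2 : 2 ^ (Nat.log 2 m + 1) ≤ 2 ^ n₀ := Nat.pow_le_pow_right (by norm_num) h
      have h3 := Nat.mul_le_mul_left (2 ^ n₀) h0
      rw [add_mul]
      omega
  have hK : (0 : ℝ) < ((Q * 2 ^ (j + 1) + 2 ^ n₀ : ℕ) : ℝ) := by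
    have := Nat.two_pow_pos n₀
    exact_mod_cast (by omega : 0 < Q * 2 ^ (j + 1) + 2 ^ n₀)
  refine ⟨1 / ((Q * 2 ^ (j + 1) + 2 ^ n₀ : ℕ) : ℝ), by positivity, A, cA, fun m =>
    ⟨(hA m).1, w m, by simp [w], hw m, ?_⟩⟩
  rw [one_div, inv_mul_le_iff₀ hK]
  exact_mod_cast hmain m

/-- If lookup in `w` decides `L` on inputs of length `n`, then `w` begins the truth table of `L`. -/
lemma map_decide_eq_of_lookup [DecidablePred fun x : List Bool => x ∈ (L : Language Bool)]
    {w : List Bool} {n : ℕ} (hw : w.length ≤ 2 ^ n)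
    (h : ∀ x : List Bool, x.length = n → (x ∈ L ↔ lookupBits x 0 w false = true)) :
    (List.range' 0 w.length).map (fun i => decide (digits n i ∈ L)) = w := by
  have e : w = (List.range' 0 w.length).map fun i => w.getD i false := by
    refine List.ext_getElem (by simp) fun i h1 h2 => ?_
    simp [List.getElem?_eq_getElem h1]
  conv_rhs => rw [e]
  refine List.map_congr_left fun i hi => ?_
  rw [List.mem_range'_1] at hi
  rw [← Bool.coe_iff_coe]
  simp only [decide_eq_true_eq]
  rw [h _ (length_digits _ _), Bool.coe_iff_coe]
  conv_lhs => rw [e]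
  refine lookupBits_map _ _ _ (fun j _ hj hij => ?_) (Or.inr ⟨i, Nat.zero_le _, hi.2, by simp⟩)
  rw [length_digits] at hij
  rw [digits_injective (by omega) (by omega) hij]

/-- A construction of strings of large `rKt` complexity yields a time hierarchy theorem. -/
lemma exists_hierarchy_of_construction {ε : ℝ} (hε : 0 < ε) {A : PTM} {cA : ℕ}
    (hA : ∀ m : ℕ, A.HaltsWithin (List.replicate m true) [] (2 ^ (cA * (m + 1))) ∧
      ∃ w : List Bool, w.length = m ∧
        2 / 3 ≤ A.outputProb (List.replicate m true) [] (2 ^ (cA * (m + 1))) w ∧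
        ε * (m : ℝ) ≤ (rKt w : ℝ)) :
    ∃ k : ℕ, 1 ≤ k ∧ ∃ lam : ℝ, 0 < lam ∧ ∀ t : ℕ → ℕ, TimeConstructible t →
      (∀ᶠ n : ℕ in Filter.atTop, n ≤ t n ∧ (t n : ℝ) ≤ (2 : ℝ) ^ (lam * (2 : ℝ) ^ n)) →
      ∃ L : Language Bool, L ∈ BPTIME (fun n => t n ^ k) ∧
        L ∉ infinitelyOften (BPTIMEAdvice t (fun n => Nat.log 2 (t n))) := by
  classical
  choose hhalt w hlen hw hrKt using hA
  obtain ⟨c₀, hcomp⟩ := exists_compressing_machine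
  obtain ⟨C, hC⟩ := exists_nat_ge ((c₀ + 9) / ε)
  rw [div_le_iff₀ hε] at hC
  have hC0 : 0 < C := by
    rcases Nat.eq_zero_or_pos C with rfl | h
    · exfalso; push_cast at hC; linarith [(Nat.cast_nonneg c₀ : (0 : ℝ) ≤ c₀)]
    · exact h
  obtain ⟨c₁, hhier⟩ := exists_hierarchy_machine A cA C
  refine ⟨(cA * C + 1) * c₁ + 1, by omega, 1 / C, by positivity, fun t htc ht => ?_⟩
  have hlog : ∀ᶠ n : ℕ in Filter.atTop, n ≤ t n ∧ C * Nat.log 2 (t n) ≤ 2 ^ n := by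
    filter_upwards [ht, Filter.eventually_ge_atTop 1] with n hn h1
    refine ⟨hn.1, ?_⟩
    have h2 : ((2 ^ Nat.log 2 (t n) : ℕ) : ℝ) ≤ t n :=
      Nat.cast_le.2 (Nat.pow_log_le_self 2 (by omega))
    have h3 := h2.trans hn.2
    rw [Nat.cast_pow, Nat.cast_ofNat, ← Real.rpow_natCast,
      Real.rpow_le_rpow_left_iff (by norm_num), one_div, le_inv_mul_iff₀ (by positivity)] at h3
    exact_mod_cast h3
  obtain ⟨n₀, hn₀⟩ := Filter.eventually_atTop.1 hlog
  obtain ⟨M, -, ct, hM⟩ := htc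
  let L : Language Bool := {x | lookupBits x 0 (w (C * Nat.log 2 (t x.length))) false = true}
  refine ⟨L, ?_, ?_⟩
  · obtain ⟨N, hN⟩ := hhier M
    let B : ℕ → ℕ := fun n => M.desc.size + (ct * t n + ct) + n +
      2 ^ (cA * (C * Nat.log 2 (t n) + 1)) + 2
    have hB : ∃ K, ∀ n, B n ^ c₁ ≤ K * (t n ^ ((cA * C + 1) * c₁ + 1)) + K := by
      refine ⟨(M.desc.size + 2 * ct + 3 + 2 ^ cA) ^ c₁ +
        ∑ n ∈ Finset.range (n₀ + 1), B n ^ c₁, fun n => ?_⟩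
      rcases lt_or_ge n (n₀ + 1) with h | h
      · have := Finset.single_le_sum (f := fun n => B n ^ c₁) (fun _ _ => Nat.zero_le _)
          (Finset.mem_range.2 h)
        omega
      · have h1 := (hn₀ n (by omega)).1
        have h2 : 1 ≤ t n := by omega
        have h3 : 2 ^ (cA * (C * Nat.log 2 (t n) + 1)) ≤ 2 ^ cA * t n ^ (cA * C) := by
          rw [mul_add, mul_one, pow_add, mul_comm, ← mul_assoc, mul_comm (cA * C), pow_mul]
          exact Nat.mul_le_mul_left _ (Nat.pow_le_pow_left (Nat.pow_log_le_self 2 (by omega)) _)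
        have h4 : t n ^ (cA * C) ≤ t n ^ (cA * C + 1) := Nat.pow_le_pow_right h2 (by omega)
        have h5 : t n ≤ t n ^ (cA * C + 1) := Nat.le_self_pow (by omega) _
        have h6 : B n ≤ (M.desc.size + 2 * ct + 3 + 2 ^ cA) * t n ^ (cA * C + 1) := by
          have h7 := Nat.mul_le_mul_left (2 ^ cA) h4
          dsimp only [B]
          nlinarith [Nat.mul_le_mul_left ct h5, Nat.mul_le_mul_left ct (h2.trans h5),
            Nat.mul_le_mul_left M.desc.size (h2.trans h5)]
        calc B n ^ c₁ ≤ (M.desc.size + 2 * ct + 3 + 2 ^ cA) ^ c₁ *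
              t n ^ ((cA * C + 1) * c₁) := by
              rw [pow_mul, ← mul_pow]; exact Nat.pow_le_pow_left h6 _
          _ ≤ (M.desc.size + 2 * ct + 3 + 2 ^ cA) ^ c₁ * t n ^ ((cA * C + 1) * c₁ + 1) :=
              Nat.mul_le_mul_left _ (Nat.pow_le_pow_right h2 (Nat.le_succ _))
          _ ≤ _ := by
              rw [Nat.add_mul (_ ^ c₁)]
              exact Nat.le_add_right_of_le (Nat.le_add_right _ _)
    obtain ⟨K, hK⟩ := hB
    refine ⟨N, K, fun x => ?_⟩
    obtain ⟨h1, h2⟩ := hN (t x.length) (ct * t x.length + ct) x (hM _).1 (hM _).2 _ (hK x.length)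
    refine ⟨h1, ?_⟩
    convert h2 _ (hw _) using 3
    rw [← Bool.coe_iff_coe]
    simp only [decide_eq_true_eq]
    rfl
  · rintro ⟨L', ⟨M', c, α, hα, hM'⟩, hfreq⟩
    obtain ⟨N, hN⟩ := hcomp M' c C
    let K := M'.desc.size + c + C + 5
    obtain ⟨n, hLL', hn⟩ := (hfreq.and_eventually (Filter.eventually_ge_atTop
      (n₀ + 2 ^ (N.encode.length + 7 + c₀ * K + 1)))).exists
    obtain ⟨h1, h2⟩ := hn₀ n ((Nat.le_add_right _ _).trans hn)
    set l := Nat.log 2 (t n) with hl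
    have h3 : t n < 2 ^ (l + 1) := Nat.lt_pow_succ_log_self (by norm_num) _
    have h4 : N.encode.length + 7 + c₀ * K + 1 ≤ l :=
      Nat.le_log_of_pow_le (by norm_num) (by omega)
    obtain ⟨a, ha, hN⟩ := hN n (α n)
    have hαn : (α n).length = l := hα n
    rw [hαn] at ha hN
    have h5 : 2 / 3 ≤ N.outputProb a [] (2 ^ (c₀ * (K + l)))
        ((List.range' 0 (C * l)).map fun i => decide (digits n i ∈ L')) := by
      refine hN _ ?_ _ fun i => ?_
      · rw [mul_comm c₀, pow_mul]
        refine Nat.pow_le_pow_left ?_ _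
        have h6 : K < 2 ^ K := Nat.lt_two_pow_self
        have h7 : 1 ≤ 2 ^ l := Nat.one_le_two_pow
        rw [pow_succ] at h3
        calc _ ≤ K * 2 ^ l := by dsimp only [K]; nlinarith
          _ ≤ 2 ^ K * 2 ^ l := Nat.mul_le_mul_right _ h6.le
          _ = _ := (pow_add _ _ _).symm
      · have h6 := hM' (digits n i)
        rw [length_digits] at h6
        refine (h6.mono ?_).two_thirds_le_prob_vote (by simp)
        gcongr
    have h6 : (List.range' 0 (C * l)).map (fun i => decide (digits n i ∈ L')) = w (C * l) := by
      have := map_decide_eq_of_lookup (L := L') (w := w (C * l)) (n := n) (by rw [hlen]; exact h2)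
        (fun x hx => (hLL' x hx).symm.trans (by rw [hl, ← hx]; rfl))
      rwa [hlen] at this
    rw [h6] at h5
    have h7 := rKt_le Nat.one_le_two_pow h5
    rw [Nat.clog_pow _ _ (by norm_num)] at h7
    have h8 : n.bits.length ≤ l + 1 := by
      rw [Nat.size_eq_bits_len, Nat.size_le]
      omega
    -- The program is too short for the truth table, whose complexity is at least `(c₀ + 9) * l`.
    have h9 : (c₀ + 9) * l ≤ rKt (w (C * l)) := by
      have h10 := hrKt (C * l)
      have h11 : ((c₀ + 9) * l : ℝ) ≤ rKt (w (C * l)) := by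
        refine le_trans ?_ h10
        push_cast
        nlinarith [mul_le_mul_of_nonneg_right hC (Nat.cast_nonneg l : (0 : ℝ) ≤ l)]
      exact_mod_cast h11
    nlinarith

theorem theorem1p3 :
    -- (1) pseudodeterministic construction of strings of large `rKt` complexity
    (∃ ε : ℝ, 0 < ε ∧ ∃ (A : PTM) (c : ℕ), ∀ m : ℕ,
      A.HaltsWithin (List.replicate m true) [] (2 ^ (c * (m + 1))) ∧
      ∃ w : List Bool, w.length = m ∧
        2 / 3 ≤ A.outputProb (List.replicate m true) [] (2 ^ (c * (m + 1))) w ∧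
        ε * (m : ℝ) ≤ (rKt w : ℝ)) ↔
    -- (2) strong time hierarchy theorem for probabilistic computation
    (∃ k : ℕ, 1 ≤ k ∧ ∃ lam : ℝ, 0 < lam ∧ ∀ t : ℕ → ℕ, TimeConstructible t →
      (∀ᶠ n : ℕ in Filter.atTop, n ≤ t n ∧ (t n : ℝ) ≤ (2 : ℝ) ^ (lam * (2 : ℝ) ^ n)) →
      ∃ L : Language Bool, L ∈ BPTIME (fun n => t n ^ k) ∧
        L ∉ infinitelyOften (BPTIMEAdvice t (fun n => Nat.log 2 (t n)))) := by
  constructor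
  · rintro ⟨ε, hε, A, c, h⟩
    exact exists_hierarchy_of_construction hε h
  · rintro ⟨k, -, lam, hlam, H⟩
    exact exists_construction_of_hierarchy hlam H
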